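/- Let $\mathbb C^+$ be the upper half-plane. Let $H^1(\mathbb C^+)$ be the space of holomorphic $f$ on $\mathbb C^+$ with $\|f\|_{H^1}=\sup_{y>0}\int_{\mathbb R}|f(x+iy)|\,dx<\infty$, and write $f|_{\mathbb R}$ (or simply $f$ on $\mathbb R$) for the non-tangential boundary values. Let $\Theta$ be an inner function on $\mathbb C^+$, that is, a bounded holomorphic function with $|\Theta|=1$ a.e. on $\mathbb R$. Put $$H^1_\Theta=\Big\{f\in H^1(\mathbb C^+):\int_{\mathbb R} f\,\overline\Theta\,dx=0\Big\}$$ with the norm of $H^1(\mathbb C^+)$. For $u\in L^1(\mathbb R)\cup L^2(\mathbb R)$ let $P_+u(z)=\frac1{2\pi i}\int_{\mathbb R}\frac{u(t)}{t-z}\,dt$, $z\in\mathbb C^+$, and let $\mathcal S_+$ be the set of all $P_+\varphi$ with $\varphi$ a Schwartz function on $\mathbb R$ whose Fourier transform $\widehat\varphi(\xi)=\frac1{\sqrt{2\pi}}\int_{\mathbb R}\varphi(x)e^{-ix\xi}\,dx$ is supported in $[0,\infty)$. The Toeplitz operator $T_{\overline\Theta}f=P_+(\overline\Theta f|_{\mathbb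 R})$ is initially defined on $H^1_\Theta\cap\mathcal S_+$; it is called bounded from $H^1_\Theta$ to $H^1(\mathbb C^+)$ if it extends to a bounded linear operator $H^1_\Theta\to H^1(\mathbb C^+)$. Let $H$ be the Hilbert transform, i.e. the Fourier multiplier with symbol $-i\,\mathrm{sign}\,\xi$, which maps $L^1(\mathbb R)$ into the tempered distributions. Let $H^1(\mathbb R)=\{f\in L^1(\mathbb R): Hf\in L^1(\mathbb R)\}$ with norm $\|f\|_{L^1}+\|Hf\|_{L^1}$, and let $$H^1_\Theta(\mathbb R)=\Big\{f\in H^1(\mathbb R):\int_{\mathbb R}f\,\overline\Theta\,dx=0\Big\}$$ with the same norm. Then the following are equivalent: (a) the Toeplitz operator $T_{\overline\Theta}\colon H^1_\Theta\to H^1(\mathbb C^+)$ is bounded; (b) the commutator $[\overline\Theta,H]f=\overline\Theta\,Hf-H(\overline\Theta f)$ is a bounded operator $H^1_\Theta(\mathbb R)\to L^1(\mathbb R)$; (c) the multiplication operator $M_{\overline\Theta}f=\overline\Theta f$ is a bounded operator $H^1_\Theta(\mathbb R)\to H^1(\mathbb R)$. -/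

import Mathlib

open MeasureTheory Filter Topology Complex
open scoped UpperHalfPlane ENNReal NNReal SchwartzMap FourierTransform Manifold ComplexConjugate

noncomputable section

namespace HardyToeplitz

/-! ### Hardy space `H¹(ℂ⁺)` and boundary values -/

/-- The point `x + i y` of the upper half-plane. -/
def pt (x y : ℝ) (hy : 0 < y) : ℍ := UpperHalfPlane.mk ⟨x, y⟩ hy

/-- The `H¹(ℂ⁺)` norm `sup_{y > 0} ∫ |f (x + i y)| dx`, as an extended nonnegative real. -/
def hardyNorm (f : ℍ → ℂ) : ℝ≥0∞ :=
  ⨆ (y : ℝ) (hy : 0 < y), ∫⁻ x : ℝ, ‖f (pt x y hy)‖ₑ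

lemma continuous_pt (y : ℝ) (hy : 0 < y) : Continuous fun x : ℝ => pt x y hy := by
  rw [UpperHalfPlane.isEmbedding_coe.continuous_iff]
  have h : ((↑) ∘ fun x : ℝ => pt x y hy : ℝ → ℂ) = fun x : ℝ => (x : ℂ) + (y : ℂ) * I := by
    funext x
    exact Complex.mk_eq_add_mul_I x y
  rw [h]
  fun_prop

lemma hardyNorm_add_le {f g : ℍ → ℂ} (hf : Continuous f) :
    hardyNorm (f + g) ≤ hardyNorm f + hardyNorm g := by
  refine iSup₂_le fun y hy => ?_
  calc ∫⁻ x : ℝ, ‖(f + g) (pt x y hy)‖ₑ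
      ≤ ∫⁻ x : ℝ, (‖f (pt x y hy)‖ₑ + ‖g (pt x y hy)‖ₑ) :=
        lintegral_mono fun x => enorm_add_le _ _
    _ = (∫⁻ x : ℝ, ‖f (pt x y hy)‖ₑ) + ∫⁻ x : ℝ, ‖g (pt x y hy)‖ₑ :=
        lintegral_add_left (hf.comp (continuous_pt y hy)).enorm.measurable _
    _ ≤ hardyNorm f + hardyNorm g :=
        add_le_add
          (le_iSup₂ (f := fun (y : ℝ) (hy : 0 < y) => ∫⁻ x : ℝ, ‖f (pt x y hy)‖ₑ) y hy)
          (le_iSup₂ (f := fun (y : ℝ) (hy : 0 < y) => ∫⁻ x : ℝ, ‖g (pt x y hy)‖ₑ) y hy)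

lemma hardyNorm_smul_le (c : ℂ) (f : ℍ → ℂ) : hardyNorm (c • f) ≤ ‖c‖ₑ * hardyNorm f := by
  refine iSup₂_le fun y hy => ?_
  simp only [Pi.smul_apply, enorm_smul]
  rw [lintegral_const_mul' _ _ enorm_ne_top]
  gcongr
  exact le_iSup₂ (f := fun (y : ℝ) (hy : 0 < y) => ∫⁻ x : ℝ, ‖f (pt x y hy)‖ₑ) y hy

/-- `H¹(ℂ⁺)`: holomorphic functions on the upper half-plane with finite `hardyNorm`. -/
def H1Plus : Submodule ℂ (ℍ → ℂ) where
  carrier := {f | MDiff f ∧ hardyNorm f < ∞}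
  zero_mem' := ⟨mdifferentiable_const, by simp [hardyNorm]⟩
  add_mem' := fun {f g} hf hg =>
    ⟨hf.1.add hg.1, (hardyNorm_add_le hf.1.continuous).trans_lt
      (ENNReal.add_lt_top.2 ⟨hf.2, hg.2⟩)⟩
  smul_mem' := fun c f hf =>
    ⟨hf.1.const_smul c, (hardyNorm_smul_le c f).trans_lt
      (ENNReal.mul_lt_top enorm_lt_top hf.2)⟩

/-- Nontangential approach to the real point `x`: the limit along this filter is the limit
as `z → x` inside every cone `|Re z - x| < α Im z`, `α > 0`. -/
def nontangential (x : ℝ) : Filter ℍ :=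
  ⨆ α : {α : ℝ // 0 < α},
    comap ((↑) : ℍ → ℂ) (𝓝 (x : ℂ)) ⊓ 𝓟 {z : ℍ | |z.re - x| < α * z.im}

/-- `f` has a nontangential limit at almost every real point. -/
def HasBoundaryValues (f : ℍ → ℂ) : Prop :=
  ∀ᵐ x : ℝ, ∃ c : ℂ, Tendsto f (nontangential x) (𝓝 c)

/-- The boundary function `f|_ℝ`, given by nontangential limits. -/
def boundary (f : ℍ → ℂ) (x : ℝ) : ℂ := limUnder (nontangential x) f

/-- `Θ` is inner: bounded and holomorphic on the upper half-plane, with nontangential boundary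
values of modulus one almost everywhere. -/
structure IsInner (Θ : ℍ → ℂ) : Prop where
  mdiff : MDiff Θ
  bounded : ∃ M : ℝ, ∀ z, ‖Θ z‖ ≤ M
  hasBoundaryValues : HasBoundaryValues Θ
  norm_boundary : ∀ᵐ x : ℝ, ‖boundary Θ x‖ = 1

lemma tendsto_pt (x : ℝ) :
    Tendsto (fun n : ℕ => pt x (1 / ((n : ℝ) + 1)) (by positivity)) atTop (nontangential x) := by
  refine Tendsto.mono_right ?_ (le_iSup _ (⟨1, one_pos⟩ : {α : ℝ // 0 < α}))
  refine tendsto_inf.2 ⟨?_, tendsto_principal.2 (Eventually.of_forall fun n => ?_)⟩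
  · rw [tendsto_comap_iff]
    have h : Tendsto (fun n : ℕ => (x : ℂ) + ((1 / ((n : ℝ) + 1) : ℝ) : ℂ) * I) atTop
        (𝓝 ((x : ℂ) + ((0 : ℝ) : ℂ) * I)) :=
      (((continuous_ofReal.tendsto 0).comp tendsto_one_div_add_atTop_nhds_zero_nat).mul_const I
        ).const_add _
    simp only [ofReal_zero, zero_mul, add_zero] at h
    refine h.congr fun n => ?_
    exact (Complex.mk_eq_add_mul_I x _).symm
  · have h1 : (pt x (1 / ((n : ℝ) + 1)) (by positivity)).re = x := rfl
    have h2 : (pt x (1 / ((n : ℝ) + 1)) (by positivity)).im = 1 / ((n : ℝ) + 1) := rfl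
    simp only [Set.mem_ofPred_eq, h1, h2, sub_self, abs_zero, one_mul]
    positivity

instance (x : ℝ) : (nontangential x).NeBot := (tendsto_pt x).neBot

lemma boundary_eq {f : ℍ → ℂ} {x : ℝ} {c : ℂ} (h : Tendsto f (nontangential x) (𝓝 c)) :
    boundary f x = c := h.limUnder_eq

lemma HasBoundaryValues.tendsto {f : ℍ → ℂ} (h : HasBoundaryValues f) :
    ∀ᵐ x : ℝ, Tendsto f (nontangential x) (𝓝 (boundary f x)) := by
  filter_upwards [h] with x hx
  obtain ⟨c, hc⟩ := hx
  rwa [boundary_eq hc]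

lemma HasBoundaryValues.aestronglyMeasurable {f : ℍ → ℂ} (h : HasBoundaryValues f)
    (hf : Continuous f) : AEStronglyMeasurable (boundary f) volume := by
  refine aestronglyMeasurable_of_tendsto_ae atTop
    (f := fun (n : ℕ) (x : ℝ) => f (pt x (1 / ((n : ℝ) + 1)) (by positivity)))
    (fun n => (hf.comp (continuous_pt (1 / ((n : ℝ) + 1)) (by positivity))).aestronglyMeasurable) ?_
  filter_upwards [h.tendsto] with x hx
  exact hx.comp (tendsto_pt x)

lemma IsInner.memLp {Θ : ℍ → ℂ} (hΘ : IsInner Θ) :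
    MemLp (fun x : ℝ => conj (boundary Θ x)) ∞ volume := by
  refine memLp_top_of_bound (Complex.continuous_conj.comp_aestronglyMeasurable
    (hΘ.hasBoundaryValues.aestronglyMeasurable hΘ.mdiff.continuous)) 1 ?_
  filter_upwards [hΘ.norm_boundary] with x hx
  simp [hx]

/-- The symbol `Θ̄` on the real line, as an element of `L^∞(ℝ)`. -/
def IsInner.symbol {Θ : ℍ → ℂ} (hΘ : IsInner Θ) : Lp ℂ ∞ (volume : Measure ℝ) :=
  hΘ.memLp.toLp _

lemma IsInner.integrable_mul {Θ : ℍ → ℂ} (hΘ : IsInner Θ) {u : ℝ → ℂ} (hu : Integrable u) :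
    Integrable fun x : ℝ => u x * conj (boundary Θ x) := by
  have h := hu.bdd_mul (c := 1) hΘ.memLp.1 (by
    filter_upwards [hΘ.norm_boundary] with x hx
    simp [hx])
  exact h.congr (Eventually.of_forall fun x => mul_comm _ _)

/-- `H¹_Θ`: the functions `f ∈ H¹(ℂ⁺)` whose boundary function satisfies `∫ f Θ̄ = 0`.
The existence and integrability of the boundary function hold for every `f ∈ H¹(ℂ⁺)`; they are
recorded so that the integral is meaningful by definition. -/
def H1Theta {Θ : ℍ → ℂ} (hΘ : IsInner Θ) : Submodule ℂ (ℍ → ℂ) where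
  carrier := {f | f ∈ H1Plus ∧ HasBoundaryValues f ∧ Integrable (boundary f) ∧
    ∫ x : ℝ, boundary f x * conj (boundary Θ x) = 0}
  zero_mem' := by
    have h : boundary (0 : ℍ → ℂ) = 0 := funext fun x => boundary_eq tendsto_const_nhds
    exact ⟨H1Plus.zero_mem, Eventually.of_forall fun x => ⟨0, tendsto_const_nhds⟩, by
      rw [h]; exact integrable_zero _ _ _, by simp [h]⟩
  add_mem' := by
    rintro f g ⟨hf, hfb, hfi, hf0⟩ ⟨hg, hgb, hgi, hg0⟩
    have h : boundary (f + g) =ᵐ[volume] boundary f + boundary g := by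
      filter_upwards [hfb.tendsto, hgb.tendsto] with x hx hy
      exact boundary_eq (hx.add hy)
    refine ⟨H1Plus.add_mem hf hg, ?_, (hfi.add hgi).congr h.symm, ?_⟩
    · filter_upwards [hfb.tendsto, hgb.tendsto] with x hx hy
      exact ⟨_, hx.add hy⟩
    · have h' : (fun x : ℝ => boundary (f + g) x * conj (boundary Θ x)) =ᵐ[volume] fun x =>
          boundary f x * conj (boundary Θ x) + boundary g x * conj (boundary Θ x) := by
        filter_upwards [h] with x hx
        rw [hx, Pi.add_apply, add_mul]
      rw [integral_congr_ae h', integral_add (hΘ.integrable_mul hfi) (hΘ.integrable_mul hgi),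
        hf0, hg0, add_zero]
  smul_mem' := by
    rintro c f ⟨hf, hfb, hfi, hf0⟩
    have h : boundary (c • f) =ᵐ[volume] c • boundary f := by
      filter_upwards [hfb.tendsto] with x hx
      exact boundary_eq (hx.const_smul c)
    refine ⟨H1Plus.smul_mem c hf, ?_, (hfi.smul c).congr h.symm, ?_⟩
    · filter_upwards [hfb.tendsto] with x hx
      exact ⟨_, hx.const_smul c⟩
    · have h' : (fun x : ℝ => boundary (c • f) x * conj (boundary Θ x)) =ᵐ[volume] fun x =>
          c * (boundary f x * conj (boundary Θ x)) := by
        filter_upwards [h] with x hx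
        rw [hx, Pi.smul_apply, smul_eq_mul, mul_assoc]
      rw [integral_congr_ae h', integral_const_mul, hf0, mul_zero]

/-! ### The Toeplitz operator -/

/-- The Cauchy–Szegő integral `P₊ u (z) = (2πi)⁻¹ ∫ u(t) / (t - z) dt`, `z ∈ ℂ⁺`. -/
def cauchySzego (u : ℝ → ℂ) (z : ℍ) : ℂ :=
  (2 * (Real.pi : ℂ) * I)⁻¹ * ∫ t : ℝ, u t / ((t : ℂ) - (z : ℂ))

/-- The class `𝒮₊` of functions `P₊ φ`, with `φ` Schwartz and `φ̂` supported in `[0, ∞)`. -/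
def SPlus : Set (ℍ → ℂ) :=
  {f | ∃ φ : 𝓢(ℝ, ℂ), (∀ ξ : ℝ, ξ < 0 → 𝓕 (φ : ℝ → ℂ) ξ = 0) ∧ f = cauchySzego φ}

/-- `T_Θ̄ f = P₊ (Θ̄ f)`. -/
def toeplitz (Θ f : ℍ → ℂ) : ℍ → ℂ :=
  cauchySzego fun t => conj (boundary Θ t) * boundary f t

/-- `T_Θ̄`, with initial domain `H¹_Θ ∩ 𝒮₊`, extends to a bounded linear operator
`H¹_Θ → H¹(ℂ⁺)`. -/
def ToeplitzBounded {Θ : ℍ → ℂ} (hΘ : IsInner Θ) : Prop :=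
  ∃ T : H1Theta hΘ →ₗ[ℂ] H1Plus,
    (∀ f : H1Theta hΘ, (f : ℍ → ℂ) ∈ SPlus → (T f : ℍ → ℂ) = toeplitz Θ f) ∧
    ∃ C : ℝ≥0, ∀ f : H1Theta hΘ, hardyNorm (T f) ≤ C * hardyNorm f

/-! ### The Hilbert transform and `H¹(ℝ)` -/

/-- `L¹(ℝ)`. -/
abbrev L1 := Lp ℂ 1 (volume : Measure ℝ)

lemma fourier_congr {u v : ℝ → ℂ} (h : u =ᵐ[volume] v) : 𝓕 u = 𝓕 v := by
  funext ξ
  simp only [Real.fourier_eq]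
  refine integral_congr_ae ?_
  filter_upwards [h] with x hx
  rw [hx]

lemma fourier_add_apply {u v : ℝ → ℂ} (hu : Integrable u) (hv : Integrable v) (ξ : ℝ) :
    𝓕 (u + v) ξ = 𝓕 u ξ + 𝓕 v ξ := by
  have h := congrFun (VectorFourier.fourierIntegral_add Real.continuous_fourierChar
    (L := innerₗ ℝ) (by exact continuous_inner) hu hv) ξ
  exact h

lemma fourier_smul_apply (c : ℂ) (u : ℝ → ℂ) (ξ : ℝ) : 𝓕 (c • u) ξ = c * 𝓕 u ξ :=
  congrFun (VectorFourier.fourierIntegral_const_smul Real.fourierChar volume (innerₗ ℝ) u c) ξ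

lemma integrable_L1 (f : L1) : Integrable (f : ℝ → ℂ) := L1.integrable_coeFn f

lemma hilbert_memLp (f : L1) :
    MemLp (fun ξ : ℝ => -I * (Real.sign ξ : ℂ) * 𝓕 (f : ℝ → ℂ) ξ) ∞ volume := by
  have hc : Continuous (𝓕 (f : ℝ → ℂ)) :=
    VectorFourier.fourierIntegral_continuous Real.continuous_fourierChar
      (by exact continuous_inner) (integrable_L1 f)
  have hs : Measurable fun ξ : ℝ => (Real.sign ξ : ℂ) :=
    Complex.measurable_ofReal.comp (Measurable.ite measurableSet_Iio measurable_const
      (Measurable.ite measurableSet_Ioi measurable_const measurable_const))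
  refine memLp_top_of_bound
    ((hs.const_mul (-I)).mul hc.measurable).aestronglyMeasurable (∫ x, ‖f x‖) ?_
  refine Eventually.of_forall fun ξ => ?_
  have h1 : ‖𝓕 (f : ℝ → ℂ) ξ‖ ≤ ∫ x, ‖f x‖ :=
    VectorFourier.norm_fourierIntegral_le_integral_norm _ _ _ _ _
  have h2 : ‖(Real.sign ξ : ℂ)‖ ≤ 1 := by
    rcases Real.sign_apply_eq ξ with h | h | h <;> simp [h]
  calc ‖-I * (Real.sign ξ : ℂ) * 𝓕 (f : ℝ → ℂ) ξ‖
      = ‖(Real.sign ξ : ℂ)‖ * ‖𝓕 (f : ℝ → ℂ) ξ‖ := by simp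
    _ ≤ 1 * ∫ x, ‖f x‖ := by gcongr
    _ = _ := one_mul _

/-- The Hilbert transform `H = -i (P₊ - P₋)` on `L¹(ℝ)`, with values in the tempered
distributions: the Fourier multiplier with symbol `-i sign ξ`. -/
def hilbert : L1 →ₗ[ℂ] 𝓢'(ℝ, ℂ) where
  toFun f := 𝓕⁻ (((hilbert_memLp f).toLp _ : Lp ℂ ∞ (volume : Measure ℝ)) : 𝓢'(ℝ, ℂ))
  map_add' f g := by
    have h : (hilbert_memLp (f + g)).toLp _ =
        (hilbert_memLp f).toLp _ + (hilbert_memLp g).toLp _ := by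
      rw [← MemLp.toLp_add]
      refine MemLp.toLp_congr _ _ (Eventually.of_forall fun ξ => ?_)
      simp only [Pi.add_apply]
      rw [fourier_congr (Lp.coeFn_add f g), fourier_add_apply (integrable_L1 f) (integrable_L1 g),
        mul_add]
    rw [h, ← Lp.toTemperedDistributionCLM_apply, map_add, FourierTransform.fourierInv_add]
    rfl
  map_smul' c f := by
    have h : (hilbert_memLp (c • f)).toLp _ = c • (hilbert_memLp f).toLp _ := by
      rw [← MemLp.toLp_const_smul]
      refine MemLp.toLp_congr _ _ (Eventually.of_forall fun ξ => ?_)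
      simp only [Pi.smul_apply, smul_eq_mul]
      rw [fourier_congr (Lp.coeFn_smul c f), fourier_smul_apply]
      ring
    rw [h, ← Lp.toTemperedDistributionCLM_apply, map_smul, FourierTransform.fourierInv_smul]
    rfl

/-- The real Hardy space `H¹(ℝ) = {f ∈ L¹(ℝ) : H f ∈ L¹(ℝ)}`. -/
def H1Real : Submodule ℂ L1 :=
  (LinearMap.range (Lp.toTemperedDistributionCLM ℂ (volume : Measure ℝ) 1).toLinearMap).comap
    hilbert

/-- For `f ∈ H¹(ℝ)`, the function `H f ∈ L¹(ℝ)`. -/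
def hilbertL1 (f : H1Real) : L1 := f.2.choose

lemma hilbertL1_spec (f : H1Real) : (hilbertL1 f : 𝓢'(ℝ, ℂ)) = hilbert f := f.2.choose_spec

/-- The norm `‖f‖_{L¹} + ‖H f‖_{L¹}` of `H¹(ℝ)`. -/
def h1Norm (f : H1Real) : ℝ := ‖(f : L1)‖ + ‖hilbertL1 f‖

/-- `H¹_Θ(ℝ) = {φ ∈ H¹(ℝ) : ∫ φ Θ̄ = 0}`. -/
def H1RealTheta {Θ : ℍ → ℂ} (hΘ : IsInner Θ) : Submodule ℂ H1Real where
  carrier := {φ | ∫ x : ℝ, (φ : L1) x * conj (boundary Θ x) = 0}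
  zero_mem' := by simp
  add_mem' := by
    intro f g hf hg
    have h : (fun x : ℝ => ((f + g : H1Real) : L1) x * conj (boundary Θ x)) =ᵐ[volume] fun x =>
        (f : L1) x * conj (boundary Θ x) + (g : L1) x * conj (boundary Θ x) := by
      filter_upwards [Lp.coeFn_add (f : L1) (g : L1)] with x hx
      rw [Submodule.coe_add, hx, Pi.add_apply, add_mul]
    simp only [Set.mem_ofPred_eq] at hf hg ⊢
    rw [integral_congr_ae h, integral_add (hΘ.integrable_mul (integrable_L1 _))
      (hΘ.integrable_mul (integrable_L1 _)), hf, hg, add_zero]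
  smul_mem' := by
    intro c f hf
    have h : (fun x : ℝ => ((c • f : H1Real) : L1) x * conj (boundary Θ x)) =ᵐ[volume] fun x =>
        c * ((f : L1) x * conj (boundary Θ x)) := by
      filter_upwards [Lp.coeFn_smul c (f : L1)] with x hx
      rw [Submodule.coe_smul, hx, Pi.smul_apply, smul_eq_mul, mul_assoc]
    simp only [Set.mem_ofPred_eq] at hf ⊢
    rw [integral_congr_ae h, integral_const_mul, hf, mul_zero]

/-! ### The commutator and the multiplication operator -/

/-- Multiplication by `Θ̄` on `L¹(ℝ)`. -/
def mulConj {Θ : ℍ → ℂ} (hΘ : IsInner Θ) (f : L1) : L1 := hΘ.symbol • f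

lemma coeFn_mulConj {Θ : ℍ → ℂ} (hΘ : IsInner Θ) (f : L1) :
    mulConj hΘ f =ᵐ[volume] fun x => conj (boundary Θ x) * f x := by
  filter_upwards [Lp.coeFn_lpSMul (r := 1) hΘ.symbol f, hΘ.memLp.coeFn_toLp] with x h1 h2
  rw [mulConj, h1, Pi.smul_apply', smul_eq_mul, IsInner.symbol, h2]

/-- `[Θ̄, H] f = Θ̄ H f - H (Θ̄ f)`, a tempered distribution for `f ∈ H¹(ℝ)`. -/
def commutator {Θ : ℍ → ℂ} (hΘ : IsInner Θ) (f : H1Real) : 𝓢'(ℝ, ℂ) :=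
  (mulConj hΘ (hilbertL1 f) : 𝓢'(ℝ, ℂ)) - hilbert (mulConj hΘ f)

/-- `[Θ̄, H]` is a bounded operator `H¹_Θ(ℝ) → L¹(ℝ)`. -/
def CommutatorBounded {Θ : ℍ → ℂ} (hΘ : IsInner Θ) : Prop :=
  ∃ L : H1RealTheta hΘ →ₗ[ℂ] L1,
    (∀ f : H1RealTheta hΘ, (L f : 𝓢'(ℝ, ℂ)) = commutator hΘ f) ∧
    ∃ C : ℝ, ∀ f : H1RealTheta hΘ, ‖L f‖ ≤ C * h1Norm f

/-- Multiplication by `Θ̄` is a bounded operator `H¹_Θ(ℝ) → H¹(ℝ)`. -/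
def MultiplicationBounded {Θ : ℍ → ℂ} (hΘ : IsInner Θ) : Prop :=
  ∃ M : H1RealTheta hΘ →ₗ[ℂ] H1Real,
    (∀ f : H1RealTheta hΘ, (M f : L1) = mulConj hΘ (f : H1Real)) ∧
    ∃ C : ℝ, ∀ f : H1RealTheta hΘ, h1Norm (M f) ≤ C * h1Norm f

end HardyToeplitz

end

open MeasureTheory Filter Topology Complex
open scoped UpperHalfPlane ENNReal NNReal SchwartzMap FourierTransform Manifold ComplexConjugate

noncomputable section

namespace HardyToeplitz

/-! ### Fourier transforms of integrable functions and the Hilbert transform -/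

/-! Since |Θ| = 1 a.e., multiplication by Θ̄ is an isometry of L¹, so the term Θ̄ Hf of the
commutator is harmless: (b) and (c) both say that H(Θ̄f) lies in L¹ with norm control on H¹_Θ(ℝ).
The link with (a) is the splitting u = a + b of u ∈ H¹(ℝ), where a = (u + iHu)/2 has spectrum in [0,
∞) and b = (u − iHu)/2 has spectrum in (−∞, 0]; H acts on them as −i and i.

(c) ⇒ (a). The boundary function u of f ∈ H¹_Θ has spectrum in [0, ∞), so Hu = −iu and u ∈ H¹_Θ(ℝ).
P₊ sees only the analytic part of Θ̄u ∈ H¹(ℝ), and the Cauchy integral of that part is its Poisson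
integral, which does not increase the L¹ norm.

(a) ⇒ (c). The Fourier transform of Θ̄b vanishes on [0, ∞) (`IsInner.fourier_conj_mul_eq_zero`).
Hence H(Θ̄b) = iΘ̄b, and at frequency 0 this reads ∫ bΘ̄ = 0, so a inherits the orthogonality to Θ.
If a is a Schwartz function φ, then v = Θ̄φ lies in L¹ ∩ L²; P₊v has an L² boundary function g,
Fatou puts g in L¹ (`exists_integrable_projection`), and Hv = −i(2g − v). General a follow by
constrained density (`IsInner.exists_schwartz_near`) and the closed graph of H
(`hilbert_eq_of_tendsto`).

Both directions use that boundary functions of H¹(ℂ⁺) have spectrum in [0, ∞)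
(`fourier_boundary_eq_zero`). On horizontal lines this is a contour shift. To pass to the boundary
one needs L¹ convergence, whereas L¹-boundedness alone would allow singular mass in the limit.
Subharmonicity of |F|^{1/2}, whose restrictions to lines are bounded in L², excludes this: it yields
|f| ≤ Poisson integral of |f|_ℝ| (`norm_le_integral_poisson_boundary`), so no line carries more mass
than the boundary.

The Fourier kernel here is e^{−2πixξ}; the dilation by 2π affects neither half-line spectra nor the
symbol −i sign ξ. -/

lemma continuous_fourier {u : ℝ → ℂ} (hu : Integrable u) : Continuous (𝓕 u) :=
  VectorFourier.fourierIntegral_continuous Real.continuous_fourierChar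
    (by exact continuous_inner) hu

lemma norm_fourier_le (u : ℝ → ℂ) (ξ : ℝ) : ‖𝓕 u ξ‖ ≤ ∫ x, ‖u x‖ :=
  VectorFourier.norm_fourierIntegral_le_integral_norm _ _ _ _ _

lemma fourier_neg_apply (u : ℝ → ℂ) (ξ : ℝ) : 𝓕 (-u) ξ = -𝓕 u ξ := by
  have := fourier_smul_apply (-1) u ξ
  simpa using this

lemma fourier_sub_apply {u v : ℝ → ℂ} (hu : Integrable u) (hv : Integrable v) (ξ : ℝ) :
    𝓕 (u - v) ξ = 𝓕 u ξ - 𝓕 v ξ := by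
  rw [sub_eq_add_neg, fourier_add_apply hu hv.neg, fourier_neg_apply, sub_eq_add_neg]

/-- The multiplication formula for the Fourier transform. -/
lemma integral_fourier_mul {u v : ℝ → ℂ} (hu : Integrable u) (hv : Integrable v) :
    ∫ ξ, 𝓕 u ξ * v ξ = ∫ x, u x * 𝓕 v x := by
  have h := VectorFourier.integral_fourierIntegral_smul_eq_flip (μ := volume) (ν := volume)
    (L := innerₗ ℝ) Real.continuous_fourierChar (by exact continuous_inner) hu hv
  simp only [smul_eq_mul, flip_innerₗ] at h
  exact h

/-- A locally integrable function is determined almost everywhere by its integrals against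
Schwartz functions. -/
lemma ae_eq_of_integral_schwartz {u v : ℝ → ℂ} (hu : LocallyIntegrable u)
    (hv : LocallyIntegrable v) (h : ∀ ψ : 𝓢(ℝ, ℂ), ∫ x, ψ x * u x = ∫ x, ψ x * v x) :
    u =ᵐ[volume] v := by
  refine ae_eq_of_integral_contDiff_smul_eq hu hv fun g hg hgc => ?_
  have hg₁ : HasCompactSupport (Complex.ofRealCLM ∘ g) := hgc.comp_left rfl
  have hg₂ : ContDiff ℝ ((⊤ : ℕ∞) : WithTop ℕ∞) (Complex.ofRealCLM ∘ g) :=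
    Complex.ofRealCLM.contDiff.comp hg
  have := h (hg₁.toSchwartzMap hg₂)
  simpa using this

lemma coe_apply_L1 (f : L1) (ψ : 𝓢(ℝ, ℂ)) : (f : 𝓢'(ℝ, ℂ)) ψ = ∫ x, ψ x * f x := by
  simp

lemma toTemperedDistribution_injective :
    Function.Injective (fun f : L1 => (f : 𝓢'(ℝ, ℂ))) := by
  have h := LinearMap.ker_eq_bot.1
    (Lp.ker_toTemperedDistributionCLM_eq_bot (F := ℂ) (μ := (volume : Measure ℝ)) (p := 1))
  exact h

lemma locallyIntegrable_fourier {u : ℝ → ℂ} (hu : Integrable u) : LocallyIntegrable (𝓕 u) :=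
  (continuous_fourier hu).locallyIntegrable

/-- The Hilbert transform of `v ∈ L¹` is the function `w ∈ L¹` exactly if
`ŵ = -i sign ξ v̂` almost everywhere. -/
lemma hilbert_eq_iff (v w : L1) : hilbert v = (w : 𝓢'(ℝ, ℂ)) ↔
    ∀ᵐ ξ : ℝ, 𝓕 (w : ℝ → ℂ) ξ = -I * (Real.sign ξ : ℂ) * 𝓕 (v : ℝ → ℂ) ξ := by
  -- Testing on 𝓕ψ moves both distributions to the frequency side, where they are integrals of
  -- functions against ψ.
  have hw : ∀ ψ : 𝓢(ℝ, ℂ), (w : 𝓢'(ℝ, ℂ)) (𝓕 ψ) = ∫ ξ, ψ ξ * 𝓕 (w : ℝ → ℂ) ξ := by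
    intro ψ
    rw [coe_apply_L1, SchwartzMap.fourier_coe]
    exact integral_fourier_mul ψ.integrable (integrable_L1 w)
  have hv : ∀ ψ : 𝓢(ℝ, ℂ), hilbert v (𝓕 ψ) =
      ∫ ξ, ψ ξ * (-I * (Real.sign ξ : ℂ) * 𝓕 (v : ℝ → ℂ) ξ) := by
    intro ψ
    have : hilbert v (𝓕 ψ) = (((hilbert_memLp v).toLp _ : Lp ℂ ∞ (volume : Measure ℝ)) :
      𝓢'(ℝ, ℂ)) (𝓕⁻ (𝓕 ψ)) := rfl
    rw [this, FourierTransform.fourierInv_fourier_eq, Lp.toTemperedDistribution_apply]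
    refine integral_congr_ae ?_
    filter_upwards [(hilbert_memLp v).coeFn_toLp] with ξ hξ
    rw [hξ, smul_eq_mul]
  constructor
  · intro h
    refine ae_eq_of_integral_schwartz (locallyIntegrable_fourier (integrable_L1 w))
      ((hilbert_memLp v).locallyIntegrable le_top) fun ψ => ?_
    rw [← hw, ← hv, h]
  · intro h
    ext ψ
    have e : ψ = 𝓕 (𝓕⁻ ψ) := (FourierTransform.fourier_fourierInv_eq ψ).symm
    rw [e, hw, hv]
    refine integral_congr_ae ?_
    filter_upwards [h] with ξ hξ
    rw [hξ]

lemma fourierInv_real_eq_fourier_neg (u : ℝ → ℂ) (x : ℝ) : 𝓕⁻ u x = 𝓕 u (-x) :=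
  Real.fourierInv_eq_fourier_neg u x

/-- The `L²` Fourier transform agrees with the Fourier integral on `L¹ ∩ L²`. -/
lemma fourier_toLp_ae_eq {u : ℝ → ℂ} (hu : Integrable u) (hu2 : MemLp u 2) :
    (𝓕 (hu2.toLp u) : Lp ℂ 2 (volume : Measure ℝ)) =ᵐ[volume] 𝓕 u := by
  refine ae_eq_of_integral_schwartz ((Lp.memLp _).locallyIntegrable (by norm_num))
    (locallyIntegrable_fourier hu) fun ψ => ?_
  -- Both transforms represent the distributional Fourier transform of u, so they agree against
  -- every ψ.
  have h := congrArg (fun T : 𝓢'(ℝ, ℂ) => T ψ)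
    (Lp.fourier_toTemperedDistribution_eq (hu2.toLp u))
  simp only [TemperedDistribution.fourier_apply, Lp.toTemperedDistribution_apply,
    smul_eq_mul] at h
  rw [← h, ← integral_fourier_mul ψ.integrable hu]
  refine integral_congr_ae ?_
  filter_upwards [hu2.coeFn_toLp] with x hx
  rw [hx, SchwartzMap.fourier_coe]

/-- The `L²` inverse Fourier transform agrees with the inverse Fourier integral on `L¹ ∩ L²`. -/
lemma fourierInv_toLp_ae_eq {u : ℝ → ℂ} (hu : Integrable u) (hu2 : MemLp u 2) :
    (𝓕⁻ (hu2.toLp u) : Lp ℂ 2 (volume : Measure ℝ)) =ᵐ[volume] 𝓕⁻ u := by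
  have hcont : Continuous (𝓕⁻ u) := by
    have : 𝓕⁻ u = fun x => 𝓕 u (-x) := funext (fourierInv_real_eq_fourier_neg u)
    rw [this]
    exact (continuous_fourier hu).comp continuous_neg
  refine ae_eq_of_integral_schwartz ((Lp.memLp _).locallyIntegrable (by norm_num))
    hcont.locallyIntegrable fun ψ => ?_
  have h := congrArg (fun T : 𝓢'(ℝ, ℂ) => T ψ)
    (Lp.fourierInv_toTemperedDistribution_eq (hu2.toLp u))
  simp only [TemperedDistribution.fourierInv_apply, Lp.toTemperedDistribution_apply,
    smul_eq_mul] at h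
  rw [← h]
  have h2 : ∫ x, ψ x * 𝓕⁻ u x = ∫ x, ψ (-x) * 𝓕 u x := by
    rw [← integral_neg_eq_self]
    simp [fourierInv_real_eq_fourier_neg]
  rw [h2, ← integral_fourier_mul ψ.integrable.comp_neg hu]
  refine integral_congr_ae ?_
  filter_upwards [hu2.coeFn_toLp] with x hx
  rw [hx, SchwartzMap.fourierInv_coe, Real.fourierInv_eq_fourier_comp_neg]

/-! ### The commutator and the multiplication operator -/

/-- `hilbertL1` is a choice, but L¹ embeds in the tempered distributions, so the choice is forced.
Identities for it can thus be checked between distributions. -/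
lemma hilbertL1_eq_of_hilbert_eq (f : H1Real) {w : L1} (h : hilbert f = (w : 𝓢'(ℝ, ℂ))) :
    hilbertL1 f = w :=
  toTemperedDistribution_injective ((hilbertL1_spec f).trans h)

lemma mem_H1Real_of_hilbert_eq {f w : L1} (h : hilbert f = (w : 𝓢'(ℝ, ℂ))) : f ∈ H1Real :=
  ⟨w, h.symm⟩

lemma coe_add_L1 (f g : L1) : ((f + g : L1) : 𝓢'(ℝ, ℂ)) = (f : 𝓢'(ℝ, ℂ)) + (g : 𝓢'(ℝ, ℂ)) :=
  map_add (Lp.toTemperedDistributionCLM ℂ (volume : Measure ℝ) 1) f g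

lemma coe_sub_L1 (f g : L1) : ((f - g : L1) : 𝓢'(ℝ, ℂ)) = (f : 𝓢'(ℝ, ℂ)) - (g : 𝓢'(ℝ, ℂ)) :=
  map_sub (Lp.toTemperedDistributionCLM ℂ (volume : Measure ℝ) 1) f g

lemma coe_smul_L1 (c : ℂ) (f : L1) : ((c • f : L1) : 𝓢'(ℝ, ℂ)) = c • (f : 𝓢'(ℝ, ℂ)) :=
  map_smul (Lp.toTemperedDistributionCLM ℂ (volume : Measure ℝ) 1) c f

lemma hilbertL1_add (f g : H1Real) : hilbertL1 (f + g) = hilbertL1 f + hilbertL1 g := by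
  refine hilbertL1_eq_of_hilbert_eq _ ?_
  rw [coe_add_L1, hilbertL1_spec, hilbertL1_spec, Submodule.coe_add, map_add]

lemma hilbertL1_smul (c : ℂ) (f : H1Real) : hilbertL1 (c • f) = c • hilbertL1 f := by
  refine hilbertL1_eq_of_hilbert_eq _ ?_
  rw [coe_smul_L1, hilbertL1_spec, Submodule.coe_smul, map_smul]

variable {Θ : ℍ → ℂ}

lemma mulConj_add (hΘ : IsInner Θ) (f g : L1) :
    mulConj hΘ (f + g) = mulConj hΘ f + mulConj hΘ g := by
  refine Lp.ext ?_
  filter_upwards [coeFn_mulConj hΘ (f + g), coeFn_mulConj hΘ f, coeFn_mulConj hΘ g,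
    Lp.coeFn_add f g, Lp.coeFn_add (mulConj hΘ f) (mulConj hΘ g)] with x h1 h2 h3 h4 h5
  rw [h1, h5, Pi.add_apply, h2, h3, h4, Pi.add_apply, mul_add]

lemma mulConj_smul (hΘ : IsInner Θ) (c : ℂ) (f : L1) :
    mulConj hΘ (c • f) = c • mulConj hΘ f := by
  refine Lp.ext ?_
  filter_upwards [coeFn_mulConj hΘ (c • f), coeFn_mulConj hΘ f,
    Lp.coeFn_smul c f, Lp.coeFn_smul c (mulConj hΘ f)] with x h1 h2 h3 h4
  rw [h1, h4, Pi.smul_apply, h2, h3, Pi.smul_apply, smul_eq_mul, smul_eq_mul]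
  ring

lemma mulConj_sub (hΘ : IsInner Θ) (f g : L1) :
    mulConj hΘ (f - g) = mulConj hΘ f - mulConj hΘ g := by
  have := mulConj_add hΘ f ((-1 : ℂ) • g)
  rw [mulConj_smul] at this
  simpa [sub_eq_add_neg] using this

lemma norm_mulConj (hΘ : IsInner Θ) (f : L1) : ‖mulConj hΘ f‖ = ‖f‖ := by
  rw [L1.norm_eq_integral_norm, L1.norm_eq_integral_norm]
  refine integral_congr_ae ?_
  filter_upwards [coeFn_mulConj hΘ f, hΘ.norm_boundary] with x h1 h2
  rw [h1, norm_mul, RCLike.norm_conj, h2, one_mul]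

/-- If `Θ̄ f ∈ H¹(ℝ)` with norm control for all `f ∈ H¹_Θ(ℝ)`, then multiplication by `Θ̄` is
bounded. -/
lemma multiplicationBounded_of_forall (hΘ : IsInner Θ) (C : ℝ)
    (h : ∀ f : H1RealTheta hΘ, ∃ w : L1, hilbert (mulConj hΘ (f : H1Real)) = (w : 𝓢'(ℝ, ℂ)) ∧
      ‖w‖ ≤ C * h1Norm f) : MultiplicationBounded hΘ := by
  have hm : ∀ f : H1RealTheta hΘ, mulConj hΘ (f : H1Real) ∈ H1Real := fun f => by
    obtain ⟨w, hw, -⟩ := h f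
    exact mem_H1Real_of_hilbert_eq hw
  refine ⟨⟨⟨fun f => ⟨mulConj hΘ (f : H1Real), hm f⟩, fun f g => Subtype.ext ?_⟩,
    fun c f => Subtype.ext ?_⟩, fun f => rfl, 1 + C, fun f => ?_⟩
  · exact mulConj_add hΘ _ _
  · exact mulConj_smul hΘ _ _
  · obtain ⟨w, hw, hC⟩ := h f
    have e : h1Norm ⟨mulConj hΘ (f : H1Real), hm f⟩ = ‖((f : H1Real) : L1)‖ + ‖w‖ := by
      have e1 : hilbertL1 ⟨mulConj hΘ (f : H1Real), hm f⟩ = w :=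
        hilbertL1_eq_of_hilbert_eq ⟨mulConj hΘ (f : H1Real), hm f⟩ hw
      rw [h1Norm, e1]
      exact congrArg (· + ‖w‖) (norm_mulConj hΘ _)
    calc _ = ‖((f : H1Real) : L1)‖ + ‖w‖ := e
      _ ≤ h1Norm f + C * h1Norm f := by
        gcongr
        exact le_add_of_nonneg_right (norm_nonneg _)
      _ = _ := by ring

/-- The two operators determine each other through H(Θ̄f) = Θ̄ Hf − [Θ̄, H]f, and ‖Θ̄ Hf‖ = ‖Hf‖ is
at most the H¹(ℝ) norm of f. Each passage costs 1 in the constant. -/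
theorem commutatorBounded_iff_multiplicationBounded (hΘ : IsInner Θ) :
    CommutatorBounded hΘ ↔ MultiplicationBounded hΘ := by
  constructor
  · rintro ⟨L, hL, C, hC⟩
    refine multiplicationBounded_of_forall hΘ (1 + C) fun f =>
      ⟨mulConj hΘ (hilbertL1 f) - L f, ?_, ?_⟩
    · rw [coe_sub_L1, hL, commutator]
      abel
    · calc ‖mulConj hΘ (hilbertL1 f) - L f‖ ≤ ‖mulConj hΘ (hilbertL1 f)‖ + ‖L f‖ := norm_sub_le _ _
        _ ≤ h1Norm f + C * h1Norm f := by
          gcongr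
          · rw [norm_mulConj]
            exact le_add_of_nonneg_left (norm_nonneg _)
          · exact hC f
        _ = _ := by ring
  · rintro ⟨M, hM, C, hC⟩
    refine ⟨⟨⟨fun f => mulConj hΘ (hilbertL1 f) - hilbertL1 (M f), fun f g => ?_⟩,
      fun c f => ?_⟩, fun f => ?_, 1 + C, fun f => ?_⟩
    · rw [map_add, hilbertL1_add, Submodule.coe_add, hilbertL1_add, mulConj_add]
      abel
    · simp only [RingHom.id_apply]
      rw [map_smul, hilbertL1_smul, Submodule.coe_smul, hilbertL1_smul, mulConj_smul, smul_sub]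
    · change ((mulConj hΘ (hilbertL1 f) - hilbertL1 (M f) : L1) : 𝓢'(ℝ, ℂ)) = _
      rw [coe_sub_L1, hilbertL1_spec, hM, commutator]
    · change ‖mulConj hΘ (hilbertL1 f) - hilbertL1 (M f)‖ ≤ _
      calc _ ≤ ‖mulConj hΘ (hilbertL1 f)‖ + ‖hilbertL1 (M f)‖ := norm_sub_le _ _
        _ ≤ h1Norm f + C * h1Norm f := by
          gcongr
          · rw [norm_mulConj]
            exact le_add_of_nonneg_left (norm_nonneg _)
          · exact (le_add_of_nonneg_left (norm_nonneg _)).trans (hC f)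
        _ = _ := by ring

/-! ### The Poisson kernel of the half-plane -/

/-- The Poisson kernel `P_y(x) = π⁻¹ y / (x² + y²)`. -/
def poisson (y x : ℝ) : ℝ := y / (Real.pi * (x ^ 2 + y ^ 2))

lemma poisson_nonneg {y : ℝ} (hy : 0 < y) (x : ℝ) : 0 ≤ poisson y x := by
  unfold poisson; positivity

lemma continuous_poisson {y : ℝ} (hy : 0 < y) : Continuous (poisson y) := by
  unfold poisson
  refine continuous_const.div (by fun_prop) fun x => ?_
  positivity

lemma poisson_eq {y : ℝ} (hy : 0 < y) (x : ℝ) :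
    poisson y x = (Real.pi * y)⁻¹ * (1 + (x / y) ^ 2)⁻¹ := by
  unfold poisson
  field_simp
  ring

lemma poisson_le {y : ℝ} (hy : 0 < y) (x : ℝ) : poisson y x ≤ (Real.pi * y)⁻¹ := by
  rw [poisson_eq hy]
  refine mul_le_of_le_one_right (by positivity) (inv_le_one_of_one_le₀ ?_)
  nlinarith [sq_nonneg (x / y)]

lemma integrable_poisson {y : ℝ} (hy : 0 < y) : Integrable (poisson y) := by
  have h : Integrable fun x : ℝ => (Real.pi * y)⁻¹ * (1 + (x / y) ^ 2)⁻¹ :=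
    (integrable_inv_one_add_sq.comp_div hy.ne').const_mul _
  exact h.congr (Eventually.of_forall fun x => (poisson_eq hy x).symm)

lemma integral_poisson {y : ℝ} (hy : 0 < y) : ∫ x, poisson y x = 1 := by
  simp_rw [poisson_eq hy]
  rw [integral_const_mul, Measure.integral_comp_div (fun x : ℝ => (1 + x ^ 2)⁻¹) y,
    integral_univ_inv_one_add_sq, smul_eq_mul, abs_of_pos hy]
  have := Real.pi_pos
  field_simp

lemma lintegral_poisson {y : ℝ} (hy : 0 < y) : ∫⁻ x, ENNReal.ofReal (poisson y x) = 1 := by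
  rw [← ofReal_integral_eq_lintegral_ofReal (integrable_poisson hy)
    (Eventually.of_forall (poisson_nonneg hy)), integral_poisson hy, ENNReal.ofReal_one]

lemma poisson_sub_comm (y x t : ℝ) : poisson y (x - t) = poisson y (t - x) := by
  unfold poisson
  ring_nf

lemma lintegral_poisson_sub_right {y : ℝ} (hy : 0 < y) (t : ℝ) :
    ∫⁻ x, ENNReal.ofReal (poisson y (x - t)) = 1 := by
  rw [lintegral_sub_right_eq_self (fun x => ENNReal.ofReal (poisson y x)), lintegral_poisson hy]

/-- The Poisson integral does not increase the integral of a nonnegative function. -/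
lemma lintegral_lintegral_poisson_mul {y : ℝ} (hy : 0 < y) {g : ℝ → ℝ≥0∞} (hg : AEMeasurable g) :
    ∫⁻ x, ∫⁻ t, ENNReal.ofReal (poisson y (x - t)) * g t = ∫⁻ t, g t := by
  have hm : Measurable fun p : ℝ × ℝ => ENNReal.ofReal (poisson y (p.1 - p.2)) :=
    ((continuous_poisson hy).comp (continuous_fst.sub continuous_snd)).measurable.ennreal_ofReal
  rw [lintegral_lintegral_swap (hm.aemeasurable.mul (hg.comp_quasiMeasurePreserving
    Measure.quasiMeasurePreserving_snd))]
  refine lintegral_congr fun t => ?_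
  have hmt : Measurable fun x => ENNReal.ofReal (poisson y (x - t)) :=
    ((continuous_poisson hy).comp (continuous_id.sub continuous_const)).measurable.ennreal_ofReal
  rw [lintegral_mul_const _ hmt,
    lintegral_poisson_sub_right hy, one_mul]

/-! ### Cauchy integrals of integrable functions -/

lemma ofReal_sub_coe_ne_zero (t : ℝ) (z : ℍ) : (t : ℂ) - (z : ℂ) ≠ 0 := by
  intro h
  have := congrArg Complex.im h
  simp only [sub_im, ofReal_im, zero_sub, zero_im, neg_eq_zero] at this
  exact z.im_pos.ne' this

lemma im_le_norm_ofReal_sub (t : ℝ) (z : ℂ) : z.im ≤ ‖(t : ℂ) - z‖ := by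
  have h := Complex.abs_im_le_norm ((t : ℂ) - z)
  simp only [sub_im, ofReal_im, zero_sub, abs_neg] at h
  exact (le_abs_self _).trans h

lemma integrable_div_ofReal_sub {u : ℝ → ℂ} (hu : Integrable u) (z : ℍ) :
    Integrable fun t : ℝ => u t / ((t : ℂ) - z) := by
  have hc : Continuous fun t : ℝ => ((t : ℂ) - (z : ℂ))⁻¹ :=
    (continuous_ofReal.sub continuous_const).inv₀ fun t => ofReal_sub_coe_ne_zero t z
  have h := hu.bdd_mul (c := (z.im)⁻¹) hc.aestronglyMeasurable (Eventually.of_forall fun t => ?_)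
  · exact h.congr (Eventually.of_forall fun t => by simp [div_eq_mul_inv, mul_comm])
  · rw [norm_inv]
    exact inv_anti₀ z.im_pos (im_le_norm_ofReal_sub t z)

lemma cauchySzego_add {u v : ℝ → ℂ} (hu : Integrable u) (hv : Integrable v) :
    cauchySzego (u + v) = cauchySzego u + cauchySzego v := by
  funext z
  simp only [cauchySzego, Pi.add_apply, add_div]
  rw [integral_add (integrable_div_ofReal_sub hu z) (integrable_div_ofReal_sub hv z), mul_add]

lemma cauchySzego_smul (c : ℂ) (u : ℝ → ℂ) : cauchySzego (c • u) = c • cauchySzego u := by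
  funext z
  simp only [cauchySzego, Pi.smul_apply, smul_eq_mul, mul_div_assoc]
  rw [integral_const_mul]
  ring

lemma cauchySzego_congr {u v : ℝ → ℂ} (h : u =ᵐ[volume] v) : cauchySzego u = cauchySzego v := by
  funext z
  simp only [cauchySzego]
  congr 1
  refine integral_congr_ae ?_
  filter_upwards [h] with x hx
  rw [hx]

lemma mdifferentiable_cauchySzego {u : ℝ → ℂ} (hu : Integrable u) : MDiff (cauchySzego u) := by
  rw [UpperHalfPlane.mdifferentiable_iff]
  have key : DifferentiableOn ℂ
      (fun z : ℂ => (2 * (Real.pi : ℂ) * I)⁻¹ * ∫ t : ℝ, u t / ((t : ℂ) - z)) {z | 0 < z.im} := by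
    intro z hz
    have hz' : 0 < z.im := hz
    refine DifferentiableAt.differentiableWithinAt (DifferentiableAt.const_mul ?_ _)
    -- On this ball |t − w| ≥ Im z / 2 for all real t, which makes the differentiated integrand
    -- dominated by a multiple of |u|.
    have hball : ∀ w ∈ Metric.ball z (z.im / 2), z.im / 2 ≤ w.im := by
      intro w hw
      have h1 := Complex.abs_im_le_norm (w - z)
      rw [Metric.mem_ball, dist_eq] at hw
      rw [sub_im] at h1
      have := (abs_le.1 (h1.trans hw.le)).1
      linarith
    have hne : ∀ t : ℝ, ∀ w ∈ Metric.ball z (z.im / 2), (t : ℂ) - w ≠ 0 := by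
      intro t w hw h
      have h1 := im_le_norm_ofReal_sub t w
      rw [h, norm_zero] at h1
      have := hball w hw
      linarith
    have hcont : ∀ w ∈ Metric.ball z (z.im / 2),
        Continuous fun t : ℝ => ((t : ℂ) - w)⁻¹ := fun w hw =>
      (continuous_ofReal.sub continuous_const).inv₀ fun t => hne t w hw
    have hz0 : z ∈ Metric.ball z (z.im / 2) := Metric.mem_ball_self (by linarith)
    have h := hasDerivAt_integral_of_dominated_loc_of_deriv_le (μ := volume) (𝕜 := ℂ)
      (F := fun (w : ℂ) (t : ℝ) => u t / ((t : ℂ) - w))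
      (F' := fun (w : ℂ) (t : ℝ) => u t * (((t : ℂ) - w) ^ 2)⁻¹)
      (bound := fun t => ‖u t‖ * ((z.im / 2) ^ 2)⁻¹) (x₀ := z)
      (s := Metric.ball z (z.im / 2)) (Metric.ball_mem_nhds z (by linarith)) ?_ ?_ ?_ ?_ ?_ ?_
    · exact h.2.differentiableAt
    · filter_upwards [Metric.ball_mem_nhds z (by linarith : 0 < z.im / 2)] with w hw
      simp_rw [div_eq_mul_inv]
      exact hu.1.mul (hcont w hw).aestronglyMeasurable
    · exact integrable_div_ofReal_sub hu ⟨z, hz'⟩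
    · have := ((hcont z hz0).pow 2).aestronglyMeasurable (μ := volume)
      exact hu.1.mul (this.congr (Eventually.of_forall fun t => inv_pow _ _))
    · refine Eventually.of_forall fun t w hw => ?_
      rw [norm_mul, norm_inv, norm_pow]
      gcongr
      exact (hball w hw).trans (im_le_norm_ofReal_sub t w)
    · exact hu.norm.mul_const _
    · refine Eventually.of_forall fun t w hw => ?_
      have h1 : HasDerivAt (fun w : ℂ => (t : ℂ) - w) (-1) w := by
        simpa using (hasDerivAt_id w).const_sub (t : ℂ)
      have h2 := (h1.inv (hne t w hw)).const_mul (u t)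
      simp only [neg_neg, one_div] at h2
      exact h2
  refine key.congr fun z hz => ?_
  simp only [Function.comp_apply, cauchySzego]
  rw [UpperHalfPlane.ofComplex_apply_of_im_pos hz]

lemma norm_exp_two_pi_mul (z : ℂ) (ξ : ℝ) :
    ‖cexp (2 * Real.pi * I * z * ξ)‖ = Real.exp (-(2 * Real.pi * z.im) * ξ) := by
  rw [norm_exp]
  congr 1
  simp

/-- The Cauchy integral of `u ∈ L¹` is the Fourier–Laplace transform of `û` on `(0, ∞)`. -/
lemma cauchySzego_eq_integral_fourier {u : ℝ → ℂ} (hu : Integrable u) (z : ℍ) :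
    cauchySzego u z = ∫ ξ in Set.Ioi (0 : ℝ), 𝓕 u ξ * cexp (2 * Real.pi * I * z * ξ) := by
  have hy : 0 < z.im := z.im_pos
  -- The Cauchy kernel is a Laplace integral over positive frequencies, absolutely convergent
  -- because Im z > 0; Fubini then produces û.
  have hker : ∀ t : ℝ, ∫ ξ in Set.Ioi (0 : ℝ), cexp (2 * Real.pi * I * ((z : ℂ) - t) * ξ) =
      (2 * (Real.pi : ℂ) * I)⁻¹ * ((t : ℂ) - z)⁻¹ := by
    intro t
    rw [integral_exp_mul_complex_Ioi]
    · have h1 := ofReal_sub_coe_ne_zero t z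
      have h2 : (z : ℂ) - t ≠ 0 := by
        rw [← neg_sub]; exact neg_ne_zero.2 h1
      have h3 : (Real.pi : ℂ) ≠ 0 := ofReal_ne_zero.2 Real.pi_ne_zero
      rw [← neg_sub (z : ℂ) t, inv_neg]
      simp only [ofReal_zero, mul_zero, Complex.exp_zero]
      field_simp
    · have : (2 * Real.pi * I * ((z : ℂ) - t)).re = -(2 * Real.pi * z.im) := by
        simp
      rw [this]
      have := Real.pi_pos
      have : 0 < 2 * Real.pi * z.im := by positivity
      linarith
  have hexp : IntegrableOn (fun ξ : ℝ => Real.exp (-(2 * Real.pi * z.im) * ξ)) (Set.Ioi 0) :=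
    integrableOn_exp_mul_Ioi (by have := Real.pi_pos; simp; positivity) 0
  have hint : Integrable (Function.uncurry fun (t ξ : ℝ) =>
      u t * cexp (2 * Real.pi * I * ((z : ℂ) - t) * ξ))
      (volume.prod (volume.restrict (Set.Ioi 0))) := by
    have h := Integrable.mul_prod hu (hexp.ofReal (𝕜 := ℂ))
    refine h.mono ?_ (Eventually.of_forall fun p => ?_)
    · refine AEStronglyMeasurable.mul ?_ ?_
      · exact hu.1.comp_quasiMeasurePreserving Measure.quasiMeasurePreserving_fst
      · refine Continuous.aestronglyMeasurable ?_
        fun_prop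
    · simp only [Function.uncurry, norm_mul, norm_exp_two_pi_mul]
      simp [Complex.norm_exp]
  have e1 : cauchySzego u z = ∫ t, ∫ ξ in Set.Ioi (0 : ℝ),
      u t * cexp (2 * Real.pi * I * ((z : ℂ) - t) * ξ) := by
    rw [cauchySzego, ← integral_const_mul]
    refine integral_congr_ae (Eventually.of_forall fun t => ?_)
    simp only
    rw [integral_const_mul, hker]
    ring
  rw [e1, integral_integral_swap hint]
  refine integral_congr_ae (Eventually.of_forall fun ξ => ?_)
  simp only
  rw [Real.fourier_real_eq_integral_exp_smul, ← integral_mul_const]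
  refine integral_congr_ae (Eventually.of_forall fun t => ?_)
  simp only [smul_eq_mul]
  rw [mul_right_comm (cexp _), ← Complex.exp_add, mul_comm (u t)]
  congr 2
  push_cast
  ring

lemma cauchySzego_eq_zero {u : ℝ → ℂ} (hu : Integrable u) (h : ∀ ξ, 0 < ξ → 𝓕 u ξ = 0) :
    cauchySzego u = 0 := by
  funext z
  rw [cauchySzego_eq_integral_fourier hu, setIntegral_congr_fun measurableSet_Ioi
    (g := fun _ => 0) fun ξ hξ => by simp only; rw [h ξ hξ, zero_mul]]
  simp

lemma fourier_comp_neg (u : ℝ → ℂ) (ξ : ℝ) : 𝓕 (fun t => u (-t)) ξ = 𝓕 u (-ξ) := by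
  rw [← Real.fourierInv_eq_fourier_comp_neg, fourierInv_real_eq_fourier_neg]

/-- The reflection t ↦ −t exchanges the two spectral half-lines and carries z̄ to the point −z̄ of
the upper half-plane, so `cauchySzego_eq_zero` applies. -/
lemma integral_div_ofReal_sub_conj_eq_zero {u : ℝ → ℂ} (hu : Integrable u)
    (h : ∀ ξ, ξ < 0 → 𝓕 u ξ = 0) (z : ℍ) : ∫ t : ℝ, u t / ((t : ℂ) - conj (z : ℂ)) = 0 := by
  have h0 : cauchySzego (fun t => u (-t)) = 0 :=
    cauchySzego_eq_zero hu.comp_neg fun ξ hξ => by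
      rw [fourier_comp_neg]; exact h _ (by linarith)
  have him : 0 < (-conj (z : ℂ)).im := by simpa using z.im_pos
  have h1 := congrFun h0 ⟨-conj (z : ℂ), him⟩
  simp only [cauchySzego, Pi.zero_apply, mul_eq_zero, inv_eq_zero] at h1
  have h2 := h1.resolve_left (by simp [Real.pi_ne_zero])
  rw [← integral_neg_eq_self] at h2
  rw [← neg_eq_zero, ← integral_neg, ← h2]
  refine integral_congr_ae (Eventually.of_forall fun t => ?_)
  simp only [neg_neg]
  rw [← div_neg]
  congr 1
  push_cast
  ring

/-- The Cauchy integral of `g ∈ L¹` with spectrum in `[0, ∞)` is its Poisson integral. -/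
lemma cauchySzego_eq_poisson {g : ℝ → ℂ} (hg : Integrable g) (h : ∀ ξ, ξ < 0 → 𝓕 g ξ = 0)
    (x y : ℝ) (hy : 0 < y) :
    cauchySzego g (pt x y hy) = ∫ t : ℝ, (poisson y (x - t) : ℂ) * g t := by
  set z : ℍ := pt x y hy with hz
  have hzc : (z : ℂ) = x + y * I := Complex.mk_eq_add_mul_I x y
  have h0 := integral_div_ofReal_sub_conj_eq_zero hg h z
  have hconj : Integrable fun t : ℝ => g t / ((t : ℂ) - conj (z : ℂ)) := by
    have him : 0 < (-conj (z : ℂ)).im := by simpa using z.im_pos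
    have h1 := (integrable_div_ofReal_sub hg.comp_neg ⟨-conj (z : ℂ), him⟩).comp_neg.neg
    refine h1.congr (Eventually.of_forall fun t => ?_)
    simp only [Pi.neg_apply, neg_neg]
    rw [← div_neg]
    congr 1
    push_cast
    ring
  -- The Cauchy integral at z̄ vanishes, so it can be subtracted freely; (t − z)⁻¹ − (t − z̄)⁻¹ =
  -- 2iy / |t − z|² is 2πi times the Poisson kernel.
  have e : cauchySzego g z = (2 * (Real.pi : ℂ) * I)⁻¹ *
      ∫ t : ℝ, (g t / ((t : ℂ) - z) - g t / ((t : ℂ) - conj (z : ℂ))) := by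
    rw [integral_sub (integrable_div_ofReal_sub hg z) hconj, h0, sub_zero, cauchySzego]
  rw [e, ← integral_const_mul]
  refine integral_congr_ae (Eventually.of_forall fun t => ?_)
  have h1 := ofReal_sub_coe_ne_zero t z
  have h2 : (t : ℂ) - conj (z : ℂ) ≠ 0 := by
    have := (map_ne_zero (starRingEnd ℂ)).2 h1
    simpa using this
  have h3 : (Real.pi : ℂ) ≠ 0 := ofReal_ne_zero.2 Real.pi_ne_zero
  have h4 : ((x : ℂ) - t) ^ 2 + (y : ℂ) ^ 2 = ((t : ℂ) - z) * ((t : ℂ) - conj (z : ℂ)) := by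
    rw [hzc]
    simp only [map_add, map_mul, conj_ofReal, conj_I]
    linear_combination ((y : ℂ) ^ 2) * I_sq
  have h5 : (z : ℂ) - conj (z : ℂ) = 2 * y * I := by
    rw [hzc]
    simp only [map_add, map_mul, conj_ofReal, conj_I]
    ring
  simp only [poisson]
  push_cast
  rw [h4]
  field_simp
  linear_combination g t * h5

/-- `‖P₊ g‖_{H¹} ≤ ‖g‖_{L¹}` for `g` with spectrum in `[0, ∞)`. -/
lemma hardyNorm_cauchySzego_le {g : ℝ → ℂ} (hg : Integrable g) (h : ∀ ξ, ξ < 0 → 𝓕 g ξ = 0) :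
    hardyNorm (cauchySzego g) ≤ ∫⁻ t, ‖g t‖ₑ := by
  refine iSup₂_le fun y hy => ?_
  rw [← lintegral_lintegral_poisson_mul hy hg.1.enorm]
  refine lintegral_mono fun x => ?_
  rw [cauchySzego_eq_poisson hg h]
  refine (enorm_integral_le_lintegral_enorm _).trans (lintegral_mono fun t => ?_)
  rw [enorm_mul]
  gcongr
  rw [← ofReal_norm, norm_real, Real.norm_of_nonneg (poisson_nonneg hy _)]

lemma cauchySzego_mem_H1Plus {g : ℝ → ℂ} (hg : Integrable g) (h : ∀ ξ, ξ < 0 → 𝓕 g ξ = 0) :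
    cauchySzego g ∈ H1Plus :=
  ⟨mdifferentiable_cauchySzego hg, (hardyNorm_cauchySzego_le hg h).trans_lt hg.2⟩

lemma nontangential_le (x : ℝ) : nontangential x ≤ comap ((↑) : ℍ → ℂ) (𝓝 (x : ℂ)) :=
  iSup_le fun _ => inf_le_left

/-- The Cauchy integral of a Schwartz function with spectrum in `[0, ∞)` extends continuously
to the real line. -/
lemma tendsto_cauchySzego_schwartz (φ : 𝓢(ℝ, ℂ)) (h : ∀ ξ : ℝ, ξ < 0 → 𝓕 (φ : ℝ → ℂ) ξ = 0)
    (x : ℝ) : Tendsto (cauchySzego φ) (nontangential x) (𝓝 (φ x)) := by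
  -- The limit exists along every approach from the half-plane: φ̂ is integrable and the
  -- exponentials have modulus at most 1, so dominated convergence needs no cone.
  refine Tendsto.mono_left ?_ (nontangential_le x)
  have hF : Integrable (𝓕 (φ : ℝ → ℂ)) := by
    rw [← SchwartzMap.fourier_coe]; exact SchwartzMap.integrable _
  have hval : φ x = ∫ ξ in Set.Ioi (0 : ℝ), 𝓕 (φ : ℝ → ℂ) ξ *
      cexp (2 * Real.pi * I * (x : ℂ) * ξ) := by
    have h1 : φ x = 𝓕⁻ (𝓕 (φ : ℝ → ℂ)) x :=
      (congrFun (φ.continuous.fourierInv_fourier_eq φ.integrable hF) x).symm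
    rw [h1, fourierInv_real_eq_fourier_neg, Real.fourier_real_eq_integral_exp_smul,
      ← integral_Ici_eq_integral_Ioi, setIntegral_eq_integral_of_forall_compl_eq_zero]
    · refine integral_congr_ae (Eventually.of_forall fun ξ => ?_)
      simp only [smul_eq_mul]
      rw [mul_comm]
      congr 2
      push_cast
      ring
    · intro ξ hξ
      rw [h ξ (by simpa using hξ), zero_mul]
  rw [hval]
  have hfun : cauchySzego φ = fun z : ℍ => ∫ ξ in Set.Ioi (0 : ℝ), 𝓕 (φ : ℝ → ℂ) ξ *
      cexp (2 * Real.pi * I * (z : ℂ) * ξ) :=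
    funext fun z => cauchySzego_eq_integral_fourier φ.integrable z
  rw [hfun]
  refine tendsto_integral_filter_of_dominated_convergence (fun ξ => ‖𝓕 (φ : ℝ → ℂ) ξ‖)
    (Eventually.of_forall fun z => ?_) (Eventually.of_forall fun z => ?_) hF.norm.integrableOn ?_
  · refine ((continuous_fourier φ.integrable).mul ?_).aestronglyMeasurable
    fun_prop
  · filter_upwards [ae_restrict_mem measurableSet_Ioi] with ξ hξ
    rw [norm_mul, norm_exp_two_pi_mul]
    refine mul_le_of_le_one_right (norm_nonneg _) (Real.exp_le_one_iff.2 ?_)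
    have : 0 ≤ 2 * Real.pi * (z : ℂ).im * ξ := by
      have h1 := z.im_pos.le
      have h2 := (Set.mem_Ioi.1 hξ).le
      have h3 := Real.pi_pos.le
      have h4 : 0 ≤ (z : ℂ).im := h1
      positivity
    linarith
  · refine Eventually.of_forall fun ξ => ?_
    have hc : Continuous fun w : ℂ => 𝓕 (φ : ℝ → ℂ) ξ * cexp (2 * Real.pi * I * w * ξ) := by
      fun_prop
    exact (hc.tendsto (x : ℂ)).comp tendsto_comap

lemma boundary_cauchySzego_schwartz (φ : 𝓢(ℝ, ℂ))
    (h : ∀ ξ : ℝ, ξ < 0 → 𝓕 (φ : ℝ → ℂ) ξ = 0) : boundary (cauchySzego φ) = φ :=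
  funext fun x => boundary_eq (tendsto_cauchySzego_schwartz φ h x)

/-! ### Subharmonicity of `|F|^{1/2}` and Poisson majorization -/

/-- The sub-mean value property of `log |G|`. -/
lemma log_norm_le_circleAverage {G : ℂ → ℂ} {r : ℝ} (hr : 0 < r)
    (hG : AnalyticOnNhd ℂ G (Metric.closedBall 0 r)) (h0 : G 0 ≠ 0) :
    Real.log ‖G 0‖ ≤ Real.circleAverage (fun z => Real.log ‖G z‖) 0 r := by
  have hG' : AnalyticOnNhd ℂ G (Metric.closedBall 0 |r|) := by rwa [abs_of_pos hr]
  -- Jensen's formula: the average exceeds log|G(0)| by a sum over the zeros u in the disc of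
  -- multiplicity times log(r/|u|), and every term is nonnegative.
  rw [hG'.circleAverage_log_norm hr.ne' h0]
  refine le_add_of_nonneg_left (finsum_nonneg fun u => ?_)
  by_cases hu : u ∈ Metric.closedBall (0 : ℂ) |r|
  · refine mul_nonneg (mod_cast MeromorphicOn.AnalyticOnNhd.divisor_nonneg hG' u) ?_
    rcases eq_or_ne u 0 with rfl | hu0
    · simp
    · refine Real.log_nonneg ?_
      rw [zero_sub, norm_neg, ← div_eq_mul_inv, one_le_div (norm_pos_iff.2 hu0)]
      simpa [abs_of_pos hr] using hu
  · simp [hu]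

/-- The sub-mean value property of `|G|^{1/2}`. -/
lemma sqrt_norm_le_circleAverage {G : ℂ → ℂ} {r : ℝ} (hr : 0 < r)
    (hG : AnalyticOnNhd ℂ G (Metric.closedBall 0 r)) :
    √‖G 0‖ ≤ Real.circleAverage (fun z => √‖G z‖) 0 r := by
  have hr' : |r| = r := abs_of_pos hr
  rcases eq_or_ne (G 0) 0 with h0 | h0
  · rw [h0, norm_zero, Real.sqrt_zero]
    exact Real.circleAverage_nonneg_of_nonneg fun z _ => Real.sqrt_nonneg _
  have hsub : Metric.sphere (0 : ℂ) |r| ⊆ Metric.closedBall 0 r := by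
    rw [hr']; exact Metric.sphere_subset_closedBall
  have hlog := log_norm_le_circleAverage hr hG h0
  set c := √‖G 0‖ with hc
  have hc0 : 0 < c := Real.sqrt_pos.2 (norm_pos_iff.2 h0)
  have hlogc : Real.log ‖G 0‖ = 2 * Real.log c := by
    rw [hc, Real.log_sqrt (norm_nonneg _)]; ring
  -- At a zero of G the convention log 0 = 0 turns the minorant used below into c(1 − log c), which
  -- may exceed √0. Raising the function to K at the zeros repairs this; the zeros are too sparse to
  -- affect the circle average.
  set K := |c * (1 - Real.log c)|
  classical
  set s : ℂ → ℝ := fun z => if G z = 0 then K else √‖G z‖ with hs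
  have hcod : (fun z => √‖G z‖) =ᶠ[codiscreteWithin (Metric.sphere (0 : ℂ) |r|)] s := by
    have h1 : G ⁻¹' {0}ᶜ ∈ codiscreteWithin (Metric.closedBall (0 : ℂ) r) :=
      hG.preimage_zero_mem_codiscreteWithin h0 (by simp [hr.le])
        ((convex_closedBall (0 : ℂ) r).isConnected (Metric.nonempty_closedBall.2 hr.le))
    filter_upwards [codiscreteWithin_mono hsub h1] with z hz
    have : G z ≠ 0 := hz
    simp [hs, this]
  have hcs : CircleIntegrable (fun z => √‖G z‖) 0 r :=
    ContinuousOn.circleIntegrable' ((hG.continuousOn.mono hsub).norm.sqrt)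
  have hcl : CircleIntegrable (fun z => Real.log ‖G z‖) 0 r :=
    (hG.mono hsub).meromorphicOn.circleIntegrable_log_norm
  rw [Real.circleAverage_congr_codiscreteWithin hcod hr.ne']
  have hlin : CircleIntegrable (fun z => (c / 2) • Real.log ‖G z‖) 0 r := hcl.const_smul
  have hconst : CircleIntegrable (fun _ : ℂ => c * (1 - Real.log c)) 0 r :=
    circleIntegrable_const _ _ _
  -- The minorant (c/2) log s + c(1 − log c) ≤ √s is eᵗ ≥ 1 + t at t = log(√s / c). It is an
  -- equality at s = c² = |G(0)|, so averaging it loses nothing.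
  calc c ≤ (c / 2) * Real.circleAverage (fun z => Real.log ‖G z‖) 0 r
        + c * (1 - Real.log c) := by
        rw [hlogc] at hlog
        nlinarith
    _ = Real.circleAverage (fun z => (c / 2) • Real.log ‖G z‖ + c * (1 - Real.log c)) 0 r := by
        rw [Real.circleAverage_fun_add hlin hconst, Real.circleAverage_const,
          Real.circleAverage_fun_smul, smul_eq_mul]
    _ ≤ Real.circleAverage s 0 r := by
        refine Real.circleAverage_mono (hlin.add hconst) (hcs.congr_codiscreteWithin hcod)
          fun z hz => ?_
        by_cases hz0 : G z = 0
        · simp only [hs, hz0, if_true, norm_zero, Real.log_zero, smul_zero, zero_add]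
          exact le_abs_self _
        · simp only [hs, hz0, if_false, smul_eq_mul]
          have hpos : 0 < √‖G z‖ := Real.sqrt_pos.2 (norm_pos_iff.2 hz0)
          have h1 : Real.log ‖G z‖ = 2 * Real.log √‖G z‖ := by
            rw [Real.log_sqrt (norm_nonneg _)]; ring
          have h2 := Real.add_one_le_exp (Real.log √‖G z‖ - Real.log c)
          rw [Real.exp_sub, Real.exp_log hpos, Real.exp_log hc0, le_div_iff₀ hc0] at h2
          rw [h1]
          linarith

/-- The conformal map of the disc onto the upper half-plane taking `0` to `x + i y`. -/
def cayley (x y : ℝ) (w : ℂ) : ℂ := x + y * I * ((1 + w) / (1 - w))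

lemma cayley_zero (x y : ℝ) : cayley x y 0 = x + y * I := by simp [cayley]

lemma one_sub_ne_zero_of_norm_lt {w : ℂ} (hw : ‖w‖ < 1) : 1 - w ≠ 0 := by
  intro h
  rw [← sub_eq_zero.1 h] at hw
  simp at hw

lemma cayley_im_pos (x : ℝ) {y : ℝ} (hy : 0 < y) {w : ℂ} (hw : ‖w‖ < 1) :
    0 < (cayley x y w).im := by
  have h1 : (cayley x y w).im = y * ((1 + w) / (1 - w)).re := by
    simp [cayley]
  have hn : 0 < normSq (1 - w) := normSq_pos.2 (one_sub_ne_zero_of_norm_lt hw)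
  have hw2 : w.re * w.re + w.im * w.im < 1 := by
    have := Complex.normSq_eq_norm_sq w
    rw [normSq_apply] at this
    nlinarith [norm_nonneg w]
  have h2 : ((1 + w) / (1 - w)).re = (1 - (w.re * w.re + w.im * w.im)) / normSq (1 - w) := by
    rw [div_re]
    simp only [add_re, one_re, sub_re, add_im, one_im, sub_im, zero_add, zero_sub]
    field_simp
    ring
  rw [h1, h2]
  have : 0 < 1 - (w.re * w.re + w.im * w.im) := by linarith
  positivity

lemma differentiableOn_cayley (x y : ℝ) : DifferentiableOn ℂ (cayley x y) {w | 1 - w ≠ 0} := by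
  intro w hw
  refine DifferentiableAt.differentiableWithinAt ?_
  unfold cayley
  refine (differentiableAt_const _).add ((differentiableAt_const _).mul ?_)
  exact ((differentiableAt_const _).add differentiableAt_id).div
    ((differentiableAt_const _).sub differentiableAt_id) hw

lemma exp_two_arctan_mul_I (s : ℝ) :
    cexp ((2 * Real.arctan s : ℝ) * I) = (1 + s * I) / (1 - s * I) := by
  have hpos : 0 < 1 + s ^ 2 := by positivity
  have hsq : ((√(1 + s ^ 2) : ℝ) : ℂ) ^ 2 = 1 + (s : ℂ) ^ 2 := by
    rw [← ofReal_pow, Real.sq_sqrt hpos.le]; push_cast; ring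
  have hne : ((√(1 + s ^ 2) : ℝ) : ℂ) ≠ 0 := ofReal_ne_zero.2 (Real.sqrt_pos.2 hpos).ne'
  have hd : (1 : ℂ) - s * I ≠ 0 := by
    intro h
    have := congrArg Complex.re h
    simp at this
  have h1 : cexp ((Real.arctan s : ℝ) * I) = (1 + s * I) / (√(1 + s ^ 2) : ℝ) := by
    rw [exp_mul_I, ← ofReal_cos, ← ofReal_sin, Real.cos_arctan, Real.sin_arctan]
    push_cast
    field_simp
  have h2 : cexp ((2 * Real.arctan s : ℝ) * I) = cexp ((Real.arctan s : ℝ) * I) ^ 2 := by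
    rw [← Complex.exp_nat_mul]
    congr 1
    push_cast
    ring
  rw [h2, h1, div_pow, hsq, div_eq_div_iff (by
    rw [← hsq]; exact pow_ne_zero 2 hne) hd]
  linear_combination (-(s : ℂ) ^ 2 - (s : ℂ) ^ 3 * I) * I_sq

/-- The circle parameter of the real point `t` under `cayley x y`. -/
def cayleyAngle (x y t : ℝ) : ℝ := Real.pi + 2 * Real.arctan ((t - x) / y)

lemma circleMap_cayleyAngle (x y t : ℝ) : circleMap 0 1 (cayleyAngle x y t) =
    -((1 + ((t - x) / y : ℝ) * I) / (1 - ((t - x) / y : ℝ) * I)) := by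
  rw [← exp_two_arctan_mul_I, circleMap, cayleyAngle]
  push_cast
  rw [add_mul, Complex.exp_add, exp_pi_mul_I]
  ring

lemma cayley_circleMap_cayleyAngle (x : ℝ) {y : ℝ} (hy : 0 < y) (t : ℝ) :
    1 - circleMap 0 1 (cayleyAngle x y t) ≠ 0 ∧
      cayley x y (circleMap 0 1 (cayleyAngle x y t)) = t := by
  set s : ℝ := (t - x) / y with hs
  have hd : (1 : ℂ) - s * I ≠ 0 := by
    intro h
    have := congrArg Complex.re h
    simp at this
  have h1 : circleMap 0 1 (cayleyAngle x y t) = -((1 + s * I) / (1 - s * I)) :=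
    circleMap_cayleyAngle x y t
  have h2 : 1 - circleMap 0 1 (cayleyAngle x y t) = 2 / (1 - s * I) := by
    rw [h1]; field_simp; ring
  have h3 : 1 + circleMap 0 1 (cayleyAngle x y t) = -2 * s * I / (1 - s * I) := by
    rw [h1]; field_simp; ring
  refine ⟨by rw [h2]; exact div_ne_zero two_ne_zero hd, ?_⟩
  have h4 : (t : ℂ) = x + y * s := by
    rw [hs]
    push_cast
    have : (y : ℂ) ≠ 0 := ofReal_ne_zero.2 hy.ne'
    field_simp
    ring
  have h5 : -2 * s * I / (1 - s * I) / (2 / (1 - s * I)) = -(s * I) := by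
    field_simp
  rw [cayley, h2, h3, h4, h5]
  linear_combination (-(y : ℂ) * s) * I_sq

/-- Normalized arc length on the circle corresponds to harmonic measure of the line seen from x +
iy; this is the Jacobian that turns circle averages into Poisson integrals. -/
lemma hasDerivAt_cayleyAngle (x : ℝ) {y : ℝ} (hy : 0 < y) (t : ℝ) :
    HasDerivAt (cayleyAngle x y) (2 * Real.pi * poisson y (x - t)) t := by
  have h1 : HasDerivAt (fun t : ℝ => (t - x) / y) (1 / y) t :=
    ((hasDerivAt_id t).sub_const x).div_const y
  have h2 := ((h1.arctan).const_mul 2).const_add Real.pi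
  refine h2.congr_deriv ?_
  have := Real.pi_pos
  rw [poisson_sub_comm, poisson_eq hy]
  field_simp

lemma image_cayleyAngle (x : ℝ) {y : ℝ} (hy : 0 < y) :
    cayleyAngle x y '' Set.univ = Set.Ioo 0 (2 * Real.pi) := by
  ext θ
  simp only [Set.image_univ, Set.mem_range, Set.mem_Ioo, cayleyAngle]
  constructor
  · rintro ⟨t, rfl⟩
    have h1 := Real.neg_pi_div_two_lt_arctan ((t - x) / y)
    have h2 := Real.arctan_lt_pi_div_two ((t - x) / y)
    constructor <;> linarith
  · rintro ⟨h1, h2⟩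
    refine ⟨x + y * Real.tan ((θ - Real.pi) / 2), ?_⟩
    have : (x + y * Real.tan ((θ - Real.pi) / 2) - x) / y = Real.tan ((θ - Real.pi) / 2) := by
      field_simp
      ring
    rw [this, Real.arctan_tan (by linarith) (by linarith)]
    ring

lemma injective_cayleyAngle (x : ℝ) {y : ℝ} (hy : 0 < y) :
    Function.Injective (cayleyAngle x y) := by
  intro a b h
  have h1 : Real.arctan ((a - x) / y) = Real.arctan ((b - x) / y) := by
    unfold cayleyAngle at h; linarith
  have h2 := Real.arctan_injective h1
  field_simp at h2
  linarith

/-- Integrals over the circle as Poisson integrals over the line. -/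
lemma integral_circle_eq_integral_poisson (x : ℝ) {y : ℝ} (hy : 0 < y) (k : ℝ → ℝ) :
    (2 * Real.pi)⁻¹ * ∫ θ in Set.Ioo 0 (2 * Real.pi), k θ =
      ∫ t, poisson y (x - t) * k (cayleyAngle x y t) := by
  have hpi := Real.pi_pos
  rw [← image_cayleyAngle x hy, integral_image_eq_integral_abs_deriv_smul MeasurableSet.univ
    (fun t _ => (hasDerivAt_cayleyAngle x hy t).hasDerivWithinAt)
    (injective_cayleyAngle x hy).injOn, setIntegral_univ, ← integral_const_mul]
  refine integral_congr_ae (Eventually.of_forall fun t => ?_)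
  simp only [smul_eq_mul]
  rw [abs_of_nonneg (by have := poisson_nonneg hy (x - t); positivity)]
  field_simp

/-- Poisson majorization of `|F|^{1/2}` for `F` bounded and holomorphic in a neighbourhood of the
closed upper half-plane. -/
lemma sqrt_norm_le_integral_poisson {F : ℂ → ℂ} {ε B : ℝ} (hε : 0 < ε)
    (hF : DifferentiableOn ℂ F {z | -ε < z.im}) (hB : ∀ z : ℂ, 0 ≤ z.im → ‖F z‖ ≤ B)
    (x : ℝ) {y : ℝ} (hy : 0 < y) :
    √‖F (x + y * I)‖ ≤ ∫ t : ℝ, poisson y (x - t) * √‖F t‖ := by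
  have hopen : IsOpen {z : ℂ | -ε < z.im} := isOpen_lt continuous_const continuous_im
  -- The Cayley map has its pole at w = 1 on the unit circle, so the mean value inequality is used
  -- on radii r < 1 and then r → 1. The shift by 2 keeps every radius positive.
  set r : ℕ → ℝ := fun n => 1 - 1 / ((n : ℝ) + 2) with hr
  have hr0 : ∀ n, 0 < r n := fun n => by
    have : 1 / ((n : ℝ) + 2) ≤ 1 / 2 := by gcongr; linarith [n.cast_nonneg (α := ℝ)]
    simp only [hr]; linarith
  have hr1 : ∀ n, r n < 1 := fun n => by
    have : 0 < 1 / ((n : ℝ) + 2) := by positivity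
    simp only [hr]; linarith
  have hrlim : Tendsto r atTop (𝓝 1) := by
    have h : Tendsto (fun n : ℕ => 1 / ((n : ℝ) + 2)) atTop (𝓝 0) :=
      tendsto_const_nhds.div_atTop
        (tendsto_atTop_add_const_right _ _ tendsto_natCast_atTop_atTop)
    simpa [hr] using h.const_sub 1
  have hdisc : DifferentiableOn ℂ (fun w => F (cayley x y w)) (Metric.ball 0 1) := by
    refine hF.comp ((differentiableOn_cayley x y).mono fun w hw => ?_) fun w hw => ?_
    · exact one_sub_ne_zero_of_norm_lt (by simpa using hw)
    · have := cayley_im_pos x hy (w := w) (by simpa using hw)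
      change -ε < _
      linarith
  have hstep : ∀ n, √‖F (x + y * I)‖ ≤
      (2 * Real.pi)⁻¹ * ∫ θ in Set.Ioo 0 (2 * Real.pi),
        √‖F (cayley x y (circleMap 0 (r n) θ))‖ := by
    intro n
    have han : AnalyticOnNhd ℂ (fun w => F (cayley x y w)) (Metric.closedBall 0 (r n)) :=
      (hdisc.analyticOnNhd Metric.isOpen_ball).mono
        (Metric.closedBall_subset_ball (hr1 n))
    have h := sqrt_norm_le_circleAverage (hr0 n) han
    rw [cayley_zero, Real.circleAverage_def, smul_eq_mul,
      intervalIntegral.integral_of_le Real.two_pi_pos.le, integral_Ioc_eq_integral_Ioo] at h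
    exact h
  have hB0 : 0 ≤ B := (norm_nonneg _).trans (hB 0 le_rfl)
  have hlim : Tendsto (fun n => ∫ θ in Set.Ioo 0 (2 * Real.pi),
      √‖F (cayley x y (circleMap 0 (r n) θ))‖) atTop
      (𝓝 (∫ θ in Set.Ioo 0 (2 * Real.pi), √‖F (cayley x y (circleMap 0 1 θ))‖)) := by
    have hin : ∀ n θ, ‖circleMap 0 (r n) θ‖ < 1 := fun n θ => by
      rw [norm_circleMap_zero, abs_of_pos (hr0 n)]; exact hr1 n
    refine tendsto_integral_of_dominated_convergence (fun _ => √B) (fun n => ?_)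
      (integrable_const _) (fun n => Eventually.of_forall fun θ => ?_) ?_
    · refine Continuous.aestronglyMeasurable ?_
      refine Continuous.sqrt (Continuous.norm ?_)
      exact hdisc.continuousOn.comp_continuous (continuous_circleMap 0 (r n)) fun θ => by
        simpa using hin n θ
    · rw [Real.norm_of_nonneg (Real.sqrt_nonneg _)]
      exact Real.sqrt_le_sqrt (hB _ (cayley_im_pos x hy (hin n θ)).le)
    -- Each angle in (0, 2π) is the image of a real t, where F is continuous because it is
    -- holomorphic on Im z > −ε.
    · filter_upwards [ae_restrict_mem measurableSet_Ioo] with θ hθ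
      rw [← image_cayleyAngle x hy] at hθ
      obtain ⟨t, -, rfl⟩ := hθ
      obtain ⟨h1, h2⟩ := cayley_circleMap_cayleyAngle x hy t
      have hc1 : Tendsto (fun n => circleMap 0 (r n) (cayleyAngle x y t)) atTop
          (𝓝 (circleMap 0 1 (cayleyAngle x y t))) := by
        simp only [circleMap]
        exact (((continuous_ofReal.tendsto 1).comp hrlim).mul_const _).const_add _
      have hopen' : IsOpen {w : ℂ | 1 - w ≠ 0} :=
        isOpen_ne_fun (continuous_const.sub continuous_id) continuous_const
      have hc2 : ContinuousAt (cayley x y) (circleMap 0 1 (cayleyAngle x y t)) :=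
        ((differentiableOn_cayley x y).differentiableAt (hopen'.mem_nhds h1)).continuousAt
      have hc3 : ContinuousAt F (cayley x y (circleMap 0 1 (cayleyAngle x y t))) := by
        refine (hF.differentiableAt (hopen.mem_nhds ?_)).continuousAt
        rw [h2]
        simpa using hε
      exact ((Real.continuous_sqrt.tendsto _).comp
        ((hc3.tendsto.comp (hc2.tendsto.comp hc1)).norm))
  have hfin := ge_of_tendsto (hlim.const_mul (2 * Real.pi)⁻¹) (Eventually.of_forall hstep)
  rw [integral_circle_eq_integral_poisson x hy] at hfin
  simpa only [(cayley_circleMap_cayleyAngle x hy _).2] using hfin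

/-! ### Contour integration -/

/-- The integral over horizontal lines of a holomorphic function on the upper half-plane that is
`O((1 + |z|²)⁻¹)` vanishes. -/
lemma integral_horizontal_eq_zero {W : ℂ → ℂ} {C : ℝ}
    (hW : DifferentiableOn ℂ W {z | 0 < z.im})
    (hC : ∀ z : ℂ, 0 < z.im → ‖W z‖ ≤ C / (1 + ‖z‖ ^ 2)) {y : ℝ} (hy : 0 < y) :
    ∫ x : ℝ, W (x + y * I) = 0 := by
  have hC0 : 0 ≤ C := by
    have h1 := (norm_nonneg _).trans (hC I (by simp))
    simp only [norm_I] at h1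
    linarith
  have hcont : Continuous fun x : ℝ => W (x + y * I) :=
    hW.continuousOn.comp_continuous (by fun_prop) fun x => by simpa using hy
  have hint : Integrable fun x : ℝ => W (x + y * I) := by
    refine (integrable_inv_one_add_sq.const_mul C).mono' hcont.aestronglyMeasurable
      (Eventually.of_forall fun x => ?_)
    refine (hC _ (by simpa using hy)).trans ?_
    rw [div_eq_mul_inv]
    have := Complex.abs_re_le_norm (x + y * I)
    simp only [add_re, ofReal_re, mul_re, I_re, mul_zero, ofReal_im, I_im, mul_one, sub_self,
      add_zero] at this
    rw [← sq_abs x]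
    gcongr
  have hlim := intervalIntegral_tendsto_integral hint tendsto_neg_atTop_atBot tendsto_id
  have hzero : Tendsto (fun R : ℝ => ∫ x in (-R)..R, W (x + y * I)) atTop (𝓝 0) := by
    have hup : Tendsto (fun R : ℝ => 4 * C * R⁻¹) atTop (𝓝 0) := by
      simpa using tendsto_inv_atTop_zero.const_mul (4 * C)
    refine squeeze_zero_norm' ?_ hup
    filter_upwards [eventually_gt_atTop 0] with R hR
    -- Cauchy's theorem on [−R, R] × [y, y + R]. The three sides other than the base stay at
    -- distance at least R from the origin, where |W| ≤ C/R².
    have hrect := integral_boundary_rect_eq_zero_of_differentiableOn W (-R + y * I)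
      (R + (y + R : ℝ) * I) (hW.mono fun z hz => by
        have h1 := hz.2
        simp only [Set.mem_preimage, add_im, neg_im, ofReal_im, mul_im, ofReal_re, I_im,
          mul_one, I_re, mul_zero, add_zero, neg_zero, zero_add] at h1
        rw [Set.uIcc_of_le (by linarith)] at h1
        exact hy.trans_le h1.1)
    have hre1 : (-(R : ℂ) + y * I).re = -R := by simp
    have hre2 : ((R : ℂ) + (y + R : ℝ) * I).re = R := by simp
    have him1 : (-(R : ℂ) + y * I).im = y := by simp
    have him2 : ((R : ℂ) + (y + R : ℝ) * I).im = y + R := by simp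
    rw [hre1, hre2, him1, him2] at hrect
    have hb : ∀ z : ℂ, 0 < z.im → R ≤ ‖z‖ → ‖W z‖ ≤ C / R ^ 2 := by
      intro z hz hRz
      refine (hC z hz).trans ?_
      gcongr
      nlinarith
    have h1 : ‖∫ x in (-R)..R, W (x + (y + R : ℝ) * I)‖ ≤ C / R ^ 2 * |R - -R| := by
      refine intervalIntegral.norm_integral_le_of_norm_le_const fun x _ => hb _ ?_ ?_
      · simp; linarith
      · have := Complex.abs_im_le_norm (x + (y + R : ℝ) * I)
        simp only [add_im, ofReal_im, mul_im, ofReal_re, I_im, mul_one, I_re, mul_zero, add_zero,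
          zero_add] at this
        exact (by linarith : R ≤ y + R).trans ((le_abs_self _).trans this)
    have h2 : ∀ a : ℝ, |a| = R → ‖∫ s in y..(y + R), W (a + s * I)‖ ≤
        C / R ^ 2 * |y + R - y| := by
      intro a ha
      refine intervalIntegral.norm_integral_le_of_norm_le_const fun s hs => hb _ ?_ ?_
      · rw [Set.uIoc_of_le (by linarith)] at hs
        simpa using hy.trans hs.1
      · have := Complex.abs_re_le_norm (a + s * I)
        simp only [add_re, ofReal_re, mul_re, I_re, mul_zero, ofReal_im, I_im, mul_one, sub_self,
          add_zero] at this
        rwa [ha] at this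
    have h3 := h2 R (abs_of_pos hR)
    have h4 := h2 (-R) (by rw [abs_neg, abs_of_pos hR])
    have e : ∫ x in (-R)..R, W (x + y * I) = (∫ x in (-R)..R, W (x + (y + R : ℝ) * I)) -
        I • (∫ s in y..(y + R), W (R + s * I)) +
        I • (∫ s in y..(y + R), W ((-R : ℝ) + s * I)) := by
      linear_combination hrect
    rw [e]
    -- The three sides have total length 2R + R + R = 4R.
    have e2 : C / R ^ 2 * |R - -R| + C / R ^ 2 * |y + R - y| + C / R ^ 2 * |y + R - y| =
        4 * C * R⁻¹ := by
      rw [show R - -R = 2 * R by ring, show y + R - y = R by ring, abs_of_pos hR,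
        abs_of_pos (by linarith : 0 < 2 * R)]
      field_simp
      ring
    rw [← e2]
    refine (norm_add_le _ _).trans (add_le_add ((norm_sub_le _ _).trans (add_le_add h1 ?_)) ?_)
    · rw [norm_smul, norm_I, one_mul]; exact h3
    · rw [norm_smul, norm_I, one_mul]; exact h4
  exact tendsto_nhds_unique hlim hzero

/-! ### The area mean value inequality -/

/-- A crude area mean value inequality for holomorphic functions. -/
lemma enorm_le_lintegral_ball {F : ℂ → ℂ} {z : ℂ} {R : ℝ} (hR : 0 < R)
    (hF : DifferentiableOn ℂ F (Metric.ball z R)) :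
    ENNReal.ofReal (R ^ 2 / 4) * ‖F z‖ₑ ≤ ∫⁻ w in Metric.ball z R, ‖F w‖ₑ := by
  have hpi := Real.pi_pos
  set g : ℂ → ℝ≥0∞ := fun w => (Metric.ball z R).indicator (fun w => ‖F w‖ₑ) (z + w) with hg
  have e1 : ∫⁻ w in Metric.ball z R, ‖F w‖ₑ = ∫⁻ w, g w := by
    rw [← lintegral_indicator Metric.isOpen_ball.measurableSet,
      ← lintegral_add_left_eq_self _ z]
  have hgeq : ∀ r ∈ Set.Ioo (R / 2) R, ∀ θ : ℝ,
      ‖F (circleMap z r θ)‖ₑ = g (Complex.polarCoord.symm (r, θ)) := by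
    intro r hr θ
    have hr0 : 0 < r := (by linarith : 0 < R / 2).trans hr.1
    have h1 : z + Complex.polarCoord.symm (r, θ) = circleMap z r θ := by
      rw [Complex.polarCoord_symm_apply, circleMap, exp_mul_I]
      push_cast
      rfl
    have h2 : circleMap z r θ ∈ Metric.ball z R := by
      rw [Metric.mem_ball, dist_eq, circleMap_sub_center, norm_circleMap_zero, abs_of_pos hr0]
      exact hr.2
    rw [hg]
    simp only [h1]
    rw [Set.indicator_of_mem h2]
  have hcirc : ∀ r ∈ Set.Ioo (R / 2) R, ENNReal.ofReal (2 * Real.pi) * ‖F z‖ₑ ≤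
      ∫⁻ θ in Set.Ioo (-Real.pi) Real.pi, g (Complex.polarCoord.symm (r, θ)) := by
    intro r hr
    have hr0 : 0 < r := (by linarith : 0 < R / 2).trans hr.1
    have hsub : Metric.closedBall z r ⊆ Metric.ball z R := Metric.closedBall_subset_ball hr.2
    have hd : DiffContOnCl ℂ F (Metric.ball z |r|) := by
      rw [abs_of_pos hr0]
      exact (hF.mono hsub).diffContOnCl_ball subset_rfl
    have hmean := hd.circleAverage
    rw [Real.circleAverage_eq_integral_add (-Real.pi),
      intervalIntegral.integral_comp_add_right (fun θ => F (circleMap z r θ)),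
      show 0 + -Real.pi = -Real.pi by ring, show 2 * Real.pi + -Real.pi = Real.pi by ring,
      intervalIntegral.integral_of_le (by linarith), integral_Ioc_eq_integral_Ioo] at hmean
    have h2 : (∫ θ in Set.Ioo (-Real.pi) Real.pi, F (circleMap z r θ)) =
        (2 * Real.pi : ℝ) • F z := by
      rw [← hmean, smul_smul, mul_inv_cancel₀ (by positivity), one_smul]
    have h3 := enorm_integral_le_lintegral_enorm
      (μ := volume.restrict (Set.Ioo (-Real.pi) Real.pi)) (fun θ => F (circleMap z r θ))
    rw [h2, enorm_smul, Real.enorm_of_nonneg (by positivity)] at h3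
    refine h3.trans (le_of_eq (lintegral_congr fun θ => ?_))
    rw [hgeq r hr θ]
  have hmem : ∀ p ∈ Set.Ioo (R / 2) R ×ˢ Set.Ioo (-Real.pi) Real.pi,
      circleMap z p.1 p.2 ∈ Metric.ball z R := fun p hp => by
    have := hp.1.1
    rw [Metric.mem_ball, dist_eq, circleMap_sub_center, norm_circleMap_zero,
      abs_of_pos (by linarith)]
    exact hp.1.2
  have hmeas : AEMeasurable (fun p : ℝ × ℝ => ENNReal.ofReal p.1 • g (Complex.polarCoord.symm p))
      (volume.restrict (Set.Ioo (R / 2) R ×ˢ Set.Ioo (-Real.pi) Real.pi)) := by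
    have hcont : ContinuousOn (fun p : ℝ × ℝ => F (circleMap z p.1 p.2))
        (Set.Ioo (R / 2) R ×ˢ Set.Ioo (-Real.pi) Real.pi) := by
      refine hF.continuousOn.comp (Continuous.continuousOn ?_) hmem
      simp only [circleMap]
      fun_prop
    have h1 := (hcont.aemeasurable (μ := volume)
      (measurableSet_Ioo.prod measurableSet_Ioo)).enorm
    refine (measurable_fst.ennreal_ofReal.aemeasurable.mul h1).congr ?_
    filter_upwards [ae_restrict_mem (measurableSet_Ioo.prod measurableSet_Ioo)] with p hp
    simp only [smul_eq_mul]
    rw [← hgeq p.1 hp.1 p.2]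
    rfl
  rw [e1, ← Complex.lintegral_comp_polarCoord_symm]
  -- Only the annulus R/2 < r < R is kept. There the Jacobian r is at least R/2, which gives
  -- (R/2)(R/2)(2π) = πR²/2 ≥ R²/4.
  calc ENNReal.ofReal (R ^ 2 / 4) * ‖F z‖ₑ
      ≤ ∫⁻ r in Set.Ioo (R / 2) R, ENNReal.ofReal (R / 2) *
          (ENNReal.ofReal (2 * Real.pi) * ‖F z‖ₑ) := by
        rw [setLIntegral_const, Real.volume_Ioo, mul_comm (ENNReal.ofReal (R / 2)),
          mul_comm (ENNReal.ofReal (2 * Real.pi)), mul_assoc, mul_assoc, mul_comm,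
          ← ENNReal.ofReal_mul (by positivity), ← ENNReal.ofReal_mul (by positivity)]
        gcongr
        have := Real.two_le_pi
        nlinarith [sq_nonneg R]
    _ ≤ ∫⁻ r in Set.Ioo (R / 2) R, ∫⁻ θ in Set.Ioo (-Real.pi) Real.pi,
          ENNReal.ofReal r • g (Complex.polarCoord.symm (r, θ)) := by
        refine setLIntegral_mono' measurableSet_Ioo fun r hr => ?_
        simp only [smul_eq_mul]
        rw [lintegral_const_mul' _ _ ENNReal.ofReal_ne_top]
        gcongr
        · exact hr.1.le
        · exact hcirc r hr
    _ = ∫⁻ p in Set.Ioo (R / 2) R ×ˢ Set.Ioo (-Real.pi) Real.pi,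
          ENNReal.ofReal p.1 • g (Complex.polarCoord.symm p) := by
        rw [Measure.volume_eq_prod, ← Measure.prod_restrict] at hmeas ⊢
        rw [lintegral_prod _ hmeas]
    _ ≤ _ := by
        refine lintegral_mono_set (Set.prod_mono (fun r hr => ?_) subset_rfl)
        exact (by linarith : 0 < R / 2).trans hr.1

/-! ### Boundary behaviour of functions in `H¹(ℂ⁺)` -/

/-- The extension of `f : ℍ → ℂ` to the complex plane used for complex analysis. -/
def ext (f : ℍ → ℂ) (z : ℂ) : ℂ := f (UpperHalfPlane.ofComplex z)

lemma ext_coe (f : ℍ → ℂ) (z : ℍ) : ext f z = f z := by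
  rw [ext, UpperHalfPlane.ofComplex_apply]

lemma coe_pt (x y : ℝ) (hy : 0 < y) : ((pt x y hy : ℍ) : ℂ) = x + y * I :=
  Complex.mk_eq_add_mul_I x y

lemma ext_apply (f : ℍ → ℂ) (x : ℝ) {y : ℝ} (hy : 0 < y) : ext f (x + y * I) = f (pt x y hy) := by
  rw [← coe_pt x y hy, ext_coe]

lemma differentiableOn_ext {f : ℍ → ℂ} (hf : MDiff f) : DifferentiableOn ℂ (ext f) {z | 0 < z.im} :=
  UpperHalfPlane.mdifferentiable_iff.1 hf

lemma lintegral_level_le (f : ℍ → ℂ) {y : ℝ} (hy : 0 < y) :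
    ∫⁻ x : ℝ, ‖f (pt x y hy)‖ₑ ≤ hardyNorm f :=
  le_iSup₂ (f := fun (y : ℝ) (hy : 0 < y) => ∫⁻ x : ℝ, ‖f (pt x y hy)‖ₑ) y hy

lemma integrable_level {f : ℍ → ℂ} (hf : f ∈ H1Plus) {y : ℝ} (hy : 0 < y) :
    Integrable fun x : ℝ => f (pt x y hy) :=
  ⟨(hf.1.continuous.comp (continuous_pt y hy)).aestronglyMeasurable,
    (lintegral_level_le f hy).trans_lt hf.2⟩

/-- Functions in `H¹(ℂ⁺)` are bounded on `Im z ≥ ε`. -/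
lemma exists_bound_of_mem_H1Plus {f : ℍ → ℂ} (hf : f ∈ H1Plus) {ε : ℝ} (hε : 0 < ε) :
    ∃ B : ℝ, ∀ z : ℂ, ε ≤ z.im → ‖ext f z‖ ≤ B := by
  have hdiff := differentiableOn_ext hf.1
  -- The disc of radius ε about z lies in a horizontal strip of width 2ε inside the half-plane, and
  -- each line of the strip carries mass at most `hardyNorm f`.
  have key : ∀ z : ℂ, ε ≤ z.im → ENNReal.ofReal (ε ^ 2 / 4) * ‖ext f z‖ₑ ≤
      ENNReal.ofReal (2 * ε) * hardyNorm f := by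
    intro z hz
    have hball : ∀ w ∈ Metric.ball z ε, w.im ∈ Set.Ioo (z.im - ε) (z.im + ε) := by
      intro w hw
      have h1 := Complex.abs_im_le_norm (w - z)
      rw [Metric.mem_ball, dist_eq] at hw
      rw [sub_im] at h1
      have := abs_lt.1 (h1.trans_lt hw)
      exact ⟨by linarith, by linarith⟩
    refine (enorm_le_lintegral_ball hε (hdiff.mono fun w hw => ?_)).trans ?_
    · have := (hball w hw).1
      change 0 < w.im
      linarith
    set S : Set ℂ := {w | w.im ∈ Set.Ioo (z.im - ε) (z.im + ε)} with hS
    have hSm : MeasurableSet S := measurable_im measurableSet_Ioo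
    have hpos : ∀ s ∈ Set.Ioo (z.im - ε) (z.im + ε), 0 < s := fun s hs => by
      have := hs.1; linarith
    have e := (Complex.volume_preserving_equiv_real_prod.symm).setLIntegral_comp_preimage_emb
      measurableEquivRealProd.symm.measurableEmbedding (fun w => ‖ext f w‖ₑ) S
    have hpre : measurableEquivRealProd.symm ⁻¹' S =
        Set.univ ×ˢ Set.Ioo (z.im - ε) (z.im + ε) := by
      ext p
      simp [hS, measurableEquivRealProd]
    calc ∫⁻ w in Metric.ball z ε, ‖ext f w‖ₑ ≤ ∫⁻ w in S, ‖ext f w‖ₑ :=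
          lintegral_mono_set hball
      _ = ∫⁻ p : ℝ × ℝ in Set.univ ×ˢ Set.Ioo (z.im - ε) (z.im + ε),
            ‖ext f (p.1 + p.2 * I)‖ₑ := by
          rw [← e, hpre]
          refine lintegral_congr fun p => ?_
          congr 2
          exact Complex.mk_eq_add_mul_I p.1 p.2
      _ = ∫⁻ s in Set.Ioo (z.im - ε) (z.im + ε), ∫⁻ x : ℝ, ‖ext f (x + s * I)‖ₑ := by
          have hcont : ContinuousOn (fun p : ℝ × ℝ => ext f (p.1 + p.2 * I))
              (Set.univ ×ˢ Set.Ioo (z.im - ε) (z.im + ε)) := by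
            refine hdiff.continuousOn.comp (Continuous.continuousOn (by fun_prop)) fun p hp => ?_
            have := hpos _ hp.2
            simpa using this
          have hm := (hcont.aemeasurable (μ := volume)
            (MeasurableSet.univ.prod measurableSet_Ioo)).enorm
          rw [Measure.volume_eq_prod, ← Measure.prod_restrict, Measure.restrict_univ] at hm ⊢
          rw [lintegral_prod_symm _ hm]
      _ ≤ ∫⁻ s in Set.Ioo (z.im - ε) (z.im + ε), hardyNorm f := by
          refine setLIntegral_mono' measurableSet_Ioo fun s hs => ?_
          simp_rw [ext_apply f _ (hpos s hs)]
          exact lintegral_level_le f _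
      _ = ENNReal.ofReal (2 * ε) * hardyNorm f := by
          rw [setLIntegral_const, Real.volume_Ioo, mul_comm]
          congr 2
          ring
  set K : ℝ≥0∞ := ENNReal.ofReal (2 * ε) * hardyNorm f with hK
  have hK' : K ≠ ∞ := ENNReal.mul_ne_top ENNReal.ofReal_ne_top hf.2.ne
  refine ⟨K.toReal / (ε ^ 2 / 4), fun z hz => ?_⟩
  have h := ENNReal.toReal_mono hK' (key z hz)
  rw [ENNReal.toReal_mul, ENNReal.toReal_ofReal (by positivity), toReal_enorm] at h
  rw [le_div_iff₀ (by positivity)]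
  linarith

/-- The heights `1 / (n + 1)`. -/
lemma level_pos (n : ℕ) : 0 < 1 / ((n : ℝ) + 1) := by positivity

lemma ae_tendsto_level {f : ℍ → ℂ} (hb : HasBoundaryValues f) :
    ∀ᵐ x : ℝ, Tendsto (fun n : ℕ => f (pt x (1 / ((n : ℝ) + 1)) (level_pos n))) atTop
      (𝓝 (boundary f x)) := by
  filter_upwards [hb.tendsto] with x hx
  exact hx.comp (tendsto_pt x)

/-- Fatou's lemma along the heights 1/(n + 1). -/
lemma lintegral_boundary_le {f : ℍ → ℂ} (hf : f ∈ H1Plus) (hb : HasBoundaryValues f) :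
    ∫⁻ x, ‖boundary f x‖ₑ ≤ hardyNorm f := by
  have hm : ∀ n : ℕ, Measurable fun x : ℝ => ‖f (pt x (1 / ((n : ℝ) + 1)) (level_pos n))‖ₑ :=
    fun n => (hf.1.continuous.comp (continuous_pt _ (level_pos n))).enorm.measurable
  calc ∫⁻ x, ‖boundary f x‖ₑ
      = ∫⁻ x, liminf (fun n : ℕ => ‖f (pt x (1 / ((n : ℝ) + 1)) (level_pos n))‖ₑ) atTop := by
        refine lintegral_congr_ae ?_
        filter_upwards [ae_tendsto_level hb] with x hx
        exact hx.enorm.liminf_eq.symm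
    _ ≤ liminf (fun n : ℕ => ∫⁻ x, ‖f (pt x (1 / ((n : ℝ) + 1)) (level_pos n))‖ₑ) atTop :=
        lintegral_liminf_le hm
    _ ≤ hardyNorm f := by
        refine liminf_le_of_frequently_le'
          (Eventually.frequently (Eventually.of_forall fun n => ?_))
        exact lintegral_level_le f (level_pos n)

lemma integrable_boundary {f : ℍ → ℂ} (hf : f ∈ H1Plus) (hb : HasBoundaryValues f) :
    Integrable (boundary f) :=
  ⟨hb.aestronglyMeasurable hf.1.continuous, (lintegral_boundary_le hf hb).trans_lt hf.2⟩

/-- Truncation at height M for a = √|f|: the error is |f|/M, which an L¹ bound controls uniformly.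
This is the uniform integrability gained from the square root. -/
lemma le_min_add_sq_div {a M : ℝ} (ha : 0 ≤ a) (hM : 0 < M) : a ≤ min a M + a ^ 2 / M := by
  rcases le_total a M with h | h
  · rw [min_eq_left h]
    have : 0 ≤ a ^ 2 / M := by positivity
    linarith
  · rw [min_eq_right h]
    have : a ≤ a ^ 2 / M := by
      rw [le_div_iff₀ hM]; nlinarith
    linarith

/-- Jensen's inequality for the square and the Poisson kernel. -/
lemma sq_integral_poisson_le (x : ℝ) {y : ℝ} (hy : 0 < y) {b : ℝ → ℝ}
    (hb : Integrable fun t => poisson y (x - t) * b t)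
    (hb2 : Integrable fun t => poisson y (x - t) * b t ^ 2) :
    (∫ t, poisson y (x - t) * b t) ^ 2 ≤ ∫ t, poisson y (x - t) * b t ^ 2 := by
  set c := ∫ t, poisson y (x - t) * b t with hc
  have hP : Integrable fun t => poisson y (x - t) := (integrable_poisson hy).comp_sub_left x
  have hP1 : ∫ t, poisson y (x - t) = 1 := by
    rw [integral_sub_left_eq_self (poisson y) volume x, integral_poisson hy]
  -- The variance of b under the probability density P_y(x − t) is nonnegative.
  have h0 : 0 ≤ ∫ t, poisson y (x - t) * (b t - c) ^ 2 :=
    integral_nonneg fun t => mul_nonneg (poisson_nonneg hy _) (sq_nonneg _)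
  have e : (fun t => poisson y (x - t) * (b t - c) ^ 2) = fun t =>
      (poisson y (x - t) * b t ^ 2 - (2 * c) * (poisson y (x - t) * b t)) +
        c ^ 2 * poisson y (x - t) := by
    funext t; ring
  have hi : Integrable fun t =>
      poisson y (x - t) * b t ^ 2 - (2 * c) * (poisson y (x - t) * b t) := hb2.sub (hb.const_mul _)
  rw [e, integral_add hi (hP.const_mul _), integral_sub hb2 (hb.const_mul _), integral_const_mul, integral_const_mul, hP1, ← hc] at h0
  nlinarith

/-- Functions in `H¹(ℂ⁺)` are majorized by the Poisson integral of their boundary modulus. -/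
lemma norm_le_integral_poisson_boundary {f : ℍ → ℂ} (hf : f ∈ H1Plus) (hb : HasBoundaryValues f)
    (x y : ℝ) (hy : 0 < y) :
    ‖f (pt x y hy)‖ ≤ ∫ t, poisson y (x - t) * ‖boundary f t‖ := by
  set fn : ℕ → ℝ → ℂ := fun n t => f (pt t (1 / ((n : ℝ) + 1)) (level_pos n)) with hfn
  set u := boundary f with hu
  have hui : Integrable u := integrable_boundary hf hb
  have hdiff := differentiableOn_ext hf.1
  have hopen : IsOpen {z : ℂ | 0 < z.im} := isOpen_lt continuous_const continuous_im
  have hPc : Continuous fun t => poisson y (x - t) :=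
    (continuous_poisson hy).comp (continuous_const.sub continuous_id)
  have hP : Integrable fun t => poisson y (x - t) := (integrable_poisson hy).comp_sub_left x
  have hP0 : ∀ t, 0 ≤ poisson y (x - t) := fun t => poisson_nonneg hy _
  have hbdd : ∀ {v : ℝ → ℝ}, Integrable v → Integrable fun t => poisson y (x - t) * v t :=
    fun hv => hv.bdd_mul (c := (Real.pi * y)⁻¹) hPc.aestronglyMeasurable
      (Eventually.of_forall fun t => by
        rw [Real.norm_of_nonneg (hP0 t)]; exact poisson_le hy _)
  have hbdd' : ∀ {v : ℝ → ℝ} {C : ℝ}, AEStronglyMeasurable v → (∀ t, |v t| ≤ C) →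
      Integrable fun t => poisson y (x - t) * v t := fun hv hC =>
    (hP.bdd_mul hv (Eventually.of_forall hC)).congr
      (Eventually.of_forall fun t => mul_comm _ _)
  have hfc : ∀ n, Continuous (fn n) := fun n =>
    hf.1.continuous.comp (continuous_pt _ (level_pos n))
  have hfi : ∀ n, Integrable (fn n) := fun n => integrable_level hf (level_pos n)
  set K := (hardyNorm f).toReal
  have hK : ∀ n, ∫ t, ‖fn n t‖ ≤ K := fun n => by
    rw [integral_norm_eq_lintegral_enorm (hfi n).1]
    exact ENNReal.toReal_mono hf.2.ne (lintegral_level_le f (level_pos n))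
  set K' := (Real.pi * y)⁻¹ * K with hK'
  have hum : AEStronglyMeasurable (fun t => √‖u t‖) :=
    Real.continuous_sqrt.comp_aestronglyMeasurable hui.1.norm
  -- the truncated estimate
  have hM : ∀ M : ℝ, 0 < M →
      √‖f (pt x y hy)‖ ≤ (∫ t, poisson y (x - t) * min √‖u t‖ M) + K' / M := by
    intro M hMpos
    have hlim1 : Tendsto (fun n : ℕ => √‖ext f (x + y * I + (1 / ((n : ℝ) + 1) : ℝ) * I)‖) atTop
        (𝓝 √‖f (pt x y hy)‖) := by
      rw [← ext_apply f x hy]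
      refine (Real.continuous_sqrt.tendsto _).comp (Tendsto.norm ?_)
      have hca : ContinuousAt (ext f) (x + y * I) :=
        (hdiff.differentiableAt (hopen.mem_nhds (by simpa using hy))).continuousAt
      refine hca.tendsto.comp ?_
      have h1 := ((continuous_ofReal.tendsto 0).comp
        tendsto_one_div_add_atTop_nhds_zero_nat).mul_const I
      simpa using h1.const_add ((x : ℂ) + y * I)
    have hlim2 : Tendsto (fun n => (∫ t, poisson y (x - t) * min √‖fn n t‖ M) + K' / M) atTop
        (𝓝 ((∫ t, poisson y (x - t) * min √‖u t‖ M) + K' / M)) := by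
      refine Tendsto.add_const _ ?_
      refine tendsto_integral_of_dominated_convergence (fun t => poisson y (x - t) * M)
        (fun n => ?_) (hP.mul_const M) (fun n => Eventually.of_forall fun t => ?_) ?_
      · exact (hPc.mul ((hfc n).norm.sqrt.min continuous_const)).aestronglyMeasurable
      · rw [norm_mul, Real.norm_of_nonneg (hP0 t),
          Real.norm_of_nonneg (le_min (Real.sqrt_nonneg _) hMpos.le)]
        exact mul_le_mul_of_nonneg_left (min_le_right _ _) (hP0 t)
      · filter_upwards [ae_tendsto_level hb] with t ht
        refine Tendsto.const_mul _ (Tendsto.min ?_ tendsto_const_nhds)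
        exact (Real.continuous_sqrt.tendsto _).comp ht.norm
    refine le_of_tendsto_of_tendsto' hlim1 hlim2 fun n => ?_
    set ε := 1 / ((n : ℝ) + 1) with hε
    have hεpos : 0 < ε := level_pos n
    obtain ⟨B, hB⟩ := exists_bound_of_mem_H1Plus hf hεpos
    -- Raised by ε, f is holomorphic past the real line and bounded on the closed half-plane, so the
    -- majorization of |F|^{1/2} applies.
    have h1 := sqrt_norm_le_integral_poisson (F := fun z => ext f (z + ε * I)) (B := B) hεpos
      (hdiff.comp (differentiableOn_id.add_const _) fun z hz => by
        have h : -ε < z.im := hz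
        change 0 < (z + ε * I).im
        simp
        linarith) (fun z hz => hB _ (by simpa using hz)) x hy
    refine h1.trans ?_
    have hFt : ∀ t : ℝ, ext f (t + ε * I) = fn n t := fun t => ext_apply f t hεpos
    simp_rw [hFt]
    have hbound : ∀ t, |√‖fn n t‖| ≤ √B := fun t => by
      rw [abs_of_nonneg (Real.sqrt_nonneg _), ← hFt]
      exact Real.sqrt_le_sqrt (hB _ (by simp))
    have hsq : ∀ t, √‖fn n t‖ ^ 2 = ‖fn n t‖ := fun t => Real.sq_sqrt (norm_nonneg _)
    have hminint : Integrable fun t => poisson y (x - t) * min √‖fn n t‖ M :=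
      hbdd' (C := M) ((hfc n).norm.sqrt.min continuous_const).aestronglyMeasurable fun t => by
        rw [abs_of_nonneg (le_min (Real.sqrt_nonneg _) hMpos.le)]
        exact min_le_right _ _
    have hnint : Integrable fun t => poisson y (x - t) * ‖fn n t‖ := hbdd (hfi n).norm
    calc ∫ t, poisson y (x - t) * √‖fn n t‖
        ≤ ∫ t, (poisson y (x - t) * min √‖fn n t‖ M + poisson y (x - t) * ‖fn n t‖ / M) := by
          refine integral_mono (hbdd' (hfc n).norm.sqrt.aestronglyMeasurable hbound)
            (hminint.add (hnint.div_const M)) fun t => ?_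
          have h2 := le_min_add_sq_div (Real.sqrt_nonneg ‖fn n t‖) hMpos
          rw [hsq] at h2
          have := mul_le_mul_of_nonneg_left h2 (hP0 t)
          rw [mul_add, ← mul_div_assoc] at this
          exact this
      _ = (∫ t, poisson y (x - t) * min √‖fn n t‖ M) +
            (∫ t, poisson y (x - t) * ‖fn n t‖) / M := by
          rw [integral_add hminint (hnint.div_const M), integral_div]
      _ ≤ _ := by
          gcongr
          calc ∫ t, poisson y (x - t) * ‖fn n t‖ ≤ ∫ t, (Real.pi * y)⁻¹ * ‖fn n t‖ :=
                integral_mono hnint ((hfi n).norm.const_mul _) fun t =>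
                  mul_le_mul_of_nonneg_right (poisson_le hy _) (norm_nonneg _)
            _ ≤ K' := by
                rw [integral_const_mul, hK']
                have := Real.pi_pos
                exact mul_le_mul_of_nonneg_left (hK n) (by positivity)
  set S := ∫ t, poisson y (x - t) * ‖u t‖ with hS
  have hS0 : 0 ≤ S := integral_nonneg fun t => mul_nonneg (hP0 t) (norm_nonneg _)
  -- The square of the truncated root is at most |u|, so Jensen's inequality replaces the Poisson
  -- integral of the root by √S; letting M → ∞ then removes the error K'/M.
  have hMS : ∀ M : ℝ, 0 < M → √‖f (pt x y hy)‖ ≤ √S + K' / M := by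
    intro M hMpos
    refine (hM M hMpos).trans (add_le_add_left ?_ _)
    have hmeas : AEStronglyMeasurable (fun t => min √‖u t‖ M) :=
      (continuous_id.min continuous_const).comp_aestronglyMeasurable hum
    have habs : ∀ t, |min √‖u t‖ M| ≤ M := fun t => by
      rw [abs_of_nonneg (le_min (Real.sqrt_nonneg _) hMpos.le)]
      exact min_le_right _ _
    have hle : ∀ t, min √‖u t‖ M ^ 2 ≤ ‖u t‖ := fun t => by
      rw [← Real.sq_sqrt (norm_nonneg (u t))]
      have := le_min (Real.sqrt_nonneg ‖u t‖) hMpos.le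
      gcongr
      · rw [Real.sq_sqrt (norm_nonneg (u t))]
        exact min_le_left _ _
    have hi2 : Integrable fun t => poisson y (x - t) * min √‖u t‖ M ^ 2 :=
      hbdd' (C := M ^ 2) (hmeas.pow 2) fun t => by
        rw [abs_pow]
        exact pow_le_pow_left₀ (abs_nonneg _) (habs t) 2
    refine Real.le_sqrt_of_sq_le ((sq_integral_poisson_le x hy (hbdd' hmeas habs) hi2).trans ?_)
    exact integral_mono hi2 (hbdd hui.norm) fun t => mul_le_mul_of_nonneg_left (hle t) (hP0 t)
  have hfin : √‖f (pt x y hy)‖ ≤ √S := by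
    have hlim : Tendsto (fun M : ℝ => √S + K' / M) atTop (𝓝 (√S + 0)) :=
      (tendsto_const_nhds.div_atTop tendsto_id).const_add _
    rw [add_zero] at hlim
    refine ge_of_tendsto hlim ?_
    filter_upwards [eventually_gt_atTop 0] with M hMpos using hMS M hMpos
  exact (Real.sqrt_le_sqrt_iff hS0).1 hfin

/-- The pointwise Poisson majorant is integrated over the line. This is the no-gain-of-mass
hypothesis of `tendsto_integral_norm_sub`. -/
lemma lintegral_level_le_boundary {f : ℍ → ℂ} (hf : f ∈ H1Plus) (hb : HasBoundaryValues f)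
    {y : ℝ} (hy : 0 < y) : ∫⁻ x, ‖f (pt x y hy)‖ₑ ≤ ∫⁻ x, ‖boundary f x‖ₑ := by
  have hui := integrable_boundary hf hb
  rw [← lintegral_lintegral_poisson_mul hy hui.1.enorm]
  refine lintegral_mono fun x => ?_
  have hP0 : ∀ t, 0 ≤ poisson y (x - t) := fun t => poisson_nonneg hy _
  have hPc : Continuous fun t => poisson y (x - t) :=
    (continuous_poisson hy).comp (continuous_const.sub continuous_id)
  have hint : Integrable fun t => poisson y (x - t) * ‖boundary f t‖ :=
    hui.norm.bdd_mul (c := (Real.pi * y)⁻¹) hPc.aestronglyMeasurable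
      (Eventually.of_forall fun t => by
        rw [Real.norm_of_nonneg (hP0 t)]; exact poisson_le hy _)
  have h := ENNReal.ofReal_le_ofReal (norm_le_integral_poisson_boundary hf hb x y hy)
  rw [ofReal_norm, ofReal_integral_eq_lintegral_ofReal hint
    (Eventually.of_forall fun t => mul_nonneg (hP0 t) (norm_nonneg _))] at h
  refine h.trans (le_of_eq (lintegral_congr fun t => ?_))
  rw [ENNReal.ofReal_mul (hP0 t), ofReal_norm]

/-- Almost everywhere convergence without gain of mass is convergence in `L¹`. -/
lemma tendsto_integral_norm_sub {fn : ℕ → ℝ → ℂ} {u : ℝ → ℂ} (hfi : ∀ n, Integrable (fn n))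
    (hu : Integrable u) (hlim : ∀ᵐ x, Tendsto (fun n => fn n x) atTop (𝓝 (u x)))
    (hle : ∀ n, ∫ x, ‖fn n x‖ ≤ ∫ x, ‖u x‖) :
    Tendsto (fun n => ∫ x, ‖fn n x - u x‖) atTop (𝓝 0) := by
  have h1 : Tendsto (fun n => ∫ x, min ‖fn n x - u x‖ (2 * ‖u x‖)) atTop (𝓝 0) := by
    rw [← integral_zero ℝ ℝ]
    refine tendsto_integral_of_dominated_convergence (fun x => 2 * ‖u x‖) (fun n => ?_)
      (hu.norm.const_mul 2) (fun n => Eventually.of_forall fun x => ?_) ?_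
    · exact (((hfi n).sub hu).norm.inf (hu.norm.const_mul 2)).1
    · rw [Real.norm_of_nonneg (le_min (norm_nonneg _) (by positivity))]
      exact min_le_right _ _
    · filter_upwards [hlim] with x hx
      have h := (hx.sub_const (u x)).norm.min (tendsto_const_nhds (x := 2 * ‖u x‖))
      rw [sub_self, norm_zero, min_eq_left (by positivity)] at h
      exact h
  have h2 : Tendsto (fun n => ∫ x, max (‖u x‖ - ‖fn n x‖) 0) atTop (𝓝 0) := by
    have e0 : ∫ _ : ℝ, (0 : ℝ) = 0 := integral_zero ℝ ℝ
    nth_rewrite 2 [← e0]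
    refine tendsto_integral_of_dominated_convergence (fun x => ‖u x‖) (fun n => ?_)
      hu.norm (fun n => Eventually.of_forall fun x => ?_) ?_
    · exact ((hu.norm.sub (hfi n).norm).sup (integrable_zero _ _ _)).1
    · rw [Real.norm_of_nonneg (le_max_right _ _)]
      exact max_le (by linarith [norm_nonneg (fn n x)]) (norm_nonneg _)
    · filter_upwards [hlim] with x hx
      have h := ((hx.norm.const_sub ‖u x‖)).max (tendsto_const_nhds (x := (0 : ℝ)))
      rw [sub_self, max_self] at h
      exact h
  have h3 := h1.add h2
  rw [add_zero] at h3
  refine squeeze_zero (fun n => integral_nonneg fun x => norm_nonneg _) (fun n => ?_) h3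
  have i1 : Integrable fun x => min ‖fn n x - u x‖ (2 * ‖u x‖) :=
    ((hfi n).sub hu).norm.inf (hu.norm.const_mul 2)
  have i2 : Integrable fun x => max (‖u x‖ - ‖fn n x‖) 0 :=
    (hu.norm.sub (hfi n).norm).sup (integrable_zero _ _ _)
  have i3 : Integrable fun x => ‖fn n x‖ - ‖u x‖ := (hfi n).norm.sub hu.norm
  -- Pointwise, |f − u| ≤ min(|f − u|, 2|u|) + (|u| − |f|)⁺ + (|f| − |u|). The first two terms are
  -- dominated by multiples of |u| and tend to 0; the last has nonpositive integral by hypothesis.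
  calc ∫ x, ‖fn n x - u x‖
      ≤ ∫ x, ((min ‖fn n x - u x‖ (2 * ‖u x‖) + max (‖u x‖ - ‖fn n x‖) 0) +
          (‖fn n x‖ - ‖u x‖)) := by
        refine integral_mono ((hfi n).sub hu).norm ((i1.add i2).add i3) fun x => ?_
        have := norm_sub_le (fn n x) (u x)
        rcases le_total ‖fn n x - u x‖ (2 * ‖u x‖) with h | h
        · simp only [min_eq_left h]
          linarith [le_max_left (‖u x‖ - ‖fn n x‖) 0]
        · simp only [min_eq_right h]
          linarith [le_max_right (‖u x‖ - ‖fn n x‖) 0]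
    _ = (∫ x, min ‖fn n x - u x‖ (2 * ‖u x‖)) + (∫ x, max (‖u x‖ - ‖fn n x‖) 0) +
          ((∫ x, ‖fn n x‖) - ∫ x, ‖u x‖) := by
        have i12 : Integrable fun x =>
          min ‖fn n x - u x‖ (2 * ‖u x‖) + max (‖u x‖ - ‖fn n x‖) 0 := i1.add i2
        rw [integral_add i12 i3, integral_add i1 i2,
          integral_sub (hfi n).norm hu.norm]
    _ ≤ _ := by linarith [hle n]

/-- Two properties of the damping factor (1 − iδz)⁻²: it has the quadratic decay that contour
integration needs, and it is bounded by 1 independently of δ, so that δ → 0 is dominated. -/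
lemma one_add_le_normSq_one_sub {δ : ℝ} (hδ : 0 < δ) (hδ1 : δ ≤ 1) {z : ℂ} (hz : 0 < z.im) :
    δ ^ 2 * (1 + ‖z‖ ^ 2) ≤ ‖1 - I * δ * z‖ ^ 2 ∧ 1 ≤ ‖1 - I * δ * z‖ ^ 2 := by
  have h1 : ‖1 - I * δ * z‖ ^ 2 = (1 + δ * z.im) ^ 2 + (δ * z.re) ^ 2 := by
    rw [← Complex.normSq_eq_norm_sq, normSq_apply]
    simp
    ring
  have h2 : ‖z‖ ^ 2 = z.re ^ 2 + z.im ^ 2 := by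
    rw [← Complex.normSq_eq_norm_sq, normSq_apply]; ring
  have h3 : 0 < δ * z.im := mul_pos hδ hz
  rw [h1, h2]
  constructor
  · nlinarith
  · nlinarith [sq_nonneg (δ * z.re)]

/-- The spectrum of a horizontal restriction of `f ∈ H¹(ℂ⁺)` lies in `[0, ∞)`. -/
lemma fourier_level_eq_zero {f : ℍ → ℂ} (hf : f ∈ H1Plus) {y : ℝ} (hy : 0 < y) {ξ : ℝ}
    (hξ : ξ ≤ 0) : 𝓕 (fun x : ℝ => f (pt x y hy)) ξ = 0 := by
  have hdiff := differentiableOn_ext hf.1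
  have hy2 : 0 < y / 2 := by linarith
  obtain ⟨B, hB⟩ := exists_bound_of_mem_H1Plus hf hy2
  have hB0 : 0 ≤ B := (norm_nonneg _).trans (hB ((y / 2 : ℝ) * I) (by simp))
  have hexp : ∀ z : ℂ, 0 < z.im → ‖cexp (-(2 * Real.pi * ξ) * I * z)‖ ≤ 1 := by
    intro z hz
    rw [norm_exp, Real.exp_le_one_iff]
    have : (-(2 * Real.pi * ξ) * I * z).re = 2 * Real.pi * ξ * z.im := by simp
    rw [this]
    have := Real.pi_pos
    exact mul_nonpos_of_nonpos_of_nonneg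
      (mul_nonpos_of_nonneg_of_nonpos (by positivity) hξ) hz.le
  set d : ℕ → ℝ := fun n => 1 / ((n : ℝ) + 1) with hd
  have hd0 : ∀ n, 0 < d n := level_pos
  have hd1 : ∀ n, d n ≤ 1 := fun n => by
    simp only [hd]
    rw [div_le_one (by positivity)]
    linarith [n.cast_nonneg (α := ℝ)]
  have hne : ∀ n, ∀ z : ℂ, 0 < z.im → (1 - I * d n * z) ^ 2 ≠ 0 := by
    intro n z hz h
    have h1 := (one_add_le_normSq_one_sub (hd0 n) (hd1 n) hz).2
    rw [← norm_pow, h, norm_zero] at h1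
    linarith
  have hzero : ∀ n, ∫ x : ℝ, ext f (x + y * I) *
      cexp (-(2 * Real.pi * ξ) * I * (x + (y / 2 : ℝ) * I)) /
      (1 - I * d n * (x + (y / 2 : ℝ) * I)) ^ 2 = 0 := by
    intro n
    -- The height y is split in two halves: f(z + iy/2) is bounded on the half-plane, and the line
    -- Im z = y/2 then recovers f at height y. The exponential is bounded by 1 because ξ ≤ 0.
    have h := integral_horizontal_eq_zero (C := B / (d n) ^ 2)
      (W := fun z => ext f (z + (y / 2 : ℝ) * I) * cexp (-(2 * Real.pi * ξ) * I * z) /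
        (1 - I * d n * z) ^ 2) ?_ ?_ hy2
    · rw [← h]
      refine integral_congr_ae (Eventually.of_forall fun x => ?_)
      simp only
      congr 3
      push_cast
      ring
    · refine DifferentiableOn.div (DifferentiableOn.mul ?_ ?_) ?_ fun z hz => hne n z hz
      · refine hdiff.comp (differentiableOn_id.add_const _) fun z hz => ?_
        have h : 0 < z.im := hz
        change 0 < (z + (y / 2 : ℝ) * I).im
        simp
        linarith
      · fun_prop
      · fun_prop
    · intro z hz
      rw [norm_div, norm_mul, norm_pow]
      have h1 := (one_add_le_normSq_one_sub (hd0 n) (hd1 n) hz).1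
      have h2 : ‖ext f (z + (y / 2 : ℝ) * I)‖ ≤ B := hB _ (by simp; exact hz.le)
      have h3 := hexp z hz
      have h4 := hd0 n
      rw [div_div]
      refine div_le_div₀ hB0 ?_ (by positivity) h1
      calc _ ≤ B * 1 := mul_le_mul h2 h3 (norm_nonneg _) hB0
        _ = B := mul_one B
  have hlim : Tendsto (fun n => ∫ x : ℝ, ext f (x + y * I) *
      cexp (-(2 * Real.pi * ξ) * I * (x + (y / 2 : ℝ) * I)) /
      (1 - I * d n * (x + (y / 2 : ℝ) * I)) ^ 2) atTop
      (𝓝 (∫ x : ℝ, ext f (x + y * I) *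
        cexp (-(2 * Real.pi * ξ) * I * (x + (y / 2 : ℝ) * I)))) := by
    have him : ∀ x : ℝ, 0 < ((x : ℂ) + (y / 2 : ℝ) * I).im := fun x => by simp; exact hy
    have hcf : Continuous fun x : ℝ => ext f (x + y * I) :=
      hdiff.continuousOn.comp_continuous (by fun_prop) fun x => by simpa using hy
    refine tendsto_integral_of_dominated_convergence (fun x : ℝ => ‖ext f (x + y * I)‖)
      (fun n => ?_) ?_ (fun n => Eventually.of_forall fun x => ?_)
      (Eventually.of_forall fun x => ?_)
    · refine (Continuous.div (hcf.mul (by fun_prop)) (by fun_prop)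
        fun x => hne n _ (him x)).aestronglyMeasurable
    · simp_rw [ext_apply f _ hy]
      exact (integrable_level hf hy).norm
    · rw [norm_div, norm_mul, norm_pow]
      refine (div_le_self (by positivity)
        (one_add_le_normSq_one_sub (hd0 n) (hd1 n) (him x)).2).trans ?_
      exact mul_le_of_le_one_right (norm_nonneg _) (hexp _ (him x))
    · have h1 : Tendsto (fun n => (d n : ℂ)) atTop (𝓝 ((0 : ℝ) : ℂ)) :=
        (continuous_ofReal.tendsto 0).comp tendsto_one_div_add_atTop_nhds_zero_nat
      have h2 : Tendsto (fun n => (1 - I * d n * ((x : ℂ) + (y / 2 : ℝ) * I)) ^ 2) atTop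
          (𝓝 ((1 - I * ((0 : ℝ) : ℂ) * ((x : ℂ) + (y / 2 : ℝ) * I)) ^ 2)) :=
        (((h1.const_mul I).mul_const _).const_sub 1).pow 2
      simp only [ofReal_zero, mul_zero, zero_mul, sub_zero, one_pow] at h2
      have h3 := (tendsto_const_nhds (x := ext f (x + y * I) *
        cexp (-(2 * Real.pi * ξ) * I * (x + (y / 2 : ℝ) * I)))).div h2 one_ne_zero
      rw [div_one] at h3
      exact h3
  have h0 := tendsto_nhds_unique hlim (by simp_rw [hzero]; exact tendsto_const_nhds)
  -- On the line at height y/2 the exponential contributes the extra factor e^{πξy}, which is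
  -- nonzero.
  have e : (∫ x : ℝ, ext f (x + y * I) *
      cexp (-(2 * Real.pi * ξ) * I * (x + (y / 2 : ℝ) * I))) =
      cexp (Real.pi * ξ * y) * 𝓕 (fun x : ℝ => f (pt x y hy)) ξ := by
    rw [Real.fourier_real_eq_integral_exp_smul, ← integral_const_mul]
    refine integral_congr_ae (Eventually.of_forall fun x => ?_)
    simp only [smul_eq_mul]
    rw [ext_apply f x hy, ← mul_assoc, ← Complex.exp_add, mul_comm]
    congr 2
    push_cast
    linear_combination (-(Real.pi * ξ * y : ℂ)) * I_sq
  rw [e] at h0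
  exact (mul_eq_zero.1 h0).resolve_left (Complex.exp_ne_zero _)

/-- The boundary function of `f ∈ H¹(ℂ⁺)` has spectrum in `[0, ∞)`. -/
theorem fourier_boundary_eq_zero {f : ℍ → ℂ} (hf : f ∈ H1Plus) (hb : HasBoundaryValues f)
    {ξ : ℝ} (hξ : ξ ≤ 0) : 𝓕 (boundary f) ξ = 0 := by
  have hui := integrable_boundary hf hb
  have hfi : ∀ n : ℕ, Integrable fun x : ℝ => f (pt x (1 / ((n : ℝ) + 1)) (level_pos n)) :=
    fun n => integrable_level hf (level_pos n)
  have h := tendsto_integral_norm_sub hfi hui (ae_tendsto_level hb) fun n => by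
    rw [integral_norm_eq_lintegral_enorm (hfi n).1, integral_norm_eq_lintegral_enorm hui.1]
    exact ENNReal.toReal_mono hui.2.ne (lintegral_level_le_boundary hf hb (level_pos n))
  have hle : ∀ n : ℕ, ‖𝓕 (boundary f) ξ‖ ≤
      ∫ x, ‖f (pt x (1 / ((n : ℝ) + 1)) (level_pos n)) - boundary f x‖ := by
    intro n
    have h1 := norm_fourier_le
      ((fun x : ℝ => f (pt x (1 / ((n : ℝ) + 1)) (level_pos n))) - boundary f) ξ
    rw [fourier_sub_apply (hfi n) hui, fourier_level_eq_zero hf (level_pos n) hξ, zero_sub,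
      norm_neg] at h1
    exact h1
  exact norm_le_zero_iff.1 (ge_of_tendsto h (Eventually.of_forall hle))

/-! ### Density of Schwartz functions with spectrum in `[0, ∞)` -/

/-- A smooth bump function on the line with prescribed support, as a Schwartz function. -/
lemma exists_schwartz_bump (c r : ℝ) (hr : 0 < r) : ∃ B : 𝓢(ℝ, ℂ),
    HasCompactSupport B ∧ B c = 1 ∧ (∀ x, r ≤ |x - c| → B x = 0) ∧ ∫ x, B x ≠ 0 := by
  let b : ContDiffBump c := ⟨r / 2, r, by linarith, by linarith⟩
  have h1 : HasCompactSupport (Complex.ofRealCLM ∘ b) := b.hasCompactSupport.comp_left rfl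
  have h2 : ContDiff ℝ ((⊤ : ℕ∞) : WithTop ℕ∞) (Complex.ofRealCLM ∘ b) :=
    Complex.ofRealCLM.contDiff.comp b.contDiff
  refine ⟨h1.toSchwartzMap h2, h1, ?_, fun x hx => ?_, ?_⟩
  · change ((b c : ℝ) : ℂ) = 1
    rw [b.one_of_mem_closedBall (Metric.mem_closedBall_self (by simp [b]; linarith)), ofReal_one]
  · change ((b x : ℝ) : ℂ) = 0
    rw [b.zero_of_le_dist (by rwa [Real.dist_eq]), ofReal_zero]
  · change ∫ x, ((b x : ℝ) : ℂ) ≠ 0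
    rw [integral_complex_ofReal]
    exact ofReal_ne_zero.2 b.integral_pos.ne'

/-- Schwartz functions with spectrum in `(0, ∞)` and value `1` at the origin exist. -/
lemma exists_schwartz_spectrum_pos : ∃ η B : 𝓢(ℝ, ℂ), η 0 = 1 ∧ (∀ s, s ≤ 0 → B s = 0) ∧
    ∀ x, η x = ∫ s, B s * cexp (2 * Real.pi * x * s * I) := by
  obtain ⟨B, -, -, hB, hB0⟩ := exists_schwartz_bump 1 1 one_pos
  have hη : ∀ x, 𝓕⁻ B x = ∫ s, B s * cexp (2 * Real.pi * x * s * I) := fun x => by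
    rw [SchwartzMap.fourierInv_coe, fourierInv_real_eq_fourier_neg,
      Real.fourier_real_eq_integral_exp_smul]
    refine integral_congr_ae (Eventually.of_forall fun s => ?_)
    simp only [smul_eq_mul]
    rw [mul_comm]
    congr 2
    push_cast
    ring
  -- The bump is centred at 1 with radius 1, so it vanishes on (−∞, 0]; dividing by ∫ B normalizes
  -- η(0) to 1.
  refine ⟨(∫ x, B x)⁻¹ • 𝓕⁻ B, (∫ x, B x)⁻¹ • B, ?_, fun s hs => ?_, fun x => ?_⟩
  · rw [smul_apply, hη]
    simp [hB0]
  · rw [smul_apply, hB s (by rw [abs_of_nonpos (by linarith)]; linarith), smul_zero]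
  · rw [smul_apply, hη, smul_eq_mul, ← integral_const_mul]
    refine integral_congr_ae (Eventually.of_forall fun s => ?_)
    simp [mul_assoc]

lemma norm_cexp_ofReal_mul_I (a : ℝ) : ‖cexp (a * I)‖ = 1 := norm_exp_ofReal_mul_I a

/-- Multiplication by `η(δ x)`, with `η̂` supported in `(0, ∞)`, preserves spectra in `[0, ∞)`. -/
lemma fourier_mul_dilate_eq_zero {f : ℝ → ℂ} (hf : Integrable f) (h : ∀ ξ, ξ < 0 → 𝓕 f ξ = 0)
    {η B : 𝓢(ℝ, ℂ)} (hB : ∀ s, s ≤ 0 → B s = 0)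
    (hη : ∀ x, η x = ∫ s, B s * cexp (2 * Real.pi * x * s * I)) {δ : ℝ} (hδ : 0 < δ)
    {ξ : ℝ} (hξ : ξ < 0) : 𝓕 (fun x => η (δ * x) * f x) ξ = 0 := by
  rw [Real.fourier_real_eq_integral_exp_smul]
  have hint : Integrable (Function.uncurry fun (x s : ℝ) =>
      cexp ((-2 * Real.pi * x * ξ + 2 * Real.pi * (δ * x) * s : ℝ) * I) * (f x * B s))
      (volume.prod volume) := by
    have h1 := hf.mul_prod (B.integrable (μ := volume))
    refine h1.bdd_mul (c := 1) (Continuous.aestronglyMeasurable ?_)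
      (Eventually.of_forall fun p => ?_)
    · fun_prop
    · exact (norm_cexp_ofReal_mul_I _).le
  have e1 : ∫ x : ℝ, cexp (((-2 * Real.pi * x * ξ : ℝ) : ℂ) * I) • (η (δ * x) * f x) =
      ∫ x : ℝ, ∫ s : ℝ,
        cexp ((-2 * Real.pi * x * ξ + 2 * Real.pi * (δ * x) * s : ℝ) * I) * (f x * B s) := by
    refine integral_congr_ae (Eventually.of_forall fun x => ?_)
    simp only [smul_eq_mul]
    rw [hη, ← integral_mul_const, ← integral_const_mul]
    refine integral_congr_ae (Eventually.of_forall fun s => ?_)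
    simp only
    rw [ofReal_add, add_mul, Complex.exp_add]
    push_cast
    ring
  rw [e1, integral_integral_swap hint]
  -- The frequency δs of the factor shifts ξ to ξ − δs, still negative when s > 0; for s ≤ 0 the
  -- weight B(s) vanishes.
  have e2 : ∀ s : ℝ, ∫ x : ℝ,
      cexp ((-2 * Real.pi * x * ξ + 2 * Real.pi * (δ * x) * s : ℝ) * I) * (f x * B s) = 0 := by
    intro s
    rcases le_or_gt s 0 with hs | hs
    · simp [hB s hs]
    · have h2 := h (ξ - δ * s) (by nlinarith)
      rw [Real.fourier_real_eq_integral_exp_smul] at h2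
      rw [← mul_zero (B s), ← h2, ← integral_const_mul]
      refine integral_congr_ae (Eventually.of_forall fun x => ?_)
      simp only [smul_eq_mul]
      rw [show -2 * Real.pi * x * ξ + 2 * Real.pi * (δ * x) * s =
        -2 * Real.pi * x * (ξ - δ * s) by ring]
      ring
  rw [integral_congr_ae (Eventually.of_forall e2), integral_zero]

lemma exists_bound_schwartz (η : 𝓢(ℝ, ℂ)) (k : ℕ) : ∃ C : ℝ, ∀ x, ‖x‖ ^ k * ‖η x‖ ≤ C := by
  obtain ⟨C, -, hC⟩ := η.decay k 0
  exact ⟨C, fun x => by simpa using hC x⟩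

/-- The decay of η makes all moments of η(δ·)f integrable. Smoothness is what lets a cutoff of this
transform be a Schwartz function. -/
lemma contDiff_fourier_mul_dilate {f : ℝ → ℂ} (hf : Integrable f) (η : 𝓢(ℝ, ℂ)) {δ : ℝ}
    (hδ : 0 < δ) : ContDiff ℝ ((⊤ : ℕ∞) : WithTop ℕ∞) (𝓕 fun x => η (δ * x) * f x) := by
  refine Real.contDiff_fourier fun n _ => ?_
  obtain ⟨C, hC⟩ := exists_bound_schwartz η n
  have hc : Continuous fun x : ℝ => ‖x‖ ^ n * ‖η (δ * x)‖ := by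
    have := η.continuous
    fun_prop
  refine (hf.norm.bdd_mul (c := (δ ^ n)⁻¹ * C) hc.aestronglyMeasurable
    (Eventually.of_forall fun x => ?_)).congr (Eventually.of_forall fun x => ?_)
  · rw [Real.norm_of_nonneg (by positivity)]
    have h1 := hC (δ * x)
    rw [norm_mul, Real.norm_of_nonneg hδ.le, mul_pow] at h1
    rw [inv_mul_eq_div, le_div_iff₀ (by positivity)]
    linarith
  · simp only [norm_mul]
    ring

lemma integrable_mul_dilate {f : ℝ → ℂ} (hf : Integrable f) (η : 𝓢(ℝ, ℂ)) (δ : ℝ) :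
    Integrable fun x => η (δ * x) * f x := by
  obtain ⟨C, hC⟩ := exists_bound_schwartz η 0
  refine hf.bdd_mul (c := C) ?_ (Eventually.of_forall fun x => by simpa using hC (δ * x))
  exact (η.continuous.comp (continuous_const.mul continuous_id)).aestronglyMeasurable

lemma tendsto_integral_mul_dilate {f : ℝ → ℂ} (hf : Integrable f) {η : 𝓢(ℝ, ℂ)} (hη : η 0 = 1) :
    Tendsto (fun n : ℕ => ∫ x, ‖f x - η (1 / ((n : ℝ) + 1) * x) * f x‖) atTop (𝓝 0) := by
  obtain ⟨C, hC⟩ := exists_bound_schwartz η 0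
  rw [← integral_zero ℝ ℝ]
  refine tendsto_integral_of_dominated_convergence (fun x => (1 + C) * ‖f x‖)
    (fun n => (hf.sub (integrable_mul_dilate hf η _)).norm.1) (hf.norm.const_mul _)
    (fun n => Eventually.of_forall fun x => ?_) (Eventually.of_forall fun x => ?_)
  · rw [norm_norm]
    have h1 : ‖η (1 / ((n : ℝ) + 1) * x)‖ ≤ C := by simpa using hC (1 / ((n : ℝ) + 1) * x)
    calc _ ≤ ‖f x‖ + ‖η (1 / ((n : ℝ) + 1) * x) * f x‖ := norm_sub_le _ _
      _ ≤ ‖f x‖ + C * ‖f x‖ := by rw [norm_mul]; gcongr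
      _ = _ := by ring
  · have h1 : Tendsto (fun n : ℕ => η (1 / ((n : ℝ) + 1) * x)) atTop (𝓝 (η (0 * x))) :=
      (η.continuous.tendsto _).comp (tendsto_one_div_add_atTop_nhds_zero_nat.mul_const x)
    rw [zero_mul, hη] at h1
    have h2 := ((h1.mul_const (f x)).const_sub (f x)).norm
    rw [one_mul, sub_self, norm_zero] at h2
    exact h2

/-- Translation is continuous in `L¹`. -/
lemma continuous_lintegral_translate {g : ℝ → ℂ} (hg : Integrable g) :
    Continuous fun h : ℝ => ∫⁻ x, ‖g (x - h) - g x‖ₑ := by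
  have hm := memLp_one_iff_integrable.2 hg
  have : Fact ((1 : ℝ≥0∞) ≠ ∞) := ⟨ENNReal.one_ne_top⟩
  have hc : Continuous fun h : ℝ => ‖(DomAddAct.mk (-h) +ᵥ hm.toLp g : L1) - hm.toLp g‖ₑ := by
    have h1 : Continuous fun h : ℝ => (DomAddAct.mk (-h) : ℝᵈᵃᵃ) :=
      DomAddAct.mkHomeomorph.continuous.comp continuous_neg
    have h2 : Continuous fun h : ℝ => (DomAddAct.mk (-h) +ᵥ hm.toLp g : L1) :=
      h1.vadd continuous_const
    exact (h2.sub continuous_const).enorm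
  refine hc.congr fun h => ?_
  rw [DomAddAct.mk_vadd_toLp, ← MemLp.toLp_sub, Lp.enorm_toLp, eLpNorm_one_eq_lintegral_enorm]
  refine lintegral_congr fun x => ?_
  simp only [Pi.sub_apply, vadd_eq_add]
  rw [neg_add_eq_sub]

/-- `L¹` convergence of approximate identities. -/
lemma tendsto_lintegral_mollify {g : ℝ → ℂ} (hg : Integrable g) (ψ : 𝓢(ℝ, ℂ))
    (hψ : ∫ s, ψ s = 1) :
    Tendsto (fun n : ℕ => ∫⁻ x, ‖(∫ s, ψ s * g (x - 1 / ((n : ℝ) + 1) * s)) - g x‖ₑ)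
      atTop (𝓝 0) := by
  set ω : ℝ → ℝ≥0∞ := fun h => ∫⁻ x, ‖g (x - h) - g x‖ₑ with hω
  have hωc : Continuous ω := continuous_lintegral_translate hg
  have hω0 : ω 0 = 0 := by simp [hω]
  obtain ⟨C, hC⟩ := exists_bound_schwartz ψ 0
  have hC' : ∀ s, ‖ψ s‖ ≤ C := fun s => by simpa using hC s
  have hωb : ∀ h, ω h ≤ 2 * ∫⁻ x, ‖g x‖ₑ := fun h => by
    calc ω h ≤ ∫⁻ x, (‖g (x - h)‖ₑ + ‖g x‖ₑ) := lintegral_mono fun x => enorm_sub_le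
      _ = (∫⁻ x, ‖g (x - h)‖ₑ) + ∫⁻ x, ‖g x‖ₑ := lintegral_add_right' _ hg.1.enorm
      _ = _ := by rw [lintegral_sub_right_eq_self (fun x => ‖g x‖ₑ) h, two_mul]
  -- Since ∫ ψ = 1, the error is an average of translation differences; Tonelli bounds it by the
  -- average of the L¹ modulus of continuity ω against |ψ|.
  have hbound : ∀ n : ℕ, ∫⁻ x, ‖(∫ s, ψ s * g (x - 1 / ((n : ℝ) + 1) * s)) - g x‖ₑ ≤
      ∫⁻ s, ‖ψ s‖ₑ * ω (1 / ((n : ℝ) + 1) * s) := by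
    intro n
    set δ := 1 / ((n : ℝ) + 1) with hδ
    have hδ0 : 0 < δ := level_pos n
    have hdil : ∀ x, Integrable fun s => g (x - δ * s) := fun x =>
      (hg.comp_sub_left x).comp_mul_left' hδ0.ne'
    have hpt : ∀ x, ‖(∫ s, ψ s * g (x - δ * s)) - g x‖ₑ ≤
        ∫⁻ s, ‖ψ s‖ₑ * ‖g (x - δ * s) - g x‖ₑ := by
      intro x
      have h1 : g x = ∫ s, ψ s * g x := by rw [integral_mul_const, hψ, one_mul]
      have h2 : Integrable fun s => ψ s * g (x - δ * s) :=
        (hdil x).bdd_mul ψ.continuous.aestronglyMeasurable (Eventually.of_forall hC')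
      have h3 : (∫ s, ψ s * g (x - δ * s)) - g x = ∫ s, ψ s * (g (x - δ * s) - g x) := by
        rw [h1, ← integral_sub h2 (ψ.integrable.mul_const _), ← h1]
        simp_rw [mul_sub]
      rw [h3]
      refine (enorm_integral_le_lintegral_enorm _).trans (le_of_eq ?_)
      simp_rw [enorm_mul]
    refine (lintegral_mono hpt).trans (le_of_eq ?_)
    have hqmp : Measure.QuasiMeasurePreserving (fun p : ℝ × ℝ => p.1 - δ * p.2)
        (volume.prod volume) volume := by
      have h1 : Measure.QuasiMeasurePreserving (fun p : ℝ × ℝ => p.1 - p.2)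
          (volume.prod volume) volume := quasiMeasurePreserving_sub _ _
      have h2 : Measure.QuasiMeasurePreserving (Prod.map id (δ * ·))
          ((volume : Measure ℝ).prod (volume : Measure ℝ)) (volume.prod volume) := by
        refine QuasiMeasurePreserving.prodMap (Measure.QuasiMeasurePreserving.id _) ?_
        refine ⟨measurable_const_mul δ, ?_⟩
        rw [Real.map_volume_mul_left hδ0.ne']
        exact Measure.smul_absolutelyContinuous
      exact h1.comp h2
    have hmeas : AEMeasurable (Function.uncurry fun x s => ‖ψ s‖ₑ * ‖g (x - δ * s) - g x‖ₑ)
        (volume.prod volume) := by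
      refine AEMeasurable.mul ?_ (AEMeasurable.enorm (AEMeasurable.sub ?_ ?_))
      · exact (ψ.continuous.comp continuous_snd).enorm.measurable.aemeasurable
      · exact hg.1.aemeasurable.comp_quasiMeasurePreserving hqmp
      · exact hg.1.aemeasurable.comp_quasiMeasurePreserving Measure.quasiMeasurePreserving_fst
    rw [lintegral_lintegral_swap hmeas]
    refine lintegral_congr fun s => ?_
    rw [lintegral_const_mul' _ _ enorm_ne_top]
  refine tendsto_of_tendsto_of_tendsto_of_le_of_le tendsto_const_nhds ?_ (fun n => zero_le) hbound
  have hz : ∫⁻ s : ℝ, ‖ψ s‖ₑ * ω (0 * s) = 0 := by simp [hω0]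
  rw [← hz]
  refine tendsto_lintegral_of_dominated_convergence
    (fun s => ‖ψ s‖ₑ * (2 * ∫⁻ x, ‖g x‖ₑ)) (fun n => ?_) (fun n => Eventually.of_forall fun s => ?_)
    ?_ (Eventually.of_forall fun s => ?_)
  · exact ψ.continuous.enorm.measurable.mul
      (hωc.comp (continuous_const.mul continuous_id)).measurable
  · exact mul_le_mul_right (hωb _) _
  · rw [lintegral_mul_const _ ψ.continuous.enorm.measurable]
    exact ENNReal.mul_ne_top ψ.integrable.2.ne (ENNReal.mul_ne_top (by norm_num) hg.2.ne)
  · refine ENNReal.Tendsto.const_mul ?_ (Or.inr enorm_ne_top)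
    exact (hωc.tendsto _).comp (tendsto_one_div_add_atTop_nhds_zero_nat.mul_const s)

/-- Truncating a smooth Fourier transform approximates in `L¹`. -/
lemma exists_schwartz_near_of_contDiff {g : ℝ → ℂ} (hg : Integrable g)
    (hs : ContDiff ℝ ((⊤ : ℕ∞) : WithTop ℕ∞) (𝓕 g)) (h : ∀ ξ, ξ < 0 → 𝓕 g ξ = 0)
    {ε : ℝ≥0∞} (hε : 0 < ε) :
    ∃ φ : 𝓢(ℝ, ℂ), (∀ ξ, ξ < 0 → 𝓕 (φ : ℝ → ℂ) ξ = 0) ∧ ∫⁻ x, ‖φ x - g x‖ₑ < ε := by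
  -- Multiplying ĝ by χ(δξ) is convolving g with the dilate δ⁻¹ψ(·/δ) of ψ = 𝓕⁻χ, and χ(0) = 1 says
  -- ∫ ψ = 1. The cutoff preserves vanishing on ξ < 0.
  obtain ⟨χ, hχc, hχ1, -, -⟩ := exists_schwartz_bump 0 1 one_pos
  set ψ : 𝓢(ℝ, ℂ) := 𝓕⁻ χ with hψ
  have hFψ : 𝓕 (ψ : ℝ → ℂ) = χ := by
    rw [← SchwartzMap.fourier_coe, hψ, FourierTransform.fourier_fourierInv_eq]
  have hψ1 : ∫ s, ψ s = 1 := by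
    have h1 := congrFun hFψ 0
    rw [Real.fourier_real_eq_integral_exp_smul, hχ1] at h1
    simpa using h1
  obtain ⟨n, hn⟩ := ((tendsto_lintegral_mollify hg ψ hψ1).eventually_lt_const hε).exists
  set δ := 1 / ((n : ℝ) + 1) with hδ
  have hδ0 : 0 < δ := level_pos n
  have h1 : HasCompactSupport fun ξ => χ (δ * ξ) * 𝓕 g ξ :=
    HasCompactSupport.mul_right (hχc.comp_homeomorph (Homeomorph.mulLeft₀ δ hδ0.ne'))
  have h2 : ContDiff ℝ ((⊤ : ℕ∞) : WithTop ℕ∞) fun ξ => χ (δ * ξ) * 𝓕 g ξ :=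
    ((χ.smooth ⊤).comp (contDiff_const.mul contDiff_id)).mul hs
  set Φ : 𝓢(ℝ, ℂ) := h1.toSchwartzMap h2 with hΦ
  have hΦa : ∀ ξ, Φ ξ = χ (δ * ξ) * 𝓕 g ξ := fun ξ => rfl
  refine ⟨𝓕⁻ Φ, fun ξ hξ => ?_, ?_⟩
  · rw [← SchwartzMap.fourier_coe, FourierTransform.fourier_fourierInv_eq, hΦa, h ξ hξ, mul_zero]
  · refine lt_of_le_of_lt (le_of_eq (lintegral_congr fun x => ?_)) hn
    congr 2
    -- the inverse Fourier transform of the truncation is a convolution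
    set v : ℝ → ℂ := fun ξ => cexp ((2 * Real.pi * x * ξ : ℝ) * I) * χ (δ * ξ) with hv
    have hvi : Integrable v := by
      have hd : Integrable fun ξ => χ (δ * ξ) := χ.integrable.comp_mul_left' hδ0.ne'
      refine hd.bdd_mul (c := 1) (Continuous.aestronglyMeasurable (by fun_prop))
        (Eventually.of_forall fun ξ => (norm_cexp_ofReal_mul_I _).le)
    have e1 : (𝓕⁻ Φ : 𝓢(ℝ, ℂ)) x = ∫ ξ, 𝓕 g ξ * v ξ := by
      rw [SchwartzMap.fourierInv_coe, fourierInv_real_eq_fourier_neg,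
        Real.fourier_real_eq_integral_exp_smul]
      refine integral_congr_ae (Eventually.of_forall fun ξ => ?_)
      simp only [smul_eq_mul, hΦa, hv]
      rw [show -2 * Real.pi * ξ * -x = 2 * Real.pi * x * ξ by ring]
      ring
    have e2 : ∀ t, 𝓕 v t = (δ⁻¹ : ℝ) * ψ (δ⁻¹ * (x - t)) := by
      intro t
      rw [Real.fourier_real_eq_integral_exp_smul, hψ, SchwartzMap.fourierInv_coe,
        fourierInv_real_eq_fourier_neg, Real.fourier_real_eq_integral_exp_smul]
      have h3 := Measure.integral_comp_mul_left (fun ξ : ℝ =>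
        cexp ((-2 * Real.pi * ξ * -(δ⁻¹ * (x - t)) : ℝ) * I) • χ ξ) δ
      rw [abs_of_pos (inv_pos.2 hδ0)] at h3
      rw [← Complex.real_smul, ← h3]
      refine integral_congr_ae (Eventually.of_forall fun ξ => ?_)
      simp only [hv, smul_eq_mul]
      rw [← mul_assoc, ← Complex.exp_add, ← add_mul, ← ofReal_add]
      congr 4
      field_simp
      ring
    rw [e1, integral_fourier_mul hg hvi]
    simp_rw [e2]
    have h4 := Measure.integral_comp_mul_left (fun s : ℝ => g (x - s) * ψ (δ⁻¹ * s)) δ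
    rw [abs_of_pos (inv_pos.2 hδ0)] at h4
    have h5 := integral_sub_left_eq_self
      (fun s : ℝ => g (x - s) * ((δ⁻¹ : ℝ) * ψ (δ⁻¹ * s))) volume x
    simp only [sub_sub_cancel] at h5
    rw [h5]
    have e3 : ∫ s : ℝ, g (x - s) * ((δ⁻¹ : ℝ) * ψ (δ⁻¹ * s)) =
        δ⁻¹ • ∫ s : ℝ, g (x - s) * ψ (δ⁻¹ * s) := by
      rw [Complex.real_smul, ← integral_const_mul]
      refine integral_congr_ae (Eventually.of_forall fun s => ?_)
      simp only
      ring
    rw [e3, ← h4]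
    refine integral_congr_ae (Eventually.of_forall fun s => ?_)
    simp only
    rw [inv_mul_cancel_left₀ hδ0.ne', mul_comm]

/-- Schwartz functions with spectrum in `[0, ∞)` are dense in the `L¹` functions with spectrum in
`[0, ∞)`. -/
theorem exists_schwartz_near {f : ℝ → ℂ} (hf : Integrable f) (h : ∀ ξ, ξ < 0 → 𝓕 f ξ = 0)
    {ε : ℝ} (hε : 0 < ε) :
    ∃ φ : 𝓢(ℝ, ℂ), (∀ ξ, ξ < 0 → 𝓕 (φ : ℝ → ℂ) ξ = 0) ∧ ∫ x, ‖f x - φ x‖ < ε := by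
  -- Multiplication by η(δx) smooths the transform without creating negative spectrum; truncation in
  -- frequency then gives a Schwartz function. Each costs ε/2.
  obtain ⟨η, B, hη0, hB, hη⟩ := exists_schwartz_spectrum_pos
  obtain ⟨n, hn⟩ := ((tendsto_integral_mul_dilate hf hη0).eventually_lt_const
    (by linarith : 0 < ε / 2)).exists
  set δ := 1 / ((n : ℝ) + 1) with hδ
  have hδ0 : 0 < δ := level_pos n
  set g : ℝ → ℂ := fun x => η (δ * x) * f x with hg
  have hgi : Integrable g := integrable_mul_dilate hf η δ
  obtain ⟨φ, hφ, hφg⟩ := exists_schwartz_near_of_contDiff hgi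
    (contDiff_fourier_mul_dilate hf η hδ0)
    (fun ξ hξ => fourier_mul_dilate_eq_zero hf h hB hη hδ0 hξ)
    (ENNReal.ofReal_pos.2 (by linarith : 0 < ε / 2))
  refine ⟨φ, hφ, ?_⟩
  have h1 : ∫ x, ‖g x - φ x‖ < ε / 2 := by
    have hi : Integrable fun x => g x - φ x := hgi.sub φ.integrable
    rw [integral_norm_eq_lintegral_enorm hi.1]
    refine (ENNReal.lt_ofReal_iff_toReal_lt hi.2.ne).1 ?_
    simpa only [enorm_sub_rev] using hφg
  calc ∫ x, ‖f x - φ x‖ ≤ ∫ x, (‖f x - g x‖ + ‖g x - φ x‖) := by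
        refine integral_mono (hf.sub φ.integrable).norm
          ((hf.sub hgi).norm.add (hgi.sub φ.integrable).norm) fun x => ?_
        exact norm_sub_le_norm_sub_add_norm_sub _ _ _
    _ = (∫ x, ‖f x - g x‖) + ∫ x, ‖g x - φ x‖ :=
        integral_add (hf.sub hgi).norm (hgi.sub φ.integrable).norm
    _ < ε := by linarith

/-! ### Cauchy integrals of functions in `L¹ ∩ L²` with finite Hardy norm -/

lemma tendsto_eLpNorm_two_of_dominated {F : ℕ → ℝ → ℂ} {bound : ℝ → ℂ}
    (hF : ∀ n, AEStronglyMeasurable (F n)) (hb : MemLp bound 2)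
    (hle : ∀ n, ∀ᵐ x, ‖F n x‖ ≤ ‖bound x‖) (hlim : ∀ᵐ x, Tendsto (fun n => F n x) atTop (𝓝 0)) :
    Tendsto (fun n => eLpNorm (F n) 2 volume) atTop (𝓝 0) := by
  have h : Tendsto (fun n => ∫⁻ x, ‖F n x‖ₑ ^ (2 : ℝ)) atTop (𝓝 (∫⁻ _ : ℝ, 0)) := by
    refine tendsto_lintegral_of_dominated_convergence' (fun x => ‖bound x‖ₑ ^ (2 : ℝ))
      (fun n => (hF n).enorm.pow_const _) (fun n => ?_) ?_ ?_
    · filter_upwards [hle n] with x hx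
      gcongr
      exact enorm_le_iff_norm_le.2 hx
    · have := lintegral_rpow_enorm_lt_top_of_eLpNorm_lt_top two_ne_zero ENNReal.ofNat_ne_top hb.2
      simpa using this.ne
    · filter_upwards [hlim] with x hx
      have h1 := (ENNReal.continuous_rpow_const (y := 2)).tendsto _ |>.comp hx.enorm
      simpa [Function.comp_def] using h1
  rw [lintegral_zero] at h
  have h2 := (ENNReal.continuous_rpow_const (y := 1 / 2)).tendsto _ |>.comp h
  simp only [one_div, inv_pos, Nat.ofNat_pos, ENNReal.zero_rpow_of_pos] at h2
  refine h2.congr fun n => ?_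
  rw [eLpNorm_eq_lintegral_rpow_enorm_toReal two_ne_zero ENNReal.ofNat_ne_top]
  simp

/-- If `v ∈ L¹ ∩ L²` and `P₊ v` has finite Hardy norm, then `P₊ v` is given by a function in `L¹`
on the boundary. -/
lemma exists_integrable_projection {v : ℝ → ℂ} (hv : Integrable v) (hv2 : MemLp v 2)
    (hH : hardyNorm (cauchySzego v) < ∞) :
    ∃ g : ℝ → ℂ, Integrable g ∧ ∫⁻ x, ‖g x‖ₑ ≤ hardyNorm (cauchySzego v) ∧
      ∀ᵐ ξ, 𝓕 g ξ = (Set.Ioi (0 : ℝ)).indicator (𝓕 v) ξ := by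
  set m : ℝ → ℂ := (Set.Ioi (0 : ℝ)).indicator (𝓕 v) with hm
  have hFv2 : MemLp (𝓕 v) 2 := (memLp_congr_ae (fourier_toLp_ae_eq hv hv2)).1 (Lp.memLp _)
  have hm2 : MemLp m 2 := hFv2.indicator measurableSet_Ioi
  have hFvc := continuous_fourier hv
  -- The factor e^{−2πyξ} at y = 1/(n + 1): on ξ > 0 it turns v̂ into the transform of the
  -- restriction of P₊v to that height.
  set e : ℕ → ℝ → ℂ := fun n ξ =>
    (Real.exp (-(2 * Real.pi * (1 / ((n : ℝ) + 1))) * ξ) : ℂ) with he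
  have hec : ∀ n, Continuous (e n) := fun n => by simp only [he]; fun_prop
  have hen : ∀ n, ∀ ξ ∈ Set.Ioi (0 : ℝ), ‖e n ξ‖ ≤ 1 := fun n ξ hξ => by
    simp only [he, norm_real, Real.norm_of_nonneg (Real.exp_pos _).le]
    refine Real.exp_le_one_iff.2 ?_
    have h1 := level_pos n
    have h2 : 0 < ξ := hξ
    have h3 := Real.pi_pos
    have : 0 ≤ 2 * Real.pi * (1 / ((n : ℝ) + 1)) * ξ := by positivity
    linarith
  set mn : ℕ → ℝ → ℂ := fun n => (Set.Ioi (0 : ℝ)).indicator fun ξ => 𝓕 v ξ * e n ξ with hmn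
  have hmnm : ∀ n, AEStronglyMeasurable (mn n) := fun n =>
    (hFvc.mul (hec n)).aestronglyMeasurable.indicator measurableSet_Ioi
  have hmn2 : ∀ n, MemLp (mn n) 2 := fun n => by
    refine hFv2.mono (hmnm n) (Eventually.of_forall fun ξ => ?_)
    by_cases hξ : ξ ∈ Set.Ioi (0 : ℝ)
    · simp only [hmn, Set.indicator_of_mem hξ, norm_mul]
      exact mul_le_of_le_one_right (norm_nonneg _) (hen n ξ hξ)
    · simp [hmn, Set.indicator_of_notMem hξ]
  have hmn1 : ∀ n, Integrable (mn n) := fun n => by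
    refine IntegrableOn.integrable_indicator ?_ measurableSet_Ioi
    have h1 : IntegrableOn (e n) (Set.Ioi 0) := by
      refine Integrable.ofReal (𝕜 := ℂ) (f := fun ξ : ℝ =>
        Real.exp (-(2 * Real.pi * (1 / ((n : ℝ) + 1))) * ξ)) ?_
      exact integrableOn_exp_mul_Ioi (by
        have h1 := level_pos n
        have := Real.pi_pos
        rw [neg_lt_zero]
        positivity) 0
    exact h1.bdd_mul hFvc.aestronglyMeasurable
      (Eventually.of_forall fun ξ => norm_fourier_le v ξ)
  have hlevel : ∀ n x, 𝓕⁻ (mn n) x =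
      cauchySzego v (pt x (1 / ((n : ℝ) + 1)) (level_pos n)) := by
    intro n x
    rw [cauchySzego_eq_integral_fourier hv, fourierInv_real_eq_fourier_neg,
      Real.fourier_real_eq_integral_exp_smul, ← integral_indicator measurableSet_Ioi]
    refine integral_congr_ae (Eventually.of_forall fun ξ => ?_)
    by_cases hξ : ξ ∈ Set.Ioi (0 : ℝ)
    · simp only [hmn, Set.indicator_of_mem hξ, smul_eq_mul, he]
      rw [mul_left_comm, ofReal_exp, ← Complex.exp_add, coe_pt]
      congr 2
      push_cast
      linear_combination (-(2 * Real.pi * ξ * (1 / ((n : ℂ) + 1)))) * I_sq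
    · simp [hmn, Set.indicator_of_notMem hξ]
  have hdiff : Tendsto (fun n => eLpNorm (mn n - m) 2 volume) atTop (𝓝 0) := by
    refine tendsto_eLpNorm_two_of_dominated (fun n => (hmnm n).sub hm2.1) (hFv2.const_smul (2 : ℂ))
      (fun n => Eventually.of_forall fun ξ => ?_) (Eventually.of_forall fun ξ => ?_)
    · by_cases hξ : ξ ∈ Set.Ioi (0 : ℝ)
      · simp only [hmn, hm, Pi.sub_apply, Set.indicator_of_mem hξ, Pi.smul_apply, smul_eq_mul]
        have h1 : ‖e n ξ - 1‖ ≤ 2 := by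
          refine (norm_sub_le _ _).trans ?_
          rw [norm_one]
          linarith [hen n ξ hξ]
        rw [← mul_sub_one, norm_mul, norm_mul, mul_comm, Complex.norm_ofNat]
        gcongr
      · simp [hmn, hm, Set.indicator_of_notMem hξ]
    · by_cases hξ : ξ ∈ Set.Ioi (0 : ℝ)
      · simp only [hmn, hm, Pi.sub_apply, Set.indicator_of_mem hξ, he]
        have h1 : Tendsto (fun n : ℕ => -(2 * Real.pi * (1 / ((n : ℝ) + 1))) * ξ) atTop
            (𝓝 (-(2 * Real.pi * 0) * ξ)) :=
          ((tendsto_one_div_add_atTop_nhds_zero_nat.const_mul _).neg).mul_const _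
        have h2 := (continuous_ofReal.tendsto _).comp ((Real.continuous_exp.tendsto _).comp h1)
        have h3 := (h2.const_mul (𝓕 v ξ)).sub_const (𝓕 v ξ)
        simpa using h3
      · simp [hmn, hm, Set.indicator_of_notMem hξ]
  have hLp : Tendsto (fun n => (hmn2 n).toLp (mn n)) atTop (𝓝 (hm2.toLp m)) :=
    (Lp.tendsto_Lp_iff_tendsto_eLpNorm'' mn hmn2 m hm2).2 hdiff
  set G : Lp ℂ 2 (volume : Measure ℝ) := 𝓕⁻ (hm2.toLp m) with hG
  have hinv : Tendsto (fun n => (𝓕⁻ ((hmn2 n).toLp (mn n)) : Lp ℂ 2 (volume : Measure ℝ))) atTop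
      (𝓝 G) :=
    ((Lp.fourierTransformₗᵢ ℝ ℂ).symm.continuous.tendsto _).comp hLp
  -- L² convergence alone does not give the L¹ bound. Along an a.e. convergent subsequence G is a
  -- pointwise limit of restrictions of P₊v, and Fatou applies.
  obtain ⟨ns, -, hns⟩ := (tendstoInMeasure_of_tendsto_Lp hinv).exists_seq_tendsto_ae
  have hae : ∀ᵐ x, Tendsto (fun k => cauchySzego v (pt x (1 / ((ns k : ℝ) + 1)) (level_pos _)))
      atTop (𝓝 (G x)) := by
    have hall : ∀ᵐ x, ∀ n, (𝓕⁻ ((hmn2 n).toLp (mn n)) : Lp ℂ 2 (volume : Measure ℝ)) x =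
        𝓕⁻ (mn n) x := ae_all_iff.2 fun n => fourierInv_toLp_ae_eq (hmn1 n) (hmn2 n)
    filter_upwards [hns, hall] with x hx hx2
    refine hx.congr fun k => ?_
    rw [hx2, hlevel]
  have hGle : ∫⁻ x, ‖G x‖ₑ ≤ hardyNorm (cauchySzego v) := by
    have hmeas : ∀ k, Measurable fun x : ℝ =>
        ‖cauchySzego v (pt x (1 / ((ns k : ℝ) + 1)) (level_pos _))‖ₑ := fun k =>
      ((mdifferentiable_cauchySzego hv).continuous.comp
        (continuous_pt _ (level_pos _))).enorm.measurable
    calc ∫⁻ x, ‖G x‖ₑ = ∫⁻ x, liminf (fun k =>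
          ‖cauchySzego v (pt x (1 / ((ns k : ℝ) + 1)) (level_pos _))‖ₑ) atTop := by
          refine lintegral_congr_ae ?_
          filter_upwards [hae] with x hx
          exact hx.enorm.liminf_eq.symm
      _ ≤ liminf (fun k => ∫⁻ x,
          ‖cauchySzego v (pt x (1 / ((ns k : ℝ) + 1)) (level_pos _))‖ₑ) atTop :=
          lintegral_liminf_le hmeas
      _ ≤ hardyNorm (cauchySzego v) := by
          refine liminf_le_of_frequently_le'
            (Eventually.frequently (Eventually.of_forall fun k => ?_))
          exact lintegral_level_le _ (level_pos _)
  have hGi : Integrable G := ⟨(Lp.memLp G).1, hGle.trans_lt hH⟩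
  refine ⟨G, hGi, hGle, ?_⟩
  -- G now lies in L¹ ∩ L², so its Fourier integral is its L² transform, which is m by construction.
  have h1 := fourier_toLp_ae_eq hGi (Lp.memLp G)
  rw [Lp.toLp_coeFn, hG, FourierTransform.fourier_fourierInv_eq] at h1
  filter_upwards [h1, hm2.coeFn_toLp] with ξ hξ hξ2
  rw [← hξ2]
  exact hξ.symm

/-! ### Multiplication by an inner function preserves nonnegative spectra -/

lemma fourier_conj (u : ℝ → ℂ) (ξ : ℝ) : 𝓕 (fun x => conj (u x)) ξ = conj (𝓕 u (-ξ)) := by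
  rw [Real.fourier_real_eq_integral_exp_smul, Real.fourier_real_eq_integral_exp_smul,
    ← integral_conj]
  refine integral_congr_ae (Eventually.of_forall fun x => ?_)
  simp only [smul_eq_mul, map_mul, ← Complex.exp_conj, conj_ofReal, conj_I]
  congr 2
  push_cast
  ring

lemma hardyNorm_mul_le {Θ f : ℍ → ℂ} {M : ℝ≥0} (hM : ∀ z, ‖Θ z‖ ≤ M) :
    hardyNorm (fun z => Θ z * f z) ≤ M * hardyNorm f := by
  refine iSup₂_le fun y hy => ?_
  calc ∫⁻ x, ‖Θ (pt x y hy) * f (pt x y hy)‖ₑ ≤ ∫⁻ x, M * ‖f (pt x y hy)‖ₑ := by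
        refine lintegral_mono fun x => ?_
        rw [enorm_mul]
        gcongr
        exact enorm_le_coe.2 (hM _)
    _ = M * ∫⁻ x, ‖f (pt x y hy)‖ₑ := lintegral_const_mul' _ _ ENNReal.coe_ne_top
    _ ≤ _ := by gcongr; exact lintegral_level_le f hy

lemma IsInner.integrable_boundary_mul (hΘ : IsInner Θ) {u : ℝ → ℂ} (hu : Integrable u) :
    Integrable fun x => boundary Θ x * u x :=
  hu.bdd_mul (c := 1) (hΘ.hasBoundaryValues.aestronglyMeasurable hΘ.mdiff.continuous) (by
    filter_upwards [hΘ.norm_boundary] with x hx using hx.le)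

/-- The product Θ · P₊φ is in H¹(ℂ⁺) because Θ is bounded, and its boundary function is Θφ. For
Schwartz φ the boundary limits of P₊φ exist everywhere. -/
lemma IsInner.fourier_mul_schwartz_eq_zero (hΘ : IsInner Θ) (φ : 𝓢(ℝ, ℂ))
    (h : ∀ ξ, ξ < 0 → 𝓕 (φ : ℝ → ℂ) ξ = 0) {ξ : ℝ} (hξ : ξ ≤ 0) :
    𝓕 (fun x => boundary Θ x * φ x) ξ = 0 := by
  obtain ⟨M, hM⟩ := hΘ.bounded
  have hF := cauchySzego_mem_H1Plus φ.integrable h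
  have hmem : (fun z => Θ z * cauchySzego φ z) ∈ H1Plus :=
    ⟨hΘ.mdiff.mul hF.1, (hardyNorm_mul_le (M := M.toNNReal) fun z =>
      (hM z).trans (Real.le_coe_toNNReal M)).trans_lt (ENNReal.mul_lt_top ENNReal.coe_lt_top hF.2)⟩
  have ht : ∀ᵐ x, Tendsto (fun z => Θ z * cauchySzego φ z) (nontangential x)
      (𝓝 (boundary Θ x * φ x)) := by
    filter_upwards [hΘ.hasBoundaryValues.tendsto] with x hx
    exact hx.mul (tendsto_cauchySzego_schwartz φ h x)
  have hb : HasBoundaryValues fun z => Θ z * cauchySzego φ z := by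
    filter_upwards [ht] with x hx
    exact ⟨_, hx⟩
  have he : boundary (fun z => Θ z * cauchySzego φ z) =ᵐ[volume] fun x => boundary Θ x * φ x := by
    filter_upwards [ht] with x hx
    exact boundary_eq hx
  rw [← fourier_congr he]
  exact fourier_boundary_eq_zero hmem hb hξ

/-- Density: as |Θ| = 1, replacing g by a Schwartz φ changes the transform by at most ‖g − φ‖₁. The
conclusion includes ξ = 0, which later gives ∫ bΘ̄ = 0. -/
lemma IsInner.fourier_mul_eq_zero (hΘ : IsInner Θ) {g : ℝ → ℂ} (hg : Integrable g)
    (h : ∀ ξ, ξ < 0 → 𝓕 g ξ = 0) {ξ : ℝ} (hξ : ξ ≤ 0) :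
    𝓕 (fun x => boundary Θ x * g x) ξ = 0 := by
  refine norm_le_zero_iff.1 (le_of_forall_pos_le_add fun ε hε => ?_)
  obtain ⟨φ, hφ, hφε⟩ := exists_schwartz_near hg h hε
  have h1 := norm_fourier_le ((fun x => boundary Θ x * g x) - fun x => boundary Θ x * φ x) ξ
  rw [fourier_sub_apply (hΘ.integrable_boundary_mul hg) (hΘ.integrable_boundary_mul φ.integrable),
    hΘ.fourier_mul_schwartz_eq_zero φ hφ hξ, sub_zero] at h1
  rw [zero_add]
  refine h1.trans (le_trans (le_of_eq ?_) hφε.le)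
  refine integral_congr_ae ?_
  filter_upwards [hΘ.norm_boundary] with x hx
  rw [Pi.sub_apply, ← mul_sub, norm_mul, hx, one_mul]

/-- Multiplication by `Θ̄` preserves spectra in `(-∞, 0]`, and annihilates the mean. -/
lemma IsInner.fourier_conj_mul_eq_zero (hΘ : IsInner Θ) {g : ℝ → ℂ} (hg : Integrable g)
    (h : ∀ ξ, 0 < ξ → 𝓕 g ξ = 0) {ξ : ℝ} (hξ : 0 ≤ ξ) :
    𝓕 (fun x => conj (boundary Θ x) * g x) ξ = 0 := by
  have hgc : Integrable fun x => conj (g x) :=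
    (LinearIsometryEquiv.integrable_comp_iff Complex.conjLIE).2 hg
  -- Conjugation reflects the spectrum, so the claim is the previous lemma for Θḡ.
  have h1 := hΘ.fourier_mul_eq_zero hgc (fun ξ hξ => by
    rw [fourier_conj, h _ (by linarith), map_zero]) (ξ := -ξ) (by linarith)
  have h2 := fourier_conj (fun x => boundary Θ x * conj (g x)) ξ
  rw [h1, map_zero] at h2
  rw [← h2]
  refine congrArg (fun w : ℝ → ℂ => 𝓕 w ξ) (funext fun x => ?_)
  simp

/-! ### Constrained density -/

lemma IsInner.norm_integral_mul_conj_le (hΘ : IsInner Θ) (u : ℝ → ℂ) :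
    ‖∫ x, u x * conj (boundary Θ x)‖ ≤ ∫ x, ‖u x‖ := by
  refine (norm_integral_le_integral_norm _).trans (le_of_eq (integral_congr_ae ?_))
  filter_upwards [hΘ.norm_boundary] with x hx
  rw [norm_mul, RCLike.norm_conj, hx, mul_one]

/-- Schwartz functions with spectrum in `[0, ∞)` orthogonal to `Θ` are dense. -/
lemma IsInner.exists_schwartz_near (hΘ : IsInner Θ) {f : ℝ → ℂ} (hf : Integrable f)
    (h : ∀ ξ, ξ < 0 → 𝓕 f ξ = 0) (h0 : ∫ x, f x * conj (boundary Θ x) = 0)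
    {ε : ℝ} (hε : 0 < ε) :
    ∃ φ : 𝓢(ℝ, ℂ), (∀ ξ, ξ < 0 → 𝓕 (φ : ℝ → ℂ) ξ = 0) ∧
      ∫ x, φ x * conj (boundary Θ x) = 0 ∧ ∫ x, ‖f x - φ x‖ < ε := by
  -- Either the functional ∫ · Θ̄ vanishes on all these Schwartz functions and any approximant is
  -- admissible, or some φ₀ is available to correct an approximant back into its kernel.
  by_cases hex : ∃ φ₀ : 𝓢(ℝ, ℂ), (∀ ξ, ξ < 0 → 𝓕 (φ₀ : ℝ → ℂ) ξ = 0) ∧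
      ∫ x, φ₀ x * conj (boundary Θ x) ≠ 0
  · obtain ⟨φ₀, hφ₀, hne⟩ := hex
    set l := ∫ x, φ₀ x * conj (boundary Θ x) with hl
    set A := ∫ x, ‖φ₀ x‖ with hA
    have hA0 : 0 ≤ A := integral_nonneg fun x => norm_nonneg _
    have hl0 : 0 < ‖l‖ := norm_pos_iff.2 hne
    -- The correction (l₁/l)φ₀ has norm (|l₁|/|l|)A, and |l₁| ≤ ‖f − φ₁‖₁ because f is in the
    -- kernel; the total error is at most this factor times ‖f − φ₁‖₁.
    have hK : 0 < 1 + A / ‖l‖ := by positivity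
    obtain ⟨φ₁, hφ₁, hφ₁ε⟩ := HardyToeplitz.exists_schwartz_near hf h (div_pos hε hK)
    set l₁ := ∫ x, φ₁ x * conj (boundary Θ x) with hl₁
    have hl₁le : ‖l₁‖ ≤ ∫ x, ‖f x - φ₁ x‖ := by
      have h1 := hΘ.norm_integral_mul_conj_le fun x => f x - φ₁ x
      simp_rw [sub_mul] at h1
      rwa [integral_sub (hΘ.integrable_mul hf) (hΘ.integrable_mul φ₁.integrable), h0, zero_sub,
        norm_neg] at h1
    refine ⟨φ₁ - (l₁ / l) • φ₀, fun ξ hξ => ?_, ?_, ?_⟩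
    · have e : ((φ₁ - (l₁ / l) • φ₀ : 𝓢(ℝ, ℂ)) : ℝ → ℂ) = (φ₁ : ℝ → ℂ) - (l₁ / l) • (φ₀ : ℝ → ℂ) :=
        rfl
      rw [e, fourier_sub_apply φ₁.integrable (φ₀.integrable.smul _), fourier_smul_apply,
        hφ₁ ξ hξ, hφ₀ ξ hξ, mul_zero, sub_zero]
    · have e : ∀ x, (φ₁ - (l₁ / l) • φ₀ : 𝓢(ℝ, ℂ)) x * conj (boundary Θ x) =
          φ₁ x * conj (boundary Θ x) - (l₁ / l) * (φ₀ x * conj (boundary Θ x)) := fun x => by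
        simp only [sub_apply, smul_apply, smul_eq_mul]
        ring
      simp_rw [e]
      rw [integral_sub (hΘ.integrable_mul φ₁.integrable)
        ((hΘ.integrable_mul φ₀.integrable).const_mul _), integral_const_mul, ← hl₁, ← hl,
        div_mul_cancel₀ _ hne, sub_self]
    · calc ∫ x, ‖f x - (φ₁ - (l₁ / l) • φ₀ : 𝓢(ℝ, ℂ)) x‖
          ≤ ∫ x, (‖f x - φ₁ x‖ + ‖l₁ / l‖ * ‖φ₀ x‖) := by
            refine integral_mono (hf.sub (SchwartzMap.integrable _)).norm
              ((hf.sub φ₁.integrable).norm.add (φ₀.integrable.norm.const_mul _)) fun x => ?_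
            simp only [sub_apply, smul_apply, smul_eq_mul]
            rw [← norm_mul]
            refine le_trans (le_of_eq ?_) (norm_add_le _ _)
            congr 1
            ring
        _ = (∫ x, ‖f x - φ₁ x‖) + ‖l₁‖ / ‖l‖ * A := by
            have hi : Integrable fun x => ‖f x - φ₁ x‖ := (hf.sub φ₁.integrable).norm
            rw [integral_add hi (φ₀.integrable.norm.const_mul _),
              integral_const_mul, norm_div]
        _ ≤ (∫ x, ‖f x - φ₁ x‖) + (∫ x, ‖f x - φ₁ x‖) / ‖l‖ * A := by gcongr
        _ = (∫ x, ‖f x - φ₁ x‖) * (1 + A / ‖l‖) := by ring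
        _ < ε := (lt_div_iff₀ hK).1 hφ₁ε
  · push Not at hex
    obtain ⟨φ, hφ, hφε⟩ := HardyToeplitz.exists_schwartz_near hf h hε
    exact ⟨φ, hφ, hex φ hφ, hφε⟩

/-! ### Riesz projections in `H¹(ℝ)` -/

lemma fourier_L1_add (f g : L1) (ξ : ℝ) :
    𝓕 ((f + g : L1) : ℝ → ℂ) ξ = 𝓕 (f : ℝ → ℂ) ξ + 𝓕 (g : ℝ → ℂ) ξ := by
  rw [fourier_congr (Lp.coeFn_add f g), fourier_add_apply (integrable_L1 f) (integrable_L1 g)]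

lemma fourier_L1_sub (f g : L1) (ξ : ℝ) :
    𝓕 ((f - g : L1) : ℝ → ℂ) ξ = 𝓕 (f : ℝ → ℂ) ξ - 𝓕 (g : ℝ → ℂ) ξ := by
  rw [fourier_congr (Lp.coeFn_sub f g), fourier_sub_apply (integrable_L1 f) (integrable_L1 g)]

lemma fourier_L1_smul (c : ℂ) (f : L1) (ξ : ℝ) :
    𝓕 ((c • f : L1) : ℝ → ℂ) ξ = c * 𝓕 (f : ℝ → ℂ) ξ := by
  rw [fourier_congr (Lp.coeFn_smul c f), fourier_smul_apply]

lemma norm_fourier_L1_le (f : L1) (ξ : ℝ) : ‖𝓕 (f : ℝ → ℂ) ξ‖ ≤ ‖f‖ := by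
  rw [L1.norm_eq_integral_norm]
  exact norm_fourier_le _ _

/-- Transforms of L¹ functions are continuous, so the a.e. multiplier identity holds at every point
of the open half-line, where the symbol is constant. -/
lemma fourier_hilbert_of_pos {v w : L1} (h : hilbert v = (w : 𝓢'(ℝ, ℂ))) {ξ : ℝ} (hξ : 0 < ξ) :
    𝓕 (w : ℝ → ℂ) ξ = -I * 𝓕 (v : ℝ → ℂ) ξ := by
  have h1 := ae_restrict_of_ae (s := Set.Ioi (0 : ℝ)) ((hilbert_eq_iff v w).1 h)
  have h2 : 𝓕 (w : ℝ → ℂ) =ᵐ[volume.restrict (Set.Ioi 0)] fun ξ => -I * 𝓕 (v : ℝ → ℂ) ξ := by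
    filter_upwards [h1, ae_restrict_mem measurableSet_Ioi] with ξ hξ hξ0
    rw [hξ, Real.sign_of_pos hξ0, ofReal_one, mul_one]
  exact Measure.eqOn_open_of_ae_eq h2 isOpen_Ioi
    (continuous_fourier (integrable_L1 w)).continuousOn
    (continuous_const.mul (continuous_fourier (integrable_L1 v))).continuousOn hξ

lemma fourier_hilbert_of_neg {v w : L1} (h : hilbert v = (w : 𝓢'(ℝ, ℂ))) {ξ : ℝ} (hξ : ξ < 0) :
    𝓕 (w : ℝ → ℂ) ξ = I * 𝓕 (v : ℝ → ℂ) ξ := by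
  have h1 := ae_restrict_of_ae (s := Set.Iio (0 : ℝ)) ((hilbert_eq_iff v w).1 h)
  have h2 : 𝓕 (w : ℝ → ℂ) =ᵐ[volume.restrict (Set.Iio 0)] fun ξ => I * 𝓕 (v : ℝ → ℂ) ξ := by
    filter_upwards [h1, ae_restrict_mem measurableSet_Iio] with ξ hξ hξ0
    rw [hξ, Real.sign_of_neg hξ0]
    simp
  exact Measure.eqOn_open_of_ae_eq h2 isOpen_Iio
    (continuous_fourier (integrable_L1 w)).continuousOn
    (continuous_const.mul (continuous_fourier (integrable_L1 v))).continuousOn hξ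

/-- A function with spectrum in `[0, ∞)` satisfies `H u = -i u`. -/
lemma hilbert_eq_of_fourier_neg {u : L1} (h : ∀ ξ, ξ < 0 → 𝓕 (u : ℝ → ℂ) ξ = 0) :
    hilbert u = (((-I) • u : L1) : 𝓢'(ℝ, ℂ)) := by
  rw [hilbert_eq_iff]
  filter_upwards [compl_mem_ae_iff.2 (measure_singleton (0 : ℝ))] with ξ hξ
  rw [fourier_L1_smul]
  rcases lt_or_gt_of_ne (show ξ ≠ 0 from hξ) with h1 | h1
  · rw [h ξ h1, mul_zero, mul_zero]
  · rw [Real.sign_of_pos h1, ofReal_one, mul_one]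

/-- A function with spectrum in `(-∞, 0]` satisfies `H u = i u`. -/
lemma hilbert_eq_of_fourier_pos {u : L1} (h : ∀ ξ, 0 < ξ → 𝓕 (u : ℝ → ℂ) ξ = 0) :
    hilbert u = ((I • u : L1) : 𝓢'(ℝ, ℂ)) := by
  rw [hilbert_eq_iff]
  filter_upwards [compl_mem_ae_iff.2 (measure_singleton (0 : ℝ))] with ξ hξ
  rw [fourier_L1_smul]
  rcases lt_or_gt_of_ne (show ξ ≠ 0 from hξ) with h1 | h1
  · rw [Real.sign_of_neg h1]
    simp
  · rw [h ξ h1, mul_zero, mul_zero]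

/-- The analytic part `(v + i w) / 2` of `v`, where `w = H v`. -/
def analyticPart (v w : L1) : L1 := (1 / 2 : ℂ) • (v + I • w)

/-- The antianalytic part `(v - i w) / 2` of `v`, where `w = H v`. -/
def antianalyticPart (v w : L1) : L1 := (1 / 2 : ℂ) • (v - I • w)

lemma analyticPart_add_antianalyticPart (v w : L1) :
    analyticPart v w + antianalyticPart v w = v := by
  rw [analyticPart, antianalyticPart, ← smul_add, add_add_sub_cancel, ← two_smul ℂ v, smul_smul]
  norm_num

lemma fourier_analyticPart {v w : L1} (h : hilbert v = (w : 𝓢'(ℝ, ℂ))) {ξ : ℝ} (hξ : ξ < 0) :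
    𝓕 (analyticPart v w : ℝ → ℂ) ξ = 0 := by
  rw [analyticPart, fourier_L1_smul, fourier_L1_add, fourier_L1_smul, fourier_hilbert_of_neg h hξ]
  linear_combination (1 / 2 * 𝓕 (v : ℝ → ℂ) ξ) * I_sq

lemma fourier_antianalyticPart {v w : L1} (h : hilbert v = (w : 𝓢'(ℝ, ℂ))) {ξ : ℝ}
    (hξ : 0 < ξ) : 𝓕 (antianalyticPart v w : ℝ → ℂ) ξ = 0 := by
  rw [antianalyticPart, fourier_L1_smul, fourier_L1_sub, fourier_L1_smul,
    fourier_hilbert_of_pos h hξ]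
  linear_combination (1 / 2 * 𝓕 (v : ℝ → ℂ) ξ) * I_sq

lemma norm_analyticPart_le (v w : L1) : ‖analyticPart v w‖ ≤ (‖v‖ + ‖w‖) / 2 := by
  rw [analyticPart, norm_smul]
  have := norm_add_le v (I • w)
  rw [norm_smul, norm_I, one_mul] at this
  norm_num
  linarith

lemma norm_antianalyticPart_le (v w : L1) : ‖antianalyticPart v w‖ ≤ (‖v‖ + ‖w‖) / 2 := by
  rw [antianalyticPart, norm_smul]
  have := norm_sub_le v (I • w)
  rw [norm_smul, norm_I, one_mul] at this
  norm_num
  linarith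

lemma lintegral_enorm_L1 (f : L1) : ∫⁻ x, ‖f x‖ₑ = ‖f‖ₑ := by
  rw [Lp.enorm_def, eLpNorm_one_eq_lintegral_enorm]

/-- For `v ∈ H¹(ℝ)` the Cauchy integral `P₊ v` is in `H¹(ℂ⁺)`. -/
lemma hardyNorm_cauchySzego_le_of_hilbert {v w : L1} (h : hilbert v = (w : 𝓢'(ℝ, ℂ))) :
    hardyNorm (cauchySzego v) ≤ ‖analyticPart v w‖ₑ := by
  -- The Cauchy integral sees only positive frequencies, so the antianalytic part drops out.
  have e : cauchySzego v = cauchySzego (analyticPart v w) := by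
    have h1 : (v : ℝ → ℂ) =ᵐ[volume]
        (analyticPart v w : ℝ → ℂ) + (antianalyticPart v w : ℝ → ℂ) := by
      have := Lp.coeFn_add (analyticPart v w) (antianalyticPart v w)
      rwa [analyticPart_add_antianalyticPart] at this
    rw [cauchySzego_congr h1, cauchySzego_add (integrable_L1 _) (integrable_L1 _),
      cauchySzego_eq_zero (integrable_L1 (antianalyticPart v w))
        (fun ξ hξ => fourier_antianalyticPart h hξ), add_zero]
  rw [e, ← lintegral_enorm_L1]
  exact hardyNorm_cauchySzego_le (integrable_L1 _) fun ξ hξ => fourier_analyticPart h hξ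

/-! ### From multiplication to Toeplitz operators -/

lemma coeFn_mulConj_toLp (hΘ : IsInner Θ) {u : ℝ → ℂ} (hu : MemLp u 1) :
    mulConj hΘ (hu.toLp u) =ᵐ[volume] fun x => conj (boundary Θ x) * u x := by
  filter_upwards [coeFn_mulConj hΘ (hu.toLp u), hu.coeFn_toLp] with x h1 h2
  rw [h1, h2]

/-- The boundary function of f ∈ H¹_Θ belongs to H¹_Θ(ℝ), and T f is the Cauchy integral of its
image under M. -/
theorem toeplitzBounded_of_multiplicationBounded (hΘ : IsInner Θ)
    (h : MultiplicationBounded hΘ) : ToeplitzBounded hΘ := by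
  obtain ⟨M, hM, C, hC⟩ := h
  have key : ∀ f : H1Theta hΘ, MDiff (toeplitz Θ f) ∧
      hardyNorm (toeplitz Θ f) ≤ ‖C‖₊ * hardyNorm f := by
    rintro ⟨f, hf, hb, hi, h0⟩
    have hm := memLp_one_iff_integrable.2 hi
    set u : L1 := hm.toLp (boundary f) with hu
    have hspec : ∀ ξ, ξ < 0 → 𝓕 (u : ℝ → ℂ) ξ = 0 := fun ξ hξ => by
      rw [fourier_congr hm.coeFn_toLp]
      exact fourier_boundary_eq_zero hf hb hξ.le
    have hHu := hilbert_eq_of_fourier_neg hspec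
    let uR : H1Real := ⟨u, mem_H1Real_of_hilbert_eq hHu⟩
    have huT : uR ∈ H1RealTheta hΘ := by
      change ∫ x : ℝ, u x * conj (boundary Θ x) = 0
      rw [← h0]
      refine integral_congr_ae ?_
      filter_upwards [hm.coeFn_toLp] with x hx
      rw [hu, hx]
    let uT : H1RealTheta hΘ := ⟨uR, huT⟩
    -- Hu = −iu doubles the norm; the factor 2 cancels the 1/2 in `norm_analyticPart_le`, so the
    -- constant of M carries over.
    have hnorm : h1Norm uR = 2 * ‖u‖ := by
      have e1 : hilbertL1 uR = (-I) • u := hilbertL1_eq_of_hilbert_eq uR hHu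
      rw [h1Norm, e1, norm_smul, norm_neg, norm_I, one_mul]
      exact (two_mul _).symm
    have hv : toeplitz Θ f = cauchySzego (M uT : L1) := by
      rw [toeplitz, hM]
      exact cauchySzego_congr (coeFn_mulConj_toLp hΘ hm).symm
    have hw : hilbert (M uT : L1) = (hilbertL1 (M uT) : 𝓢'(ℝ, ℂ)) := (hilbertL1_spec _).symm
    have hle : ‖analyticPart (M uT : L1) (hilbertL1 (M uT))‖ ≤ ‖C‖ * ‖u‖ := by
      refine (norm_analyticPart_le _ _).trans ?_
      have h1 : ‖(M uT : L1)‖ + ‖hilbertL1 (M uT)‖ ≤ C * (2 * ‖u‖) := by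
        rw [← hnorm]; exact hC uT
      have h2 : C * ‖u‖ ≤ ‖C‖ * ‖u‖ := by gcongr; exact Real.le_norm_self C
      linarith
    change MDiff (toeplitz Θ f) ∧ hardyNorm (toeplitz Θ f) ≤ ‖C‖₊ * hardyNorm f
    rw [hv]
    refine ⟨mdifferentiable_cauchySzego (integrable_L1 _), ?_⟩
    refine (hardyNorm_cauchySzego_le_of_hilbert hw).trans ?_
    calc ‖analyticPart (M uT : L1) (hilbertL1 (M uT))‖ₑ ≤ ‖C‖₊ * ‖u‖ₑ := by
          rw [← enorm_eq_nnnorm, ← ofReal_norm, ← ofReal_norm u, ← ofReal_norm C,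
            ← ENNReal.ofReal_mul (norm_nonneg _)]
          exact ENNReal.ofReal_le_ofReal hle
      _ ≤ ‖C‖₊ * hardyNorm f := by
          gcongr
          rw [← lintegral_enorm_L1]
          refine le_trans (le_of_eq (lintegral_congr_ae ?_)) (lintegral_boundary_le hf hb)
          filter_upwards [hm.coeFn_toLp] with x hx
          rw [hu, hx]
  have hmem : ∀ f : H1Theta hΘ, toeplitz Θ f ∈ H1Plus := fun f =>
    ⟨(key f).1, (key f).2.trans_lt (ENNReal.mul_lt_top ENNReal.coe_lt_top f.2.1.2)⟩
  have hint : ∀ f : H1Theta hΘ, Integrable fun t => conj (boundary Θ t) * boundary f t := fun f =>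
    (hΘ.integrable_mul f.2.2.2.1).congr (Eventually.of_forall fun t => mul_comm _ _)
  -- The extension is given by P₊(Θ̄f) on all of H¹_Θ, so it agrees with the initial operator by
  -- definition.
  refine ⟨⟨⟨fun f => ⟨toeplitz Θ f, hmem f⟩, fun f g => Subtype.ext ?_⟩,
    fun c f => Subtype.ext ?_⟩, fun f _ => rfl, ‖C‖₊, fun f => (key f).2⟩
  · change toeplitz Θ (f + g : ℍ → ℂ) = toeplitz Θ f + toeplitz Θ g
    simp only [toeplitz]
    rw [← cauchySzego_add (hint f) (hint g)]
    refine cauchySzego_congr ?_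
    filter_upwards [f.2.2.1.tendsto, g.2.2.1.tendsto] with x hx hy
    have e : boundary (f + g : ℍ → ℂ) x = boundary f x + boundary g x := boundary_eq (hx.add hy)
    rw [e, Pi.add_apply, mul_add]
  · change toeplitz Θ (c • f : ℍ → ℂ) = c • toeplitz Θ f
    simp only [toeplitz]
    rw [← cauchySzego_smul]
    refine cauchySzego_congr ?_
    filter_upwards [f.2.2.1.tendsto] with x hx
    have e : boundary (c • f : ℍ → ℂ) x = c • boundary f x := boundary_eq (hx.const_smul c)
    rw [e, Pi.smul_apply, smul_eq_mul, smul_eq_mul]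
    ring

/-! ### From Toeplitz operators to multiplication -/

/-- A Schwartz function as an element of `L¹`. -/
def schwartzL1 (φ : 𝓢(ℝ, ℂ)) : L1 := (memLp_one_iff_integrable.2 φ.integrable).toLp φ

lemma coeFn_schwartzL1 (φ : 𝓢(ℝ, ℂ)) : schwartzL1 φ =ᵐ[volume] φ :=
  MemLp.coeFn_toLp _

lemma schwartzL1_sub (φ ψ : 𝓢(ℝ, ℂ)) : schwartzL1 (φ - ψ) = schwartzL1 φ - schwartzL1 ψ :=
  rfl

/-- On Schwartz functions in `H¹_Θ`, boundedness of the Toeplitz operator controls the Hilbert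
transform of `Θ̄ φ`. -/
lemma exists_hilbert_mulConj_schwartz (hΘ : IsInner Θ) {T : H1Theta hΘ →ₗ[ℂ] H1Plus}
    (hT : ∀ f : H1Theta hΘ, (f : ℍ → ℂ) ∈ SPlus → (T f : ℍ → ℂ) = toeplitz Θ f) {C : ℝ≥0}
    (hC : ∀ f : H1Theta hΘ, hardyNorm (T f) ≤ C * hardyNorm f) (φ : 𝓢(ℝ, ℂ))
    (hφ : ∀ ξ, ξ < 0 → 𝓕 (φ : ℝ → ℂ) ξ = 0) (h0 : ∫ x, φ x * conj (boundary Θ x) = 0) :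
    ∃ w : L1, hilbert (mulConj hΘ (schwartzL1 φ)) = (w : 𝓢'(ℝ, ℂ)) ∧
      ‖w‖ ≤ (2 * C + 1) * ‖schwartzL1 φ‖ := by
  set p := schwartzL1 φ with hp
  have hbd := boundary_cauchySzego_schwartz φ hφ
  have hF : cauchySzego φ ∈ H1Theta hΘ := by
    refine ⟨cauchySzego_mem_H1Plus φ.integrable hφ,
      Eventually.of_forall fun x => ⟨_, tendsto_cauchySzego_schwartz φ hφ x⟩, ?_, ?_⟩
    · rw [hbd]; exact φ.integrable
    · rw [hbd]; exact h0
  set v : ℝ → ℂ := fun t => conj (boundary Θ t) * φ t with hv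
  have hTF : (T ⟨cauchySzego φ, hF⟩ : ℍ → ℂ) = cauchySzego v := by
    rw [hT _ ⟨φ, hφ, rfl⟩]
    simp only [toeplitz]
    rw [hbd]
  have hvi : Integrable v :=
    (hΘ.integrable_mul φ.integrable).congr (Eventually.of_forall fun t => mul_comm _ _)
  -- Square integrability of Θ̄φ, available because φ is Schwartz, is what allows P₊v to be handled
  -- by L² theory.
  have hv2 : MemLp v 2 := by
    refine (φ.memLp 2 volume).of_le hvi.1 ?_
    filter_upwards [hΘ.norm_boundary] with x hx
    simp [hv, hx]
  have hpn : ∫⁻ x, ‖φ x‖ₑ = ‖p‖ₑ := by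
    rw [← lintegral_enorm_L1]
    refine lintegral_congr_ae ?_
    filter_upwards [coeFn_schwartzL1 φ] with x hx
    rw [hp, hx]
  have hH : hardyNorm (cauchySzego v) ≤ C * ‖p‖ₑ := by
    rw [← hTF]
    refine (hC _).trans ?_
    gcongr
    rw [← hpn]
    exact hardyNorm_cauchySzego_le φ.integrable hφ
  have hfin : (C : ℝ≥0∞) * ‖p‖ₑ < ∞ := ENNReal.mul_lt_top ENNReal.coe_lt_top enorm_lt_top
  obtain ⟨g, hgi, hgle, hgF⟩ := exists_integrable_projection hvi hv2 (hH.trans_lt hfin)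
  have hgm := memLp_one_iff_integrable.2 hgi
  set gL : L1 := hgm.toLp g with hgL
  have hgn : ‖gL‖ ≤ C * ‖p‖ := by
    have h1 : ‖gL‖ₑ ≤ C * ‖p‖ₑ := by
      rw [← lintegral_enorm_L1]
      refine le_trans (le_of_eq (lintegral_congr_ae ?_)) (hgle.trans hH)
      filter_upwards [hgm.coeFn_toLp] with x hx
      rw [hgL, hx]
    have h2 := ENNReal.toReal_mono hfin.ne h1
    rwa [ENNReal.toReal_mul, toReal_enorm, toReal_enorm, ENNReal.coe_toReal] at h2
  set vL := mulConj hΘ p with hvL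
  have hvF : 𝓕 (vL : ℝ → ℂ) = 𝓕 v := fourier_congr (coeFn_mulConj_toLp hΘ _)
  -- The transform of g is v̂ cut to ξ > 0, and −i sign ξ = −i(2·1_{ξ>0} − 1) off the origin.
  refine ⟨(-I) • ((2 : ℂ) • gL - vL), ?_, ?_⟩
  · rw [hilbert_eq_iff]
    filter_upwards [hgF, compl_mem_ae_iff.2 (measure_singleton (0 : ℝ))] with ξ h1 h2
    rw [fourier_L1_smul, fourier_L1_sub, fourier_L1_smul, fourier_congr hgm.coeFn_toLp, h1, hvF]
    rcases lt_or_gt_of_ne (show ξ ≠ 0 from h2) with h3 | h3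
    · rw [Set.indicator_of_notMem (by simpa using h3.le), Real.sign_of_neg h3]
      push_cast
      ring
    · rw [Set.indicator_of_mem (by simpa using h3), Real.sign_of_pos h3]
      push_cast
      ring
  · rw [norm_smul, norm_neg, norm_I, one_mul]
    refine (norm_sub_le _ _).trans ?_
    rw [norm_smul, hvL, norm_mulConj, Complex.norm_ofNat]
    linarith

/-- The graph of the Hilbert transform is closed in `L¹ × L¹`. -/
lemma hilbert_eq_of_tendsto {v w : ℕ → L1} {v₀ w₀ : L1} (h : ∀ n, hilbert (v n) = (w n : 𝓢'(ℝ, ℂ)))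
    (hv : Tendsto v atTop (𝓝 v₀)) (hw : Tendsto w atTop (𝓝 w₀)) :
    hilbert v₀ = (w₀ : 𝓢'(ℝ, ℂ)) := by
  have hlim : ∀ {u : ℕ → L1} {u₀ : L1}, Tendsto u atTop (𝓝 u₀) → ∀ ξ,
      Tendsto (fun n => 𝓕 (u n : ℝ → ℂ) ξ) atTop (𝓝 (𝓕 (u₀ : ℝ → ℂ) ξ)) := by
    intro u u₀ hu ξ
    rw [tendsto_iff_norm_sub_tendsto_zero] at hu ⊢
    refine squeeze_zero (fun n => norm_nonneg _) (fun n => ?_) hu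
    rw [← fourier_L1_sub]
    exact norm_fourier_L1_le _ _
  rw [hilbert_eq_iff]
  filter_upwards [ae_all_iff.2 fun n => (hilbert_eq_iff (v n) (w n)).1 (h n)] with ξ hξ
  refine tendsto_nhds_unique (hlim hw ξ) ?_
  simp_rw [hξ]
  exact (hlim hv ξ).const_mul _

lemma continuous_mulConj (hΘ : IsInner Θ) : Continuous (mulConj hΘ) := by
  refine LipschitzWith.continuous (K := 1) (LipschitzWith.of_dist_le_mul fun f g => ?_)
  rw [dist_eq_norm, dist_eq_norm, ← mulConj_sub, norm_mulConj, NNReal.coe_one, one_mul]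

/-- Differences of admissible Schwartz functions are admissible, so the estimate makes the Hilbert
transforms of Θ̄φ_n Cauchy in L¹; the closed graph identifies their limit. -/
lemma exists_hilbert_mulConj_of_spectrum (hΘ : IsInner Θ) {K : ℝ}
    (hS : ∀ φ : 𝓢(ℝ, ℂ), (∀ ξ, ξ < 0 → 𝓕 (φ : ℝ → ℂ) ξ = 0) →
      ∫ x, φ x * conj (boundary Θ x) = 0 →
      ∃ w : L1, hilbert (mulConj hΘ (schwartzL1 φ)) = (w : 𝓢'(ℝ, ℂ)) ∧
        ‖w‖ ≤ K * ‖schwartzL1 φ‖)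
    (f : L1) (hf : ∀ ξ, ξ < 0 → 𝓕 (f : ℝ → ℂ) ξ = 0)
    (h0 : ∫ x, f x * conj (boundary Θ x) = 0) :
    ∃ w : L1, hilbert (mulConj hΘ f) = (w : 𝓢'(ℝ, ℂ)) ∧ ‖w‖ ≤ K * ‖f‖ := by
  choose φ hφ hφ0 hφε using fun n : ℕ =>
    hΘ.exists_schwartz_near (integrable_L1 f) hf h0 (level_pos n)
  set p : ℕ → L1 := fun n => schwartzL1 (φ n) with hp
  have hplim : Tendsto p atTop (𝓝 f) := by
    rw [tendsto_iff_norm_sub_tendsto_zero]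
    refine squeeze_zero (fun n => norm_nonneg _) (fun n => ?_)
      tendsto_one_div_add_atTop_nhds_zero_nat
    rw [← norm_neg, neg_sub, L1.norm_eq_integral_norm]
    refine le_trans (le_of_eq (integral_congr_ae ?_)) (hφε n).le
    filter_upwards [Lp.coeFn_sub f (p n), coeFn_schwartzL1 (φ n)] with x h1 h2
    rw [h1, Pi.sub_apply, hp, h2]
  choose w hw hwn using fun n => hS (φ n) (hφ n) (hφ0 n)
  have hdiff : ∀ n m, ‖w n - w m‖ ≤ K * ‖p n - p m‖ := by
    intro n m
    obtain ⟨w', hw', hwn'⟩ := hS (φ n - φ m)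
      (fun ξ hξ => by
        have e : ((φ n - φ m : 𝓢(ℝ, ℂ)) : ℝ → ℂ) = (φ n : ℝ → ℂ) - (φ m : ℝ → ℂ) := rfl
        rw [e, fourier_sub_apply (φ n).integrable (φ m).integrable, hφ n ξ hξ, hφ m ξ hξ,
          sub_zero])
      (by
        simp only [sub_apply, sub_mul]
        rw [integral_sub (hΘ.integrable_mul (φ n).integrable)
          (hΘ.integrable_mul (φ m).integrable), hφ0, hφ0, sub_zero])
    rw [schwartzL1_sub] at hw' hwn'
    -- Both sides represent the Hilbert transform of Θ̄(φ_n − φ_m), so the bound for w' is the bound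
    -- for the difference.
    have e : w n - w m = w' := by
      refine toTemperedDistribution_injective ?_
      simp only
      rw [coe_sub_L1, ← hw', mulConj_sub, map_sub, hw n, hw m]
    rw [e]
    exact hwn'
  have hcauchy : CauchySeq w := by
    have hpc := hplim.cauchySeq
    rw [cauchySeq_iff_tendsto_dist_atTop_0] at hpc ⊢
    have h1 := hpc.const_mul K
    rw [mul_zero] at h1
    refine squeeze_zero (fun n => dist_nonneg) (fun n => ?_) h1
    rw [dist_eq_norm, dist_eq_norm]
    exact hdiff _ _
  obtain ⟨w₀, hw₀⟩ := cauchySeq_tendsto_of_complete hcauchy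
  refine ⟨w₀, hilbert_eq_of_tendsto hw
    (((continuous_mulConj hΘ).tendsto f).comp hplim) hw₀, ?_⟩
  exact le_of_tendsto_of_tendsto' hw₀.norm (hplim.norm.const_mul K) hwn

/-- Only the analytic part needs the Toeplitz operator: for an antianalytic b, Θ̄b is again
antianalytic and H(Θ̄b) = iΘ̄b. -/
theorem multiplicationBounded_of_toeplitzBounded (hΘ : IsInner Θ)
    (h : ToeplitzBounded hΘ) : MultiplicationBounded hΘ := by
  obtain ⟨T, hT, C, hC⟩ := h
  have hS := exists_hilbert_mulConj_schwartz hΘ hT hC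
  refine multiplicationBounded_of_forall hΘ (C + 1) fun f => ?_
  set u : L1 := ((f : H1Real) : L1) with hu
  set w := hilbertL1 (f : H1Real) with hw
  have hH : hilbert u = (w : 𝓢'(ℝ, ℂ)) := (hilbertL1_spec _).symm
  set a := analyticPart u w with ha
  set b := antianalyticPart u w with hb
  have hab : a + b = u := analyticPart_add_antianalyticPart u w
  have hbF : ∀ {ξ : ℝ}, 0 ≤ ξ → 𝓕 (mulConj hΘ b : ℝ → ℂ) ξ = 0 := fun {ξ} hξ => by
    rw [fourier_congr (coeFn_mulConj hΘ b)]
    exact hΘ.fourier_conj_mul_eq_zero (integrable_L1 b)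
      (fun ξ hξ => fourier_antianalyticPart hH hξ) hξ
  -- This integral is the Fourier transform of Θ̄b at 0. It transfers the orthogonality condition
  -- from u to a.
  have hb0 : ∫ x, b x * conj (boundary Θ x) = 0 := by
    have h1 := hbF le_rfl
    rw [fourier_congr (coeFn_mulConj hΘ b), Real.fourier_real_eq_integral_exp_smul] at h1
    rw [← h1]
    refine integral_congr_ae (Eventually.of_forall fun x => ?_)
    simp [mul_comm]
  have ha0 : ∫ x, a x * conj (boundary Θ x) = 0 := by
    have h1 : ∫ x, u x * conj (boundary Θ x) = 0 := f.2
    have h2 : (fun x => u x * conj (boundary Θ x)) =ᵐ[volume] fun x =>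
        a x * conj (boundary Θ x) + b x * conj (boundary Θ x) := by
      have h3 := Lp.coeFn_add a b
      rw [hab] at h3
      filter_upwards [h3] with x hx
      rw [hx, Pi.add_apply, add_mul]
    rw [integral_congr_ae h2, integral_add (hΘ.integrable_mul (integrable_L1 a))
      (hΘ.integrable_mul (integrable_L1 b)), hb0, add_zero] at h1
    exact h1
  obtain ⟨wa, hwa, hwan⟩ := exists_hilbert_mulConj_of_spectrum hΘ hS a
    (fun ξ hξ => fourier_analyticPart hH hξ) ha0
  refine ⟨wa + I • mulConj hΘ b, ?_, ?_⟩
  · rw [← hab, mulConj_add, map_add, hwa, coe_add_L1,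
      hilbert_eq_of_fourier_pos fun ξ hξ => hbF (le_of_lt hξ)]
  · have h1 : ‖a‖ ≤ h1Norm f / 2 := norm_analyticPart_le u w
    have h2 : ‖b‖ ≤ h1Norm f / 2 := norm_antianalyticPart_le u w
    -- Each part has at most half the H¹(ℝ) norm, so the constant is (2C + 1)/2 + 1/2 = C + 1.
    calc ‖wa + I • mulConj hΘ b‖ ≤ ‖wa‖ + ‖b‖ := by
          refine (norm_add_le _ _).trans (le_of_eq ?_)
          rw [norm_smul, norm_I, one_mul, norm_mulConj]
      _ ≤ (2 * C + 1) * (h1Norm f / 2) + h1Norm f / 2 := by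
          refine add_le_add (hwan.trans ?_) h2
          gcongr
      _ = (C + 1) * h1Norm f := by ring

end HardyToeplitz

end

theorem mainTheorem4 {Θ : ℍ → ℂ} (hΘ : HardyToeplitz.IsInner Θ) :
    List.TFAE [
      HardyToeplitz.ToeplitzBounded hΘ,
      HardyToeplitz.CommutatorBounded hΘ,
      HardyToeplitz.MultiplicationBounded hΘ] := by
  tfae_have 1 → 3 := HardyToeplitz.multiplicationBounded_of_toeplitzBounded hΘ
  tfae_have 3 → 1 := HardyToeplitz.toeplitzBounded_of_multiplicationBounded hΘ
  tfae_have 2 ↔ 3 := HardyToeplitz.commutatorBounded_iff_multiplicationBounded hΘ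
  tfae_finish
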